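/- Let $a:\mathbb R\to\mathbb R$ be a measurable function such that $0<a_0\le a(x)\le A_0$ for a.e. $x\in\mathbb R$, with constants $a_0,A_0$. Functions in $\dot H^1(\mathbb R)$ (weakly differentiable functions with $\partial_x\varphi\in L^2(\mathbb R)$) are identified with their continuous representatives, and derivatives are understood in the sense of distributions. For continuous $\varphi:\mathbb R\to\mathbb R$ consider the constraints $$\varphi(0)=0,\qquad \varphi(\pm\infty)=\pm\tfrac{\pi}{2},\tag{C}$$ and the energy $$G(\varphi)=\int_{\mathbb R}\Big(a(x)(\partial_x\varphi)^2+a(x)\cos^2\varphi\Big)\,dx\in[0,\infty],$$ with $G(\varphi)=\infty$ if $\varphi$ is not weakly differentiable. There exists exactly one solution $\varphi\in\dot H^1(\mathbb R)$ of the weighted pendulum equation $$\partial_x\big(a(x)\partial_x\varphi\big)+a(x)\sin\varphi\cos\varphi=0\tag{E}$$ in $\mathbb R\setminus\{0\}$ that satisfies (C) and $-\frac{\pi}{2}\le\varphi(-x)\le 0\le\varphi(x)\le\frac{\pi}{2}$ for every $x>0$. This solution $\varphi$ is Lipschitz and strictly increasing on $\mathbb R$; the function $a\,\partial_x\varphi$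 belongs to $W^{1,\infty}(\mathbb R\setminus\{0\})$ and its continuous representative on $\mathbb R\setminus\{0\}$ is positive everywhere there; $G(\varphi)<\infty$, and $\varphi$ is the unique minimizer of $G$ among all continuous functions that satisfy (C). If, in addition, $a$ is even on $\mathbb R$ and non-decreasing on $\mathbb R_+=(0,\infty)$, then $\varphi$ is odd, $\varphi$ solves (E) in the whole of $\mathbb R$, and $\varphi$ is stable: for every $\eta\in H^1(\mathbb R)$, the function $t\mapsto G(\varphi+t\eta)$ is finite and differentiable on $\mathbb R$, its derivative is differentiable at $t=0$, and $$Q(\eta):=\frac12\frac{d^2}{dt^2}\Big|_{t=0}G(\varphi+t\eta)=\int_{\mathbb R}\Big(a(x)(\partial_x\eta)^2-a(x)\cos(2\varphi(x))\,\eta^2\Big)\,dx\ \ge\ 0.$$ -/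

import Mathlib

open MeasureTheory Set Filter Topology
open scoped ContDiff ENNReal NNReal

noncomputable section

namespace Pendulum

/-- `g` is the weak (distributional) derivative of `f` on the open set `Ω ⊆ ℝ`: both are locally
integrable on `Ω`, and `∫ f ψ' = - ∫ g ψ` for every test function `ψ ∈ C_c^∞(Ω)`. -/
def HasWeakDerivOn (Ω : Set ℝ) (f g : ℝ → ℝ) : Prop :=
  LocallyIntegrableOn f Ω volume ∧ LocallyIntegrableOn g Ω volume ∧
    ∀ ψ : ℝ → ℝ, ContDiff ℝ ∞ ψ → HasCompactSupport ψ → tsupport ψ ⊆ Ω →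
      ∫ x, f x * deriv ψ x = - ∫ x, g x * ψ x

/-- `f ∈ W^{1,1}_loc(ℝ)`: `f` has a weak derivative on `ℝ`. -/
def WeaklyDifferentiable (f : ℝ → ℝ) : Prop :=
  ∃ g : ℝ → ℝ, HasWeakDerivOn univ f g

open Classical in
/-- The weak derivative `∂ₓ f` of `f` on `ℝ` (well defined up to null sets; `0` by convention when
`f` is not weakly differentiable). -/
def weakDeriv (f : ℝ → ℝ) : ℝ → ℝ :=
  if h : WeaklyDifferentiable f then h.choose else 0

/-- `f ∈ Ḣ¹(ℝ)`, with `f` the continuous representative: `f` is weakly differentiable and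
`∂ₓ f ∈ L²(ℝ)`. -/
def MemHomH1 (f : ℝ → ℝ) : Prop :=
  Continuous f ∧ WeaklyDifferentiable f ∧ MemLp (weakDeriv f) 2 volume

/-- `η ∈ H¹(ℝ)`: `η ∈ L²(ℝ)` is weakly differentiable with `∂ₓ η ∈ L²(ℝ)`. -/
def MemH1 (η : ℝ → ℝ) : Prop :=
  MemLp η 2 volume ∧ WeaklyDifferentiable η ∧ MemLp (weakDeriv η) 2 volume

/-- `f ∈ W^{1,∞}(Ω)` for an open set `Ω ⊆ ℝ`. -/
def MemW1Infty (Ω : Set ℝ) (f : ℝ → ℝ) : Prop :=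
  MemLp f ⊤ (volume.restrict Ω) ∧
    ∃ g : ℝ → ℝ, HasWeakDerivOn Ω f g ∧ MemLp g ⊤ (volume.restrict Ω)

/-- The weighted pendulum equation `∂ₓ(a ∂ₓ φ) + a sin φ cos φ = 0` in the sense of distributions
on the open set `Ω`, for a function `φ` that is weakly differentiable on `ℝ`. -/
def SolvesPendulumOn (a : ℝ → ℝ) (Ω : Set ℝ) (φ : ℝ → ℝ) : Prop :=
  HasWeakDerivOn Ω (fun x => a x * weakDeriv φ x)
    (fun x => -(a x * Real.sin (φ x) * Real.cos (φ x)))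

/-- The constraints `φ(0) = 0` and `φ(±∞) = ±π/2`. -/
def WallConstraints (φ : ℝ → ℝ) : Prop :=
  φ 0 = 0 ∧ Tendsto φ atTop (𝓝 (Real.pi / 2)) ∧ Tendsto φ atBot (𝓝 (-(Real.pi / 2)))

/-- `φ ∈ Ḣ¹(ℝ)` solves the weighted pendulum equation on `ℝ ∖ {0}`, satisfies the constraints, and
`-π/2 ≤ φ(-x) ≤ 0 ≤ φ(x) ≤ π/2` for every `x > 0`. -/
def IsWallSolution (a φ : ℝ → ℝ) : Prop :=
  MemHomH1 φ ∧ SolvesPendulumOn a {0}ᶜ φ ∧ WallConstraints φ ∧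
    ∀ x : ℝ, 0 < x →
      -(Real.pi / 2) ≤ φ (-x) ∧ φ (-x) ≤ 0 ∧ 0 ≤ φ x ∧ φ x ≤ Real.pi / 2

open Classical in
/-- The energy `G(φ) = ∫ a (∂ₓ φ)² + a cos² φ ∈ [0, ∞]`, which is `∞` when `φ` is not weakly
differentiable. -/
def energy (a φ : ℝ → ℝ) : ℝ≥0∞ :=
  if WeaklyDifferentiable φ then
    ∫⁻ x, ENNReal.ofReal (a x * weakDeriv φ x ^ 2 + a x * Real.cos (φ x) ^ 2)
  else ⊤

/-- `φ` minimizes `G` among all continuous functions that satisfy the constraints. -/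
def IsConstrainedMinimizer (a φ : ℝ → ℝ) : Prop :=
  Continuous φ ∧ WallConstraints φ ∧
    ∀ ψ : ℝ → ℝ, Continuous ψ → WallConstraints ψ → energy a φ ≤ energy a ψ

/-- The integrand `a (∂ₓ η)² - a cos(2φ) η²` of the second variation. -/
def secondVariationDensity (a φ η : ℝ → ℝ) (x : ℝ) : ℝ :=
  a x * weakDeriv η x ^ 2 - a x * Real.cos (2 * φ x) * η x ^ 2

/-- The quadratic form `Q(η) = ∫ a (∂ₓ η)² - a cos(2φ) η²`. -/
def secondVariation (a φ η : ℝ → ℝ) : ℝ :=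
  ∫ x, secondVariationDensity a φ η x

/-- `Q(η)` is one half of the second derivative at `t = 0` of `t ↦ G(φ + t η)`: this function is
finite and differentiable on `ℝ`, its derivative is differentiable at `0` with value `2 Q(η)`, and
the integral that defines `Q(η)` converges. -/
def IsHalfSecondDerivOfEnergy (a φ η : ℝ → ℝ) : Prop :=
  (∀ t : ℝ, energy a (fun x => φ x + t * η x) ≠ ⊤) ∧
    Integrable (secondVariationDensity a φ η) volume ∧
    Differentiable ℝ (fun t : ℝ => (energy a (fun x => φ x + t * η x)).toReal) ∧
    HasDerivAt (deriv fun t : ℝ => (energy a (fun x => φ x + t * η x)).toReal)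
      (2 * secondVariation a φ η) 0

end Pendulum

end

/-! On each half-line the equation is the first order system `φ' = ξ / b`, `ξ' = -b sin φ cos φ` for
the angle and the flux `ξ = a φ'`, where `b` is a version of `a` that obeys the bounds at every
point. The basic quantity is `ξ² - c² cos² φ`: it is conserved when `b = c`, and otherwise its
derivative has the sign of `c² - b²` while `0 ≤ φ ≤ π/2` and `ξ ≥ 0` (`hasAEDeriv_sq_sub`). Along a
wall it vanishes at infinity, so `c = a₀` and `c = A₀` give `a₀ cos φ ≤ ξ ≤ A₀ cos φ`. With
Grönwall's inequality this yields `cos φ > 0` and `ξ > 0`, hence strict monotonicity and finite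
energy.

Existence is by shooting in the initial flux. Overshooting `π/2` and turning back are disjoint open
conditions, and the infimum of the overshooting fluxes satisfies neither (`exists_halfLineWall`).

Minimality is a calibration (`calibration_Icc`). With `w = ξ / sin φ`, the energy density of a
competitor `ψ` exceeds that of `φ` by at least `b (cos ψ - cos φ)²` plus the derivative of `-2 w
(cos ψ - cos φ)`, whose boundary values do no harm in the limit. Equality forces `cos ψ = cos φ` and
then `ψ = φ`. Every wall solution is a profile of this kind, hence the unique minimizer, so
uniqueness of solutions comes for free.

If `a` is even, reflection and uniqueness make `φ` odd, and the flux has no jump at `0`. If `a` also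
increases on the right half-line, the choice `c = b x` improves the lower bound to `b cos φ ≤ ξ`.
Adding the derivative of `ξ tan φ η²` to the density of `Q(η)` then completes a square with a
nonnegative remainder. -/

namespace Pendulum

/-! ### Calculus of absolutely continuous functions -/

/-- `f` is absolutely continuous on `[u, v]` with almost everywhere derivative `g`. -/
structure HasAEDeriv (f g : ℝ → ℝ) (u v : ℝ) : Prop where
  ac : AbsolutelyContinuousOnInterval f u v
  ae : ∀ᵐ x, x ∈ Ioo u v → HasDerivAt f (g x) x

namespace HasAEDeriv

variable {f g f₁ g₁ f₂ g₂ : ℝ → ℝ} {u v : ℝ}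

lemma ae_deriv_eq (h : HasAEDeriv f g u v) (huv : u ≤ v) :
    ∀ᵐ x, x ∈ uIoc u v → deriv f x = g x := by
  filter_upwards [h.ae, compl_mem_ae_iff.2 (measure_singleton v : volume {v} = 0)] with x hx hxv hxI
  rw [uIoc_of_le huv] at hxI
  exact (hx ⟨hxI.1, lt_of_le_of_ne hxI.2 hxv⟩).deriv

lemma intervalIntegrable (h : HasAEDeriv f g u v) (huv : u ≤ v) :
    IntervalIntegrable g volume u v :=
  h.ac.intervalIntegrable_deriv.congr_ae
    ((ae_restrict_iff' measurableSet_uIoc).2 (h.ae_deriv_eq huv))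

lemma integral_eq (h : HasAEDeriv f g u v) (huv : u ≤ v) : ∫ x in u..v, g x = f v - f u := by
  rw [← h.ac.integral_deriv_eq_sub]
  refine intervalIntegral.integral_congr_ae ?_
  filter_upwards [h.ae_deriv_eq huv] with x hx hxI using (hx hxI).symm

lemma continuousOn (h : HasAEDeriv f g u v) (huv : u ≤ v) : ContinuousOn f (Icc u v) := by
  simpa [uIcc_of_le huv] using h.ac.continuousOn

lemma congr_deriv (h : HasAEDeriv f g u v) {g' : ℝ → ℝ}
    (hg : ∀ᵐ x, x ∈ Ioo u v → g x = g' x) : HasAEDeriv f g' u v :=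
  ⟨h.ac, by filter_upwards [h.ae, hg] with x h1 h2 hx using h2 hx ▸ h1 hx⟩

lemma sub (h₁ : HasAEDeriv f₁ g₁ u v) (h₂ : HasAEDeriv f₂ g₂ u v) :
    HasAEDeriv (fun x => f₁ x - f₂ x) (fun x => g₁ x - g₂ x) u v :=
  ⟨h₁.ac.sub h₂.ac, by filter_upwards [h₁.ae, h₂.ae] with x h1 h2 hx using (h1 hx).sub (h2 hx)⟩

lemma mul (h₁ : HasAEDeriv f₁ g₁ u v) (h₂ : HasAEDeriv f₂ g₂ u v) :
    HasAEDeriv (fun x => f₁ x * f₂ x) (fun x => g₁ x * f₂ x + f₁ x * g₂ x) u v :=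
  ⟨h₁.ac.mul h₂.ac, by filter_upwards [h₁.ae, h₂.ae] with x h1 h2 hx using (h1 hx).mul (h2 hx)⟩

lemma const_mul (c : ℝ) (h : HasAEDeriv f g u v) :
    HasAEDeriv (fun x => c * f x) (fun x => c * g x) u v :=
  ⟨h.ac.const_mul c, by filter_upwards [h.ae] with x h1 hx using (h1 hx).const_mul c⟩

/-- The image of `[u, v]` is a compact interval on which the C¹ function `F` is Lipschitz, and
Lipschitz maps preserve absolute continuity. Smoothness is only asked on the range of `f`, so that
reciprocals of non-vanishing functions are covered. -/
lemma comp (h : HasAEDeriv f g u v) (huv : u ≤ v) {F : ℝ → ℝ}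
    (hF : ∀ x ∈ Icc u v, ContDiffAt ℝ 1 F (f x)) :
    HasAEDeriv (fun x => F (f x)) (fun x => deriv F (f x) * g x) u v := by
  have hc := h.continuousOn huv
  have hconv : Convex ℝ (f '' Icc u v) :=
    ((isPreconnected_Icc.image f hc).ordConnected).convex
  have hcd : ContDiffOn ℝ 1 F (f '' Icc u v) := by
    rintro _ ⟨x, hx, rfl⟩
    exact (hF x hx).contDiffWithinAt
  obtain ⟨K, hK⟩ := hcd.exists_lipschitzOnWith (by decide) hconv (isCompact_Icc.image_of_continuousOn hc)
  refine ⟨?_, ?_⟩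
  · have hac := h.ac
    unfold AbsolutelyContinuousOnInterval at hac ⊢
    refine squeeze_zero' (g := fun E : ℕ × (ℕ → ℝ × ℝ) =>
      K * ∑ i ∈ Finset.range E.1, dist (f (E.2 i).1) (f (E.2 i).2)) ?_ ?_ ?_
    · exact Eventually.of_forall fun E => Finset.sum_nonneg fun i _ => dist_nonneg
    · refine Filter.eventually_of_mem (mem_inf_of_right (mem_principal_self _)) fun E hE => ?_
      rw [Finset.mul_sum]
      refine Finset.sum_le_sum fun i hi => ?_
      have := hE.1 i hi
      rw [uIcc_of_le huv] at this
      exact hK.dist_le_mul _ (mem_image_of_mem _ this.1) _ (mem_image_of_mem _ this.2)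
    · simpa using hac.const_mul (K : ℝ)
  · filter_upwards [h.ae] with x hx hxI
    exact ((hF x (Ioo_subset_Icc_self hxI)).differentiableAt one_ne_zero).hasDerivAt.comp x (hx hxI)

lemma of_integral (huv : u ≤ v) (hg : IntervalIntegrable g volume u v) {c : ℝ}
    (hf : ∀ x ∈ Icc u v, f x = c + ∫ t in u..x, g t) : HasAEDeriv f g u v := by
  have hac := hg.absolutelyContinuousOnInterval_intervalIntegral (c := u) (by simp)
  refine ⟨?_, ?_⟩
  · have : AbsolutelyContinuousOnInterval (fun x => c + ∫ t in u..x, g t) u v :=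
      (contDiffOn_const.absolutelyContinuousOnInterval).add hac
    unfold AbsolutelyContinuousOnInterval at this ⊢
    refine this.congr' ?_
    refine Filter.eventually_of_mem (mem_inf_of_right (mem_principal_self _)) fun E hE => ?_
    refine Finset.sum_congr rfl fun i hi => ?_
    have := hE.1 i hi
    rw [uIcc_of_le huv] at this
    rw [hf _ this.1, hf _ this.2]
  · filter_upwards [hg.ae_hasDerivAt_integral] with x hx hxI
    have := (hx (by rw [uIcc_of_le huv]; exact Ioo_subset_Icc_self hxI) u (by simp)).const_add c
    refine this.congr_of_eventuallyEq ?_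
    filter_upwards [Ioo_mem_nhds hxI.1 hxI.2] with y hy using hf y (Ioo_subset_Icc_self hy)

end HasAEDeriv

end Pendulum

/-! ### Weak derivatives and primitives -/

namespace Pendulum

lemma intervalIntegrable_of_locallyIntegrable {g : ℝ → ℝ} (hg : LocallyIntegrable g volume)
    (u v : ℝ) : IntervalIntegrable g volume u v :=
  (hg.integrableOn_isCompact isCompact_uIcc).intervalIntegrable

lemma integrable_mul_of_tsupport_subset {Ω : Set ℝ} {g ψ : ℝ → ℝ}
    (hg : LocallyIntegrableOn g Ω volume) (hψ : Continuous ψ) (hc : HasCompactSupport ψ)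
    (hs : tsupport ψ ⊆ Ω) : Integrable (fun x => g x * ψ x) volume := by
  have h1 : IntegrableOn g (tsupport ψ) := hg.integrableOn_compact_subset hs hc
  have h2 : IntegrableOn (fun x => g x * ψ x) (tsupport ψ) :=
    h1.mul_continuousOn hψ.continuousOn hc
  refine (integrableOn_iff_integrable_of_support_subset ?_).1 h2
  intro x hx
  exact subset_tsupport ψ (right_ne_zero_of_mul hx)

lemma contDiff_deriv_of_contDiff {ψ : ℝ → ℝ} (hψ : ContDiff ℝ ∞ ψ) : ContDiff ℝ ∞ (deriv ψ) :=
  (contDiff_infty_iff_deriv.1 hψ).2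

lemma tsupport_deriv_subset' {ψ : ℝ → ℝ} : tsupport (deriv ψ) ⊆ tsupport ψ :=
  closure_minimal support_deriv_subset isClosed_closure

lemma HasWeakDerivOn.ae_unique {Ω : Set ℝ} (hΩ : IsOpen Ω) {f g₁ g₂ : ℝ → ℝ}
    (h₁ : HasWeakDerivOn Ω f g₁) (h₂ : HasWeakDerivOn Ω f g₂) :
    ∀ᵐ x, x ∈ Ω → g₁ x = g₂ x := by
  have : ∀ᵐ x, x ∈ Ω → (g₁ - g₂) x = 0 := by
    refine hΩ.ae_eq_zero_of_integral_contDiff_smul_eq_zero (h₁.2.1.sub h₂.2.1) ?_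
    intro ψ hψ hc hs
    have e1 := h₁.2.2 ψ hψ hc hs
    have e2 := h₂.2.2 ψ hψ hc hs
    have i1 := integrable_mul_of_tsupport_subset h₁.2.1 hψ.continuous hc hs
    have i2 := integrable_mul_of_tsupport_subset h₂.2.1 hψ.continuous hc hs
    have : ∫ x, ψ x • (g₁ - g₂) x = (∫ x, g₁ x * ψ x) - ∫ x, g₂ x * ψ x := by
      rw [← integral_sub i1 i2]
      congr 1; ext x; simp; ring
    rw [this]; linarith
  filter_upwards [this] with x hx hxΩ using sub_eq_zero.1 (hx hxΩ)

/-- This allows `a` to be traded for a representative with pointwise bounds, and `a ∂ₓφ` for its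
continuous version. -/
lemma HasWeakDerivOn.congr {Ω : Set ℝ} (hΩ : MeasurableSet Ω) {f f' g g' : ℝ → ℝ}
    (h : HasWeakDerivOn Ω f g) (hf : ∀ᵐ x, x ∈ Ω → f x = f' x)
    (hg : ∀ᵐ x, x ∈ Ω → g x = g' x) : HasWeakDerivOn Ω f' g' := by
  have hf' := (ae_restrict_iff' hΩ).2 hf
  have hg' := (ae_restrict_iff' hΩ).2 hg
  have aux : ∀ {k k' : ℝ → ℝ}, LocallyIntegrableOn k Ω volume →
      k =ᵐ[volume.restrict Ω] k' → LocallyIntegrableOn k' Ω volume := by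
    intro k k' hk hkk x hx
    obtain ⟨s, hs, hi⟩ := hk x hx
    refine ⟨s ∩ Ω, inter_mem hs self_mem_nhdsWithin, ?_⟩
    have := hi.mono_set (inter_subset_left (t := Ω))
    exact this.congr (ae_mono (Measure.restrict_mono inter_subset_right le_rfl) hkk)
  refine ⟨aux h.1 hf', aux h.2.1 hg', fun ψ hψ hc hs => ?_⟩
  have e := h.2.2 ψ hψ hc hs
  have e1 : ∫ x, f' x * deriv ψ x = ∫ x, f x * deriv ψ x := by
    refine integral_congr_ae ?_
    filter_upwards [hf] with x hx
    by_cases hxΩ : x ∈ Ω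
    · simp only [hx hxΩ]
    · simp only [image_eq_zero_of_notMem_tsupport
        (fun hx' => hxΩ (hs (tsupport_deriv_subset' hx'))), mul_zero]
  have e2 : ∫ x, g' x * ψ x = ∫ x, g x * ψ x := by
    refine integral_congr_ae ?_
    filter_upwards [hg] with x hx
    by_cases hxΩ : x ∈ Ω
    · simp only [hx hxΩ]
    · simp only [image_eq_zero_of_notMem_tsupport (fun hx' => hxΩ (hs hx')), mul_zero]
  rw [e1, e2, e]

lemma HasWeakDerivOn.mono {Ω Ω' : Set ℝ} {f g : ℝ → ℝ} (h : HasWeakDerivOn Ω f g)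
    (hs : Ω' ⊆ Ω) : HasWeakDerivOn Ω' f g :=
  ⟨h.1.mono_set hs, h.2.1.mono_set hs, fun ψ h1 h2 h3 => h.2.2 ψ h1 h2 (h3.trans hs)⟩

lemma HasWeakDerivOn.add {Ω : Set ℝ} {f₁ g₁ f₂ g₂ : ℝ → ℝ} (h₁ : HasWeakDerivOn Ω f₁ g₁)
    (h₂ : HasWeakDerivOn Ω f₂ g₂) :
    HasWeakDerivOn Ω (fun x => f₁ x + f₂ x) (fun x => g₁ x + g₂ x) := by
  refine ⟨h₁.1.add h₂.1, h₁.2.1.add h₂.2.1, fun ψ hψ hc hs => ?_⟩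
  have hd := (contDiff_deriv_of_contDiff hψ).continuous
  have hs' := (tsupport_deriv_subset' (ψ := ψ)).trans hs
  simp only [add_mul]
  rw [integral_add (integrable_mul_of_tsupport_subset h₁.1 hd hc.deriv hs')
      (integrable_mul_of_tsupport_subset h₂.1 hd hc.deriv hs'),
    integral_add (integrable_mul_of_tsupport_subset h₁.2.1 hψ.continuous hc hs)
      (integrable_mul_of_tsupport_subset h₂.2.1 hψ.continuous hc hs),
    h₁.2.2 ψ hψ hc hs, h₂.2.2 ψ hψ hc hs]
  ring

lemma HasWeakDerivOn.const_mul {Ω : Set ℝ} {f g : ℝ → ℝ} (c : ℝ) (h : HasWeakDerivOn Ω f g) :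
    HasWeakDerivOn Ω (fun x => c * f x) (fun x => c * g x) := by
  refine ⟨fun x hx => ?_, fun x hx => ?_, fun ψ hψ hc hs => ?_⟩
  · obtain ⟨s, hs, hi⟩ := h.1 x hx
    exact ⟨s, hs, hi.const_mul c⟩
  · obtain ⟨s, hs, hi⟩ := h.2.1 x hx
    exact ⟨s, hs, hi.const_mul c⟩
  · simp only [mul_assoc]
    rw [integral_const_mul, integral_const_mul, h.2.2 ψ hψ hc hs]
    ring

lemma exists_support_subset_Ioo {ψ : ℝ → ℝ} (hc : HasCompactSupport ψ) :
    ∃ R > 0, tsupport ψ ⊆ Ioo (-R) R := by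
  obtain ⟨R, hR, h⟩ := hc.isBounded.subset_ball_lt 0 0
  exact ⟨R, hR, by simpa [Real.ball_eq_Ioo] using h⟩

lemma hasAEDeriv_of_contDiff {ψ : ℝ → ℝ} (hψ : ContDiff ℝ 1 ψ) (u v : ℝ) :
    HasAEDeriv ψ (deriv ψ) u v :=
  ⟨hψ.contDiffOn.absolutelyContinuousOnInterval,
    Eventually.of_forall fun x _ => (hψ.differentiable one_ne_zero x).hasDerivAt⟩

/-- Integration by parts for absolutely continuous functions on an interval `[-R, R]` whose interior
contains the support of the test function. -/
lemma hasWeakDerivOn_of_integral {f g : ℝ → ℝ} (hg : LocallyIntegrable g volume) {c : ℝ}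
    (hf : ∀ x, f x = c + ∫ t in (0 : ℝ)..x, g t) : HasWeakDerivOn univ f g := by
  have hgi : ∀ u v, IntervalIntegrable g volume u v := fun u v => intervalIntegrable_of_locallyIntegrable hg u v
  have hcont : Continuous f := by
    have : f = fun x => c + ∫ t in (0 : ℝ)..x, g t := funext hf
    rw [this]
    exact continuous_const.add (intervalIntegral.continuous_primitive hgi 0)
  refine ⟨hcont.locallyIntegrable.locallyIntegrableOn _, hg.locallyIntegrableOn _,
    fun ψ hψ hc _ => ?_⟩
  obtain ⟨R, hR, hsR⟩ := exists_support_subset_Ioo hc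
  have hR' : -R ≤ R := by linarith
  have h1 : HasAEDeriv f g (-R) R := by
    refine HasAEDeriv.of_integral hR' (hgi _ _) (c := f (-R)) fun x _ => ?_
    rw [hf x, hf (-R), ← intervalIntegral.integral_add_adjacent_intervals (hgi 0 (-R)) (hgi (-R) x)]
    ring
  have h2 := h1.mul (hasAEDeriv_of_contDiff (hψ.of_le (by exact_mod_cast le_top)) (-R) R)
  have e := h2.integral_eq hR'
  have z1 : ψ R = 0 := image_eq_zero_of_notMem_tsupport fun h => lt_irrefl _ (hsR h).2
  have z2 : ψ (-R) = 0 := image_eq_zero_of_notMem_tsupport fun h => lt_irrefl _ (hsR h).1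
  rw [z1, z2] at e
  have i1 := integrable_mul_of_tsupport_subset (hg.locallyIntegrableOn univ) hψ.continuous hc
    (subset_univ _)
  have i2 := integrable_mul_of_tsupport_subset (hcont.locallyIntegrable.locallyIntegrableOn univ)
    (contDiff_deriv_of_contDiff hψ).continuous hc.deriv (subset_univ _)
  rw [intervalIntegral.integral_eq_integral_of_support_subset, integral_add i1 i2] at e
  · linarith
  · intro x hx
    by_contra hcon
    have hx' : x ∉ tsupport ψ := fun h => hcon ⟨(hsR h).1, (hsR h).2.le⟩
    apply hx
    have a1 : ψ x = 0 := image_eq_zero_of_notMem_tsupport hx'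
    have a2 : deriv ψ x = 0 :=
      image_eq_zero_of_notMem_tsupport fun h => hx' (tsupport_deriv_subset' h)
    simp [a1, a2]

/-- A smooth compactly supported function with zero mean is the derivative of a smooth function
supported in the convex hull of its support. -/
lemma exists_primitive_of_integral_eq_zero {Ω : Set ℝ} (hΩ : Ω.OrdConnected) {θ : ℝ → ℝ}
    (hθ : ContDiff ℝ ∞ θ) (hc : HasCompactSupport θ) (hs : tsupport θ ⊆ Ω)
    (h0 : ∫ x, θ x = 0) :
    ∃ Ψ : ℝ → ℝ, ContDiff ℝ ∞ Ψ ∧ HasCompactSupport Ψ ∧ tsupport Ψ ⊆ Ω ∧ deriv Ψ = θ := by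
  rcases (tsupport θ).eq_empty_or_nonempty with hemp | hne
  · have : θ = 0 := by
      ext x; exact image_eq_zero_of_notMem_tsupport (by simp [hemp])
    exact ⟨0, contDiff_const, HasCompactSupport.zero, by simp [tsupport], by
      rw [this]; ext x; simp⟩
  obtain ⟨p, hp, hpl⟩ := hc.exists_isLeast hne
  obtain ⟨q, hq, hql⟩ := hc.exists_isGreatest hne
  have hθc := hθ.continuous
  have hint : ∀ u v, IntervalIntegrable θ volume u v := fun u v => hθc.intervalIntegrable u v
  -- The integral starts at the left end `p` of the support; zero mean makes it vanish again beyond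
  -- the right end `q`.
  set Ψ : ℝ → ℝ := fun x => ∫ t in p..x, θ t with hΨ
  have hder : ∀ x, HasDerivAt Ψ (θ x) x := fun x =>
    intervalIntegral.integral_hasDerivAt_right (hint p x)
      hθc.stronglyMeasurable.stronglyMeasurableAtFilter hθc.continuousAt
  have hd : deriv Ψ = θ := funext fun x => (hder x).deriv
  have hz : ∀ x, x ∉ Icc p q → Ψ x = 0 := by
    intro x hx
    by_cases hxp : x < p
    · have : ∫ t in p..x, θ t = 0 := by
        rw [intervalIntegral.integral_symm, neg_eq_zero]
        refine intervalIntegral.integral_zero_ae ?_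
        filter_upwards [compl_mem_ae_iff.2 (measure_singleton p : volume {p} = 0)] with t ht htI
        rw [uIoc_of_le hxp.le] at htI
        exact image_eq_zero_of_notMem_tsupport fun h => ht (le_antisymm htI.2 (hpl h))
      exact this
    · have hxq : q < x := by
        by_contra hcon
        exact hx ⟨not_lt.1 hxp, not_lt.1 hcon⟩
      have : ∫ t in p - 1..x, θ t = ∫ t, θ t := by
        refine intervalIntegral.integral_eq_integral_of_support_subset fun t ht => ?_
        have ht' := subset_tsupport θ ht
        exact ⟨by linarith [hpl ht'], by linarith [hql ht']⟩
      have h2 : ∫ t in p - 1..p, θ t = 0 := by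
        refine intervalIntegral.integral_zero_ae ?_
        filter_upwards [compl_mem_ae_iff.2 (measure_singleton p : volume {p} = 0)] with t ht htI
        rw [uIoc_of_le (by linarith)] at htI
        exact image_eq_zero_of_notMem_tsupport fun h => ht (le_antisymm htI.2 (hpl h))
      have h3 := intervalIntegral.integral_add_adjacent_intervals (hint (p - 1) p) (hint p x)
      rw [this, h0, h2, zero_add] at h3
      exact h3
  have hts : tsupport Ψ ⊆ Icc p q := by
    refine closure_minimal (fun x hx => ?_) isClosed_Icc
    by_contra hcon
    exact hx (hz x hcon)
  refine ⟨Ψ, ?_, ?_, hts.trans (hΩ.out (hs hp) (hs hq)), hd⟩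
  · exact contDiff_infty_iff_deriv.2 ⟨fun x => (hder x).differentiableAt, hd ▸ hθ⟩
  · exact isCompact_Icc.of_isClosed_subset isClosed_closure hts

/-- A locally integrable function with vanishing weak derivative on an open interval is constant. -/
lemma exists_ae_eq_const {Ω : Set ℝ} (ho : IsOpen Ω) (hΩ : Ω.OrdConnected) {h : ℝ → ℝ}
    (hl : LocallyIntegrableOn h Ω volume)
    (h0 : ∀ ψ : ℝ → ℝ, ContDiff ℝ ∞ ψ → HasCompactSupport ψ → tsupport ψ ⊆ Ω →
      ∫ x, h x * deriv ψ x = 0) : ∃ c, ∀ᵐ x, x ∈ Ω → h x = c := by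
  rcases Ω.eq_empty_or_nonempty with rfl | ⟨p, hp⟩
  · exact ⟨0, by simp⟩
  obtain ⟨r, hr, hrΩ⟩ := Metric.isOpen_iff.1 ho p hp
  let B : ContDiffBump p := ⟨r / 4, r / 2, by positivity, by linarith⟩
  set ρ : ℝ → ℝ := B.normed volume with hρ
  have hρc : ContDiff ℝ ∞ ρ := B.contDiff_normed
  have hρs : HasCompactSupport ρ := B.hasCompactSupport_normed
  have hρt : tsupport ρ ⊆ Ω := by
    rw [hρ, B.tsupport_normed_eq]
    exact (Metric.closedBall_subset_ball (by simp only [B]; linarith)).trans hrΩ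
  have hρ1 : ∫ x, ρ x = 1 := B.integral_normed
  set c := ∫ x, h x * ρ x with hc
  refine ⟨c, ?_⟩
  have key : ∀ᵐ x, x ∈ Ω → h x - c = 0 := by
    refine ho.ae_eq_zero_of_integral_contDiff_smul_eq_zero (f := fun x => h x - c)
      (hl.sub ((locallyIntegrable_const c).locallyIntegrableOn _)) fun χ hχ hχc hχs => ?_
    -- Since `ρ` has mass one, `χ - m ρ` has zero mean and is the derivative of a test function.
    -- Testing with it gives `∫ h χ = c ∫ χ`.
    set m := ∫ x, χ x with hm
    have iχ := hχ.continuous.integrable_of_hasCompactSupport hχc (μ := volume)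
    have iρ := hρc.continuous.integrable_of_hasCompactSupport hρs (μ := volume)
    have ihχ := integrable_mul_of_tsupport_subset hl hχ.continuous hχc hχs
    have ihρ := integrable_mul_of_tsupport_subset hl hρc.continuous hρs hρt
    obtain ⟨Ψ, h1, h2, h3, h4⟩ := exists_primitive_of_integral_eq_zero hΩ
      (θ := fun x => χ x - m * ρ x) (hχ.sub (contDiff_const.mul hρc))
      (hχc.sub (hρs.mul_left (f := fun _ => m))) (by
        refine (tsupport_sub χ (fun x => m * ρ x)).trans (union_subset hχs ?_)
        exact (tsupport_mul_subset_right (f := fun _ => m) (g := ρ)).trans hρt) (by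
        rw [integral_sub iχ (iρ.const_mul m), integral_const_mul, hρ1, ← hm]; ring)
    have e := h0 Ψ h1 h2 h3
    rw [h4] at e
    have e2 : ∫ x, h x * (χ x - m * ρ x) = (∫ x, h x * χ x) - m * c := by
      rw [hc, ← integral_const_mul, ← integral_sub ihχ (ihρ.const_mul m)]
      congr 1; ext x; ring
    have e3 : ∫ x, χ x • (h x - c) = (∫ x, h x * χ x) - c * m := by
      rw [hm, ← integral_const_mul, ← integral_sub ihχ (iχ.const_mul c)]
      congr 1; ext x; simp; ring
    rw [e3]; linarith
  filter_upwards [key] with x hx hxΩ using sub_eq_zero.1 (hx hxΩ)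

/-- The difference of `f` and the primitive of `g` has zero weak derivative on an interval, hence is
constant almost everywhere there. -/
lemma HasWeakDerivOn.exists_ae_eq_integral {Ω : Set ℝ} (ho : IsOpen Ω) (hΩ : Ω.OrdConnected)
    {f g : ℝ → ℝ} (h : HasWeakDerivOn Ω f g) (hg : LocallyIntegrable g volume) :
    ∃ c, ∀ᵐ x, x ∈ Ω → f x = c + ∫ t in (0 : ℝ)..x, g t := by
  have h2 := (hasWeakDerivOn_of_integral hg (c := 0) (fun x => rfl)).mono (subset_univ Ω)
  have h3 := h.add (h2.const_mul (-1))
  obtain ⟨c, hc⟩ := exists_ae_eq_const ho hΩ h3.1 fun ψ h1 h2 h4 => by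
    rw [h3.2.2 ψ h1 h2 h4]; simp
  refine ⟨c, ?_⟩
  filter_upwards [hc] with x hx hxΩ
  have := hx hxΩ
  linarith

lemma WeaklyDifferentiable.hasWeakDerivOn {f : ℝ → ℝ} (h : WeaklyDifferentiable f) :
    HasWeakDerivOn univ f (weakDeriv f) := by
  rw [weakDeriv, dif_pos h]
  exact h.choose_spec

lemma HasWeakDerivOn.weakDeriv_ae_eq {f g : ℝ → ℝ} (h : HasWeakDerivOn univ f g) :
    weakDeriv f =ᵐ[volume] g := by
  have := HasWeakDerivOn.ae_unique isOpen_univ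
    (WeaklyDifferentiable.hasWeakDerivOn ⟨g, h⟩) h
  filter_upwards [this] with x hx using hx (mem_univ x)

lemma WeaklyDifferentiable.locallyIntegrable {f : ℝ → ℝ} (h : WeaklyDifferentiable f) :
    LocallyIntegrable (weakDeriv f) volume :=
  locallyIntegrableOn_univ.1 h.hasWeakDerivOn.2.1

lemma WeaklyDifferentiable.exists_ae_eq_integral {f : ℝ → ℝ} (h : WeaklyDifferentiable f) :
    ∃ c, f =ᵐ[volume] fun x => c + ∫ t in (0 : ℝ)..x, weakDeriv f t := by
  obtain ⟨c, hc⟩ := h.hasWeakDerivOn.exists_ae_eq_integral isOpen_univ ordConnected_univ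
    h.locallyIntegrable
  exact ⟨c, by filter_upwards [hc] with x hx using hx (mem_univ x)⟩

lemma WeaklyDifferentiable.eq_integral {f : ℝ → ℝ} (h : WeaklyDifferentiable f)
    (hf : Continuous f) (x : ℝ) : f x = f 0 + ∫ t in (0 : ℝ)..x, weakDeriv f t := by
  obtain ⟨c, hc⟩ := h.exists_ae_eq_integral
  have hgi : ∀ u v, IntervalIntegrable (weakDeriv f) volume u v :=
    fun u v => intervalIntegrable_of_locallyIntegrable h.locallyIntegrable u v
  have := Continuous.ae_eq_iff_eq (μ := volume) hf
    (continuous_const.add (intervalIntegral.continuous_primitive hgi 0)) |>.1 hc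
  have h0 : f 0 = c := by rw [this]; simp
  rw [h0]
  exact congrFun this x

end Pendulum

/-! ### Monotonicity from almost everywhere derivatives -/

namespace Pendulum

namespace HasAEDeriv

variable {f g f₁ g₁ f₂ g₂ : ℝ → ℝ} {u v : ℝ}

lemma le_of_nonneg (h : HasAEDeriv f g u v) (huv : u ≤ v)
    (hg : ∀ᵐ x, x ∈ Ioo u v → 0 ≤ g x) : f u ≤ f v := by
  have h1 : 0 ≤ ∫ x in u..v, g x := by
    refine intervalIntegral.integral_nonneg_of_ae_restrict huv ?_
    rw [restrict_Ioo_eq_restrict_Icc.symm]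
    exact (ae_restrict_iff' measurableSet_Ioo).2 hg
  rw [h.integral_eq huv] at h1
  linarith

lemma lt_of_pos (h : HasAEDeriv f g u v) (huv : u < v) (hg : ∀ x ∈ Ioo u v, 0 < g x) :
    f u < f v := by
  have h1 := intervalIntegral.intervalIntegral_pos_of_pos_on (h.intervalIntegrable huv.le) hg huv
  rw [h.integral_eq huv.le] at h1
  linarith

lemma id_mul (c u v : ℝ) : HasAEDeriv (fun x => c * x) (fun _ => c) u v := by
  have := hasAEDeriv_of_contDiff (ψ := fun x : ℝ => c * x) (by fun_prop) u v
  refine this.congr_deriv (Eventually.of_forall fun x _ => ?_)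
  simp

lemma sub_le_mul (h : HasAEDeriv f g u v) (huv : u ≤ v) {C : ℝ}
    (hg : ∀ᵐ x, x ∈ Ioo u v → g x ≤ C) : f v - f u ≤ C * (v - u) := by
  have := ((id_mul C u v).sub h).le_of_nonneg huv (by
    filter_upwards [hg] with x hx hxI
    linarith [hx hxI])
  linarith

lemma mul_le_sub (h : HasAEDeriv f g u v) (huv : u ≤ v) {c : ℝ}
    (hg : ∀ᵐ x, x ∈ Ioo u v → c ≤ g x) : c * (v - u) ≤ f v - f u := by
  have := (h.sub (id_mul c u v)).le_of_nonneg huv (by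
    filter_upwards [hg] with x hx hxI
    linarith [hx hxI])
  linarith

lemma sin (h : HasAEDeriv f g u v) (huv : u ≤ v) :
    HasAEDeriv (fun x => Real.sin (f x)) (fun x => Real.cos (f x) * g x) u v := by
  simpa using h.comp huv (F := Real.sin) fun x _ => Real.contDiff_sin.contDiffAt

lemma cos (h : HasAEDeriv f g u v) (huv : u ≤ v) :
    HasAEDeriv (fun x => Real.cos (f x)) (fun x => -Real.sin (f x) * g x) u v := by
  simpa using h.comp huv (F := Real.cos) fun x _ => Real.contDiff_cos.contDiffAt

lemma inv (h : HasAEDeriv f g u v) (huv : u ≤ v) (h0 : ∀ x ∈ Icc u v, f x ≠ 0) :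
    HasAEDeriv (fun x => (f x)⁻¹) (fun x => -(f x ^ 2)⁻¹ * g x) u v := by
  simpa using h.comp huv (F := fun y => y⁻¹) fun x hx => contDiffAt_inv ℝ (h0 x hx)

end HasAEDeriv

/-! ### The half-line system and a priori bounds for its walls -/

/-- A measurable coefficient with values in `[a₀, A₀]`, `a₀ > 0`. -/
structure IsCoeff (b : ℝ → ℝ) (a₀ A₀ : ℝ) : Prop where
  meas : Measurable b
  pos : 0 < a₀
  lb : ∀ x, a₀ ≤ b x
  ub : ∀ x, b x ≤ A₀

namespace IsCoeff

variable {b : ℝ → ℝ} {a₀ A₀ : ℝ}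

lemma pos' (hb : IsCoeff b a₀ A₀) (x : ℝ) : 0 < b x := hb.pos.trans_le (hb.lb x)

lemma upper_pos (hb : IsCoeff b a₀ A₀) : 0 < A₀ := (hb.pos' 0).trans_le (hb.ub 0)

lemma locallyIntegrable_mul (hb : IsCoeff b a₀ A₀) {f : ℝ → ℝ} (hf : LocallyIntegrable f volume) :
    LocallyIntegrable (fun x => b x * f x) volume := by
  rw [locallyIntegrable_iff]
  intro k hk
  refine Integrable.bdd_mul (c := A₀) (hf.integrableOn_isCompact hk)
    hb.meas.aestronglyMeasurable.restrict (Eventually.of_forall fun x => ?_)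
  rw [Real.norm_of_nonneg (hb.pos' x).le]
  exact hb.ub x

lemma locallyIntegrable_div (hb : IsCoeff b a₀ A₀) {f : ℝ → ℝ} (hf : LocallyIntegrable f volume) :
    LocallyIntegrable (fun x => f x / b x) volume := by
  rw [locallyIntegrable_iff]
  intro k hk
  have := Integrable.bdd_mul (f := fun x => (b x)⁻¹) (c := a₀⁻¹) (hf.integrableOn_isCompact hk)
    hb.meas.inv.aestronglyMeasurable.restrict (Eventually.of_forall fun x => by
      rw [norm_inv, Real.norm_of_nonneg (hb.pos' x).le]
      exact inv_anti₀ hb.pos (hb.lb x))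
  refine this.congr (Eventually.of_forall fun x => ?_)
  simp only [div_eq_inv_mul]

lemma comp_neg (hb : IsCoeff b a₀ A₀) : IsCoeff (fun x => b (-x)) a₀ A₀ :=
  ⟨hb.meas.comp measurable_neg, hb.pos, fun _ => hb.lb _, fun _ => hb.ub _⟩

end IsCoeff

/-- `(φ, ξ)` solves the first order system `φ' = ξ / b`, `ξ' = -b sin φ cos φ` on `[0, ∞)`,
with `φ 0 = 0`. -/
structure HalfLineFlow (b φ ξ : ℝ → ℝ) : Prop where
  cont_phi : Continuous φ
  cont_xi : Continuous ξ
  phi_eq : ∀ x, 0 ≤ x → φ x = ∫ t in (0 : ℝ)..x, ξ t / b t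
  xi_eq : ∀ x, 0 ≤ x → ξ x = ξ 0 - ∫ t in (0 : ℝ)..x, b t * Real.sin (φ t) * Real.cos (φ t)

/-- `φ` is a wall profile on the half-line `[0, ∞)` for the coefficient `b`, with flux
`ξ = b φ'`. -/
structure HalfLineWall (b φ ξ : ℝ → ℝ) : Prop extends HalfLineFlow b φ ξ where
  phi_nonneg : ∀ x, 0 ≤ x → 0 ≤ φ x
  phi_le : ∀ x, 0 ≤ x → φ x ≤ Real.pi / 2
  lim : Tendsto φ atTop (𝓝 (Real.pi / 2))

lemma hasAEDeriv_of_primitive {f g : ℝ → ℝ} (hg : LocallyIntegrable g volume) {c : ℝ}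
    (hf : ∀ x, 0 ≤ x → f x = c + ∫ t in (0 : ℝ)..x, g t) {u v : ℝ} (hu : 0 ≤ u) (huv : u ≤ v) :
    HasAEDeriv f g u v := by
  have hi := fun u v => intervalIntegrable_of_locallyIntegrable hg u v
  refine HasAEDeriv.of_integral huv (hi _ _) (c := f u) fun x hx => ?_
  rw [hf x (hu.trans hx.1), hf u hu,
    ← intervalIntegral.integral_add_adjacent_intervals (hi 0 u) (hi u x)]
  ring

namespace HalfLineFlow

variable {b φ ξ : ℝ → ℝ} {a₀ A₀ : ℝ}

lemma phi_zero (h : HalfLineFlow b φ ξ) : φ 0 = 0 := by simpa using h.phi_eq 0 le_rfl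

lemma hasAEDeriv_phi (hb : IsCoeff b a₀ A₀) (h : HalfLineFlow b φ ξ) {u v : ℝ} (hu : 0 ≤ u)
    (huv : u ≤ v) : HasAEDeriv φ (fun x => ξ x / b x) u v :=
  hasAEDeriv_of_primitive (c := 0) (hb.locallyIntegrable_div h.cont_xi.locallyIntegrable)
    (fun x hx => by rw [h.phi_eq x hx, zero_add]) hu huv

lemma hasAEDeriv_xi (hb : IsCoeff b a₀ A₀) (h : HalfLineFlow b φ ξ) {u v : ℝ} (hu : 0 ≤ u)
    (huv : u ≤ v) :
    HasAEDeriv ξ (fun x => -(b x * Real.sin (φ x) * Real.cos (φ x))) u v := by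
  have hφ := h.cont_phi
  have := hb.locallyIntegrable_mul (f := fun x => Real.sin (φ x) * Real.cos (φ x))
    (Continuous.locallyIntegrable (by fun_prop))
  simp only [← mul_assoc] at this
  exact hasAEDeriv_of_primitive (c := ξ 0) this.neg
    (fun x hx => by
      rw [h.xi_eq x hx]
      simp only [Pi.neg_apply, intervalIntegral.integral_neg]
      ring) hu huv

/-- For `b` constantly equal to `c` this is the conserved quantity of the pendulum. For variable `b`
the first factor of the derivative is nonnegative as long as `ξ`, `sin φ` and `cos φ` are, so
comparing `b` with a constant decides monotonicity. -/
lemma hasAEDeriv_sq_sub (hb : IsCoeff b a₀ A₀) (h : HalfLineFlow b φ ξ) (c : ℝ) {u v : ℝ}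
    (hu : 0 ≤ u) (huv : u ≤ v) :
    HasAEDeriv (fun x => ξ x * ξ x - c ^ 2 * (Real.cos (φ x) * Real.cos (φ x)))
      (fun x => (2 * ξ x * Real.sin (φ x) * Real.cos (φ x) / b x) * (c ^ 2 - b x ^ 2)) u v := by
  have h1 := h.hasAEDeriv_xi hb hu huv
  have h2 := (h.hasAEDeriv_phi hb hu huv).cos huv
  refine ((h1.mul h1).sub ((h2.mul h2).const_mul (c ^ 2))).congr_deriv
    (Eventually.of_forall fun x _ => ?_)
  have := (hb.pos' x).ne'
  field_simp
  ring

/-- Grönwall's inequality for `cos φ`. -/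
lemma cos_pos_of_le (hb : IsCoeff b a₀ A₀) (h : HalfLineFlow b φ ξ) {x : ℝ} (hx : 0 ≤ x)
    (h0 : ∀ t ∈ Ioo 0 x, 0 ≤ ξ t) (h1 : ∀ t ∈ Ioo 0 x, ξ t ≤ A₀ * Real.cos (φ t)) :
    0 < Real.cos (φ x) := by
  have ha := hb.pos
  have hc := (h.hasAEDeriv_phi hb le_rfl hx).cos hx
  -- The hypotheses give `(cos φ)' = -sin φ · ξ / b ≥ -(A₀ / a₀) cos φ`, so `exp (A₀ t / a₀) cos φ`
  -- is nondecreasing and starts from `1`.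
  have he := hasAEDeriv_of_contDiff (ψ := fun t : ℝ => Real.exp (A₀ / a₀ * t)) (by fun_prop) 0 x
  have := (he.mul hc).le_of_nonneg hx (Eventually.of_forall fun t ht => by
    have e0 : deriv (fun t : ℝ => Real.exp (A₀ / a₀ * t)) t =
        Real.exp (A₀ / a₀ * t) * (A₀ / a₀) := by
      simpa using ((hasDerivAt_id t).const_mul (A₀ / a₀)).exp.deriv
    have e1 : Real.sin (φ t) * (ξ t / b t) ≤ 1 * (ξ t / a₀) := by
      refine mul_le_mul (Real.sin_le_one _) ?_ (div_nonneg (h0 t ht) (hb.pos' t).le) zero_le_one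
      exact div_le_div_of_nonneg_left (h0 t ht) ha (hb.lb t)
    have e2 : ξ t / a₀ ≤ A₀ / a₀ * Real.cos (φ t) := by
      rw [div_mul_eq_mul_div]
      exact div_le_div_of_nonneg_right (h1 t ht) ha.le
    have e3 : 0 ≤ Real.exp (A₀ / a₀ * t) *
        (A₀ / a₀ * Real.cos (φ t) - Real.sin (φ t) * (ξ t / b t)) :=
      mul_nonneg (Real.exp_pos _).le (by linarith)
    rw [e0]
    linarith)
  rw [h.phi_zero] at this
  simp only [mul_zero, Real.exp_zero, Real.cos_zero, mul_one] at this
  exact pos_of_mul_pos_right (zero_lt_one.trans_le this) (Real.exp_pos _).le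

end HalfLineFlow

namespace HalfLineWall

variable {b φ ξ : ℝ → ℝ} {a₀ A₀ : ℝ}

lemma sin_nonneg (h : HalfLineWall b φ ξ) {x : ℝ} (hx : 0 ≤ x) : 0 ≤ Real.sin (φ x) :=
  Real.sin_nonneg_of_nonneg_of_le_pi (h.phi_nonneg x hx) (by linarith [h.phi_le x hx, Real.pi_pos])

lemma cos_nonneg (h : HalfLineWall b φ ξ) {x : ℝ} (hx : 0 ≤ x) : 0 ≤ Real.cos (φ x) :=
  Real.cos_nonneg_of_neg_pi_div_two_le_of_le (by linarith [h.phi_nonneg x hx, Real.pi_pos])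
    (h.phi_le x hx)

lemma antitoneOn (hb : IsCoeff b a₀ A₀) (h : HalfLineWall b φ ξ) : AntitoneOn ξ (Ici 0) := by
  intro x hx y hy hxy
  have := (h.hasAEDeriv_xi hb hx hxy).sub_le_mul hxy (C := 0) (Eventually.of_forall fun t ht => by
    have ht0 : 0 ≤ t := le_trans hx ht.1.le
    have := mul_nonneg (mul_nonneg (hb.pos' t).le (h.sin_nonneg ht0)) (h.cos_nonneg ht0)
    linarith)
  linarith

/-- The flux is nonincreasing; once negative it keeps `φ'` below a negative constant, which would
drive `φ` below `0`. -/
lemma xi_nonneg (hb : IsCoeff b a₀ A₀) (h : HalfLineWall b φ ξ) {x : ℝ} (hx : 0 ≤ x) :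
    0 ≤ ξ x := by
  by_contra hcon
  push Not at hcon
  have hA := hb.upper_pos
  -- At slope at most `ξ x / A₀`, this is far enough for `φ` to drop by `φ x + 1`.
  set y := x + (φ x + 1) * A₀ / (-ξ x) with hy
  have hpos : 0 < (φ x + 1) * A₀ / (-ξ x) := by
    have := h.phi_nonneg x hx
    exact div_pos (by positivity) (by linarith)
  have hxy : x ≤ y := by linarith
  have := (h.hasAEDeriv_phi hb hx hxy).sub_le_mul hxy (C := ξ x / A₀)
    (Eventually.of_forall fun t ht => by
      have h1 := h.antitoneOn hb hx (show (0 : ℝ) ≤ t from hx.trans ht.1.le) ht.1.le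
      rw [div_le_div_iff₀ (hb.pos' t) hA]
      nlinarith [hb.ub t, hb.pos' t])
  have h2 : ξ x / A₀ * (y - x) = -(φ x + 1) := by
    have := hcon.ne
    rw [hy]; field_simp; ring
  rw [h2] at this
  linarith [h.phi_nonneg y (hx.trans hxy)]

lemma le_phi_sub (hb : IsCoeff b a₀ A₀) (h : HalfLineWall b φ ξ) {x y : ℝ} (hx : 0 ≤ x)
    (hxy : x ≤ y) : ξ y / A₀ * (y - x) ≤ φ y - φ x :=
  (h.hasAEDeriv_phi hb hx hxy).mul_le_sub hxy (Eventually.of_forall fun t ht => by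
    have h1 := h.antitoneOn hb (show (0 : ℝ) ≤ t from hx.trans ht.1.le)
      (show (0 : ℝ) ≤ y from hx.trans hxy) ht.2.le
    exact div_le_div₀ (h.xi_nonneg hb (hx.trans ht.1.le)) h1 (hb.pos' t) (hb.ub t))

/-- As `ξ` is nonincreasing and `φ` bounded, `x ξ(x) / A₀ ≤ φ(x) ≤ π/2`. -/
lemma tendsto_xi (hb : IsCoeff b a₀ A₀) (h : HalfLineWall b φ ξ) : Tendsto ξ atTop (𝓝 0) := by
  have hA := hb.upper_pos
  have h1 : Tendsto (fun x : ℝ => (Real.pi / 2 * A₀) / x) atTop (𝓝 0) :=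
    tendsto_const_nhds.div_atTop tendsto_id
  refine squeeze_zero' ?_ ?_ h1
  · filter_upwards [eventually_ge_atTop 0] with x hx using h.xi_nonneg hb hx
  · filter_upwards [eventually_gt_atTop 0] with x hx
    have h2 := h.le_phi_sub hb le_rfl hx.le
    rw [h.phi_zero, sub_zero, sub_zero, div_mul_eq_mul_div, div_le_iff₀ hA] at h2
    rw [le_div_iff₀ hx]
    nlinarith [h.phi_le x hx.le]

lemma tendsto_cos (h : HalfLineWall b φ ξ) :
    Tendsto (fun x => Real.cos (φ x)) atTop (𝓝 0) := by
  have := (Real.continuous_cos.tendsto (Real.pi / 2)).comp h.lim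
  rwa [Real.cos_pi_div_two] at this

lemma tendsto_sq_sub (hb : IsCoeff b a₀ A₀) (h : HalfLineWall b φ ξ) (c : ℝ) :
    Tendsto (fun x => ξ x * ξ x - c ^ 2 * (Real.cos (φ x) * Real.cos (φ x))) atTop (𝓝 0) := by
  have h1 := h.tendsto_xi hb
  have h2 := h.tendsto_cos
  simpa using (h1.mul h1).sub ((h2.mul h2).const_mul (c ^ 2))

/-- Beyond `x` the quantity `ξ² - c² cos² φ` is nonincreasing, and it tends to `0`; hence it is
nonnegative at `x`. The lower bound on `b` is required only beyond `x`, so that a monotone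
coefficient admits `c = b x`. -/
lemma mul_cos_le_xi (hb : IsCoeff b a₀ A₀) (h : HalfLineWall b φ ξ) {c x : ℝ} (hx : 0 ≤ x)
    (hc : 0 ≤ c) (hcb : ∀ᵐ t, x < t → c ≤ b t) : c * Real.cos (φ x) ≤ ξ x := by
  have key : ∀ y, x ≤ y → ξ y * ξ y - c ^ 2 * (Real.cos (φ y) * Real.cos (φ y)) ≤
      ξ x * ξ x - c ^ 2 * (Real.cos (φ x) * Real.cos (φ x)) := by
    intro y hy
    have := (h.hasAEDeriv_sq_sub hb c hx hy).sub_le_mul hy (C := 0) (by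
      filter_upwards [hcb] with t ht htI
      have h0 : 0 ≤ t := hx.trans htI.1.le
      have e1 : 0 ≤ 2 * ξ t * Real.sin (φ t) * Real.cos (φ t) / b t :=
        div_nonneg (mul_nonneg (mul_nonneg (mul_nonneg zero_le_two (h.xi_nonneg hb h0))
          (h.sin_nonneg h0)) (h.cos_nonneg h0)) (hb.pos' t).le
      have e2 := ht htI.1
      exact mul_nonpos_of_nonneg_of_nonpos e1 (by nlinarith))
    linarith
  have := le_of_tendsto (h.tendsto_sq_sub hb c)
    (by filter_upwards [eventually_ge_atTop x] with y hy using key y hy)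
  exact abs_le_of_sq_le_sq' (by nlinarith) (h.xi_nonneg hb hx) |>.2

/-- With `c = A₀` the same quantity is nondecreasing with limit `0`, hence nonpositive. -/
lemma xi_le_mul_cos (hb : IsCoeff b a₀ A₀) (h : HalfLineWall b φ ξ) {x : ℝ} (hx : 0 ≤ x) :
    ξ x ≤ A₀ * Real.cos (φ x) := by
  have key : ∀ y, x ≤ y → ξ x * ξ x - A₀ ^ 2 * (Real.cos (φ x) * Real.cos (φ x)) ≤
      ξ y * ξ y - A₀ ^ 2 * (Real.cos (φ y) * Real.cos (φ y)) := by
    intro y hy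
    refine (h.hasAEDeriv_sq_sub hb A₀ hx hy).le_of_nonneg hy (Eventually.of_forall fun t htI => ?_)
    have h0 : 0 ≤ t := hx.trans htI.1.le
    have e1 : 0 ≤ 2 * ξ t * Real.sin (φ t) * Real.cos (φ t) / b t :=
      div_nonneg (mul_nonneg (mul_nonneg (mul_nonneg zero_le_two (h.xi_nonneg hb h0))
        (h.sin_nonneg h0)) (h.cos_nonneg h0)) (hb.pos' t).le
    exact mul_nonneg e1 (by nlinarith [hb.ub t, hb.pos' t])
  have := ge_of_tendsto (h.tendsto_sq_sub hb A₀)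
    (by filter_upwards [eventually_ge_atTop x] with y hy using key y hy)
  exact abs_le_of_sq_le_sq' (by nlinarith) (mul_nonneg hb.upper_pos.le (h.cos_nonneg hx)) |>.2

lemma cos_pos (hb : IsCoeff b a₀ A₀) (h : HalfLineWall b φ ξ) {x : ℝ} (hx : 0 ≤ x) :
    0 < Real.cos (φ x) :=
  h.cos_pos_of_le hb hx (fun _ ht => h.xi_nonneg hb ht.1.le) fun _ ht => h.xi_le_mul_cos hb ht.1.le

lemma xi_pos (hb : IsCoeff b a₀ A₀) (h : HalfLineWall b φ ξ) {x : ℝ} (hx : 0 ≤ x) : 0 < ξ x :=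
  (mul_pos hb.pos (h.cos_pos hb hx)).trans_le
    (h.mul_cos_le_xi hb hx hb.pos.le (Eventually.of_forall fun t _ => hb.lb t))

lemma strictMonoOn (hb : IsCoeff b a₀ A₀) (h : HalfLineWall b φ ξ) : StrictMonoOn φ (Ici 0) := by
  intro x hx y hy hxy
  have h1 := h.le_phi_sub hb hx hxy.le
  have h2 : 0 < ξ y / A₀ * (y - x) :=
    mul_pos (div_pos (h.xi_pos hb hy) hb.upper_pos) (by linarith)
  linarith

lemma phi_pos (hb : IsCoeff b a₀ A₀) (h : HalfLineWall b φ ξ) {x : ℝ} (hx : 0 < x) : 0 < φ x := by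
  have := h.strictMonoOn hb (mem_Ici.2 le_rfl) (mem_Ici.2 hx.le) hx
  rwa [h.phi_zero] at this

lemma sin_pos (hb : IsCoeff b a₀ A₀) (h : HalfLineWall b φ ξ) {x : ℝ} (hx : 0 < x) :
    0 < Real.sin (φ x) :=
  Real.sin_pos_of_pos_of_lt_pi (h.phi_pos hb hx) (by linarith [h.phi_le x hx.le, Real.pi_pos])

end HalfLineWall

end Pendulum

/-! ### Calibration of the half-line energy -/

namespace Pendulum

/-- Cauchy–Schwarz against the constant `1`, read off from the nonnegativity of the variance of `p`
about its mean `I / ε`. -/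
lemma sq_integral_le {p : ℝ → ℝ} {ε : ℝ} (hε : 0 < ε) (hp : IntervalIntegrable p volume 0 ε)
    (hp2 : IntervalIntegrable (fun x => p x ^ 2) volume 0 ε) :
    (∫ x in (0 : ℝ)..ε, p x) ^ 2 ≤ ε * ∫ x in (0 : ℝ)..ε, p x ^ 2 := by
  set I := ∫ x in (0 : ℝ)..ε, p x with hI
  have h0 : 0 ≤ ∫ x in (0 : ℝ)..ε, (p x - I / ε) ^ 2 :=
    intervalIntegral.integral_nonneg hε.le fun x _ => sq_nonneg _
  have h1 : ∫ x in (0 : ℝ)..ε, (p x - I / ε) ^ 2 =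
      (∫ x in (0 : ℝ)..ε, p x ^ 2) - 2 * (I / ε) * I + (I / ε) ^ 2 * ε := by
    have e : ∀ x, (p x - I / ε) ^ 2 = (p x ^ 2 - 2 * (I / ε) * p x) + (I / ε) ^ 2 :=
      fun x => by ring
    simp only [e]
    rw [intervalIntegral.integral_add (hp2.sub (hp.const_mul _)) intervalIntegrable_const,
      intervalIntegral.integral_sub hp2 (hp.const_mul _), intervalIntegral.integral_const_mul,
      intervalIntegral.integral_const, ← hI]
    simp; ring
  rw [h1] at h0
  have h2 : 2 * (I / ε) * I - (I / ε) ^ 2 * ε = I ^ 2 / ε := by field_simp; ring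
  have h3 : I ^ 2 / ε ≤ ∫ x in (0 : ℝ)..ε, p x ^ 2 := by linarith
  rwa [div_le_iff₀ hε, mul_comm] at h3

lemma tendsto_integral_zero_right {f : ℝ → ℝ} (hf : IntegrableOn f (Ioi 0) volume) :
    Tendsto (fun ε => ∫ x in (0 : ℝ)..ε, f x) (𝓝[>] 0) (𝓝 0) := by
  have h1 : IntegrableOn f (uIcc 0 1) := by
    rw [uIcc_of_le zero_le_one, integrableOn_Icc_iff_integrableOn_Ioc]
    exact hf.mono_set Ioc_subset_Ioi_self
  have h2 := intervalIntegral.continuousOn_primitive_interval h1 0 (by simp)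
  rw [uIcc_of_le zero_le_one] at h2
  have h3 : Tendsto (fun ε => ∫ x in (0 : ℝ)..ε, f x) (𝓝[Icc 0 1] 0) (𝓝 0) := by
    simpa [ContinuousWithinAt] using h2
  refine h3.mono_left ?_
  rw [← nhdsWithin_Ioo_eq_nhdsGT (zero_lt_one' ℝ)]
  exact nhdsWithin_mono _ Ioo_subset_Icc_self

lemma integral_Ioi_eq_sub {f : ℝ → ℝ} (hf : IntegrableOn f (Ioi 0) volume) {ε : ℝ} (hε : 0 ≤ ε) :
    ∫ x in Ioi ε, f x = (∫ x in Ioi 0, f x) - ∫ x in (0 : ℝ)..ε, f x := by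
  have := setIntegral_union (μ := volume) (f := f) (Ioc_disjoint_Ioi (le_refl ε) (a := 0))
    measurableSet_Ioi
    (hf.mono_set Ioc_subset_Ioi_self) (hf.mono_set (Ioi_subset_Ioi hε))
  rw [Ioc_union_Ioi_eq_Ioi hε] at this
  rw [intervalIntegral.integral_of_le hε, this]
  ring

namespace HalfLineWall

variable {b φ ξ : ℝ → ℝ} {a₀ A₀ : ℝ}

lemma integrableOn_deriv (hb : IsCoeff b a₀ A₀) (h : HalfLineWall b φ ξ) :
    IntegrableOn (fun x => ξ x / b x) (Ioi 0) volume := by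
  refine integrableOn_Ioi_of_intervalIntegral_norm_bounded (Real.pi / 2) 0 (l := atTop)
    (b := fun R : ℝ => R) (fun R => ?_) tendsto_id ?_
  · have := intervalIntegrable_of_locallyIntegrable
      (hb.locallyIntegrable_div h.cont_xi.locallyIntegrable) 0 R
    exact this.1
  · filter_upwards [eventually_ge_atTop 0] with R hR
    have e : ∫ x in (0 : ℝ)..R, ‖ξ x / b x‖ = ∫ x in (0 : ℝ)..R, ξ x / b x := by
      refine intervalIntegral.integral_congr fun x hx => ?_
      rw [uIcc_of_le hR] at hx
      exact Real.norm_of_nonneg (div_nonneg (h.xi_nonneg hb hx.1) (hb.pos' x).le)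
    rw [e, ← h.phi_eq R hR]
    exact h.phi_le R hR

/-- The energy density of a half-line wall. -/
lemma integrableOn_energy (hb : IsCoeff b a₀ A₀) (h : HalfLineWall b φ ξ) :
    IntegrableOn (fun x => b x * (ξ x / b x) ^ 2 + b x * Real.cos (φ x) ^ 2) (Ioi 0) volume := by
  have hA := hb.upper_pos
  have ha := hb.pos
  have hm := hb.meas
  have hξ := h.cont_xi.measurable
  have hφ := h.cont_phi.measurable
  -- Both terms are dominated by multiples of the integrable `φ' = ξ / b`: the first because `ξ ≤ ξ
  -- 0`, the second because `cos φ ≤ ξ / a₀`.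
  refine Integrable.mono' ((h.integrableOn_deriv hb).const_mul (ξ 0 + A₀ * A₀ / a₀))
    (Measurable.aestronglyMeasurable (by fun_prop)) ?_
  refine (ae_restrict_iff' measurableSet_Ioi).2 (Eventually.of_forall fun x hx => ?_)
  have hx0 : 0 ≤ x := le_of_lt hx
  have hbx := hb.pos' x
  have hξ0 := h.xi_nonneg hb hx0
  have hc0 := h.cos_nonneg hx0
  rw [Real.norm_of_nonneg (by positivity)]
  have e1 : b x * (ξ x / b x) ^ 2 = ξ x * (ξ x / b x) := by field_simp
  have e2 : ξ x * (ξ x / b x) ≤ ξ 0 * (ξ x / b x) :=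
    mul_le_mul_of_nonneg_right (h.antitoneOn hb (mem_Ici.2 le_rfl) (mem_Ici.2 hx0) hx0)
      (by positivity)
  have e3 := h.mul_cos_le_xi hb hx0 ha.le (Eventually.of_forall fun t _ => hb.lb t)
  have e4 : b x * Real.cos (φ x) ^ 2 ≤ A₀ * A₀ / a₀ * (ξ x / b x) := by
    have c1 : Real.cos (φ x) ≤ ξ x / a₀ := by rw [le_div_iff₀ ha]; linarith
    calc b x * Real.cos (φ x) ^ 2 = b x * Real.cos (φ x) * Real.cos (φ x) := by ring
      _ ≤ b x * 1 * (ξ x / a₀) := by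
        refine mul_le_mul (mul_le_mul_of_nonneg_left (Real.cos_le_one _) hbx.le) c1 hc0
          (by positivity)
      _ = b x * b x / a₀ * (ξ x / b x) := by field_simp
      _ ≤ A₀ * A₀ / a₀ * (ξ x / b x) := by
        have := mul_le_mul (hb.ub x) (hb.ub x) hbx.le hA.le
        gcongr
  rw [e1, add_mul]
  linarith

/-- The calibration inequality on `[ε, R]`. -/
lemma calibration_Icc (hb : IsCoeff b a₀ A₀) (h : HalfLineWall b φ ξ) {ψ p : ℝ → ℝ} {ε R : ℝ}
    (hψ : HasAEDeriv ψ p ε R) (hε : 0 < ε) (hεR : ε ≤ R)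
    (hi : IntervalIntegrable (fun x => (b x * p x ^ 2 + b x * Real.cos (ψ x) ^ 2) -
      (b x * (ξ x / b x) ^ 2 + b x * Real.cos (φ x) ^ 2) -
      b x * (Real.cos (ψ x) - Real.cos (φ x)) ^ 2) volume ε R) :
    -2 * (ξ R * (Real.sin (φ R))⁻¹ * (Real.cos (ψ R) - Real.cos (φ R))) -
      -2 * (ξ ε * (Real.sin (φ ε))⁻¹ * (Real.cos (ψ ε) - Real.cos (φ ε))) ≤
    ∫ x in ε..R, ((b x * p x ^ 2 + b x * Real.cos (ψ x) ^ 2) -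
      (b x * (ξ x / b x) ^ 2 + b x * Real.cos (φ x) ^ 2) -
      b x * (Real.cos (ψ x) - Real.cos (φ x)) ^ 2) := by
  have hs : ∀ x ∈ Icc ε R, Real.sin (φ x) ≠ 0 := fun x hx =>
    (h.sin_pos hb (hε.trans_le hx.1)).ne'
  have hφ := h.hasAEDeriv_phi hb hε.le hεR
  -- The weight `w = ξ / sin φ` satisfies the Riccati equation `w' = -cos φ (b + w² / b)`; it is
  -- finite because the interval stays away from `0`.
  have hw := (h.hasAEDeriv_xi hb hε.le hεR).mul ((hφ.sin hεR).inv hεR hs)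
  have hW := (hw.mul ((hψ.cos hεR).sub (hφ.cos hεR))).const_mul (-2)
  rw [← hW.integral_eq hεR]
  refine intervalIntegral.integral_mono_on hεR (hW.intervalIntegrable hεR) hi fun x hx => ?_
  have hsx := hs x hx
  have hB := hb.pos' x
  have h1 := Real.sin_sq_add_cos_sq (φ x)
  have h2 := Real.sin_sq_add_cos_sq (ψ x)
  obtain ⟨w, hw⟩ : ∃ w, ξ x = w * Real.sin (φ x) := ⟨ξ x / Real.sin (φ x), by field_simp⟩
  rw [hw]
  generalize Real.sin (φ x) = s at *
  generalize Real.cos (φ x) = c at *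
  generalize Real.sin (ψ x) = s' at *
  generalize Real.cos (ψ x) = c' at *
  generalize b x = B at *
  -- These two squares are exactly the integrand minus the derivative of `-2 w (cos ψ - cos φ)`.
  have hnn : 0 ≤ B * (p x - w * s' / B) ^ 2 + w ^ 2 / B * (c' - c) ^ 2 := by positivity
  rw [← sub_nonneg]
  refine hnn.trans_eq ?_
  field_simp
  linear_combination w ^ 2 * (h2 - h1)

/-- The inequality on `[ε, R]` is passed to the limit. At infinity the boundary term vanishes
because `ξ` and both cosines do. At `0` the weight `ξ / sin φ` is singular, but only of order `1 /
ε`, and this is compensated by `ψ(ε)² = o(ε)`, a consequence of `ψ 0 = 0` and finite energy. -/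
lemma calibration_Ioi (hb : IsCoeff b a₀ A₀) (h : HalfLineWall b φ ξ) {ψ p : ℝ → ℝ}
    (hp : LocallyIntegrable p volume) (hψ : ∀ x, 0 ≤ x → ψ x = ∫ t in (0 : ℝ)..x, p t)
    (hψc : Continuous ψ) (hlim : Tendsto ψ atTop (𝓝 (Real.pi / 2)))
    (hi : IntegrableOn (fun x => b x * p x ^ 2 + b x * Real.cos (ψ x) ^ 2) (Ioi 0) volume) :
    IntegrableOn (fun x => b x * (Real.cos (ψ x) - Real.cos (φ x)) ^ 2) (Ioi 0) volume ∧
    (∫ x in Ioi 0, (b x * (ξ x / b x) ^ 2 + b x * Real.cos (φ x) ^ 2)) +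
      ∫ x in Ioi 0, b x * (Real.cos (ψ x) - Real.cos (φ x)) ^ 2 ≤
      ∫ x in Ioi 0, (b x * p x ^ 2 + b x * Real.cos (ψ x) ^ 2) := by
  have hA := hb.upper_pos
  have ha := hb.pos
  have hm := hb.meas
  have hφm := h.cont_phi.measurable
  have hψm := hψc.measurable
  have hie := h.integrableOn_energy hb
  have hiD : IntegrableOn (fun x => b x * (Real.cos (ψ x) - Real.cos (φ x)) ^ 2) (Ioi 0) volume := by
    refine Integrable.mono' ((hi.add hie).const_mul 2)
      (Measurable.aestronglyMeasurable (by fun_prop)) (Eventually.of_forall fun x => ?_)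
    have hB := hb.pos' x
    rw [Real.norm_of_nonneg (by positivity)]
    have : 0 ≤ b x * p x ^ 2 + b x * (ξ x / b x) ^ 2 +
      b x * (Real.cos (ψ x) + Real.cos (φ x)) ^ 2 / 2 := by positivity
    simp only [Pi.add_apply]
    nlinarith [mul_nonneg hB.le (sq_nonneg (p x)), mul_nonneg hB.le (sq_nonneg (ξ x / b x)),
      mul_nonneg hB.le (sq_nonneg (Real.cos (ψ x) + Real.cos (φ x)))]
  refine ⟨hiD, ?_⟩
  have hp2 : IntegrableOn (fun x => p x ^ 2) (Ioi 0) volume := by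
    refine Integrable.mono' (hi.const_mul a₀⁻¹)
      (hp.aestronglyMeasurable.restrict.pow 2) (Eventually.of_forall fun x => ?_)
    have hB := hb.pos' x
    rw [Real.norm_of_nonneg (by positivity), inv_mul_eq_div, le_div_iff₀ ha]
    nlinarith [mul_nonneg (sub_nonneg.2 (hb.lb x)) (sq_nonneg (p x)),
      mul_nonneg hB.le (sq_nonneg (Real.cos (ψ x)))]
  have hAE : ∀ ε R, 0 ≤ ε → ε ≤ R → HasAEDeriv ψ p ε R := fun ε R h0 h1 =>
    hasAEDeriv_of_primitive hp (c := 0) (fun x hx => by rw [hψ x hx, zero_add]) h0 h1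
  set d : ℝ → ℝ := fun x => (b x * p x ^ 2 + b x * Real.cos (ψ x) ^ 2) -
      (b x * (ξ x / b x) ^ 2 + b x * Real.cos (φ x) ^ 2) -
      b x * (Real.cos (ψ x) - Real.cos (φ x)) ^ 2 with hd
  have hid : IntegrableOn d (Ioi 0) volume := (hi.sub hie).sub hiD
  have hint : ∫ x in Ioi 0, d x = (∫ x in Ioi 0, (b x * p x ^ 2 + b x * Real.cos (ψ x) ^ 2)) -
      (∫ x in Ioi 0, (b x * (ξ x / b x) ^ 2 + b x * Real.cos (φ x) ^ 2)) -
      ∫ x in Ioi 0, b x * (Real.cos (ψ x) - Real.cos (φ x)) ^ 2 := by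
    rw [← integral_sub hi hie]
    exact integral_sub (hi.sub hie) hiD
  suffices hgoal : 0 ≤ ∫ x in Ioi 0, d x by linarith
  have hstep1 : ∀ ε, 0 < ε →
      2 * (ξ ε * (Real.sin (φ ε))⁻¹ * (Real.cos (ψ ε) - Real.cos (φ ε))) ≤
        ∫ x in Ioi ε, d x := by
    intro ε hε
    have t1 : Tendsto (fun R => ∫ x in ε..R, d x) atTop (𝓝 (∫ x in Ioi ε, d x)) :=
      intervalIntegral_tendsto_integral_Ioi ε (hid.mono_set (Ioi_subset_Ioi hε.le)) tendsto_id
    have t2 : Tendsto (fun R => -2 * (ξ R * (Real.sin (φ R))⁻¹ *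
        (Real.cos (ψ R) - Real.cos (φ R))) -
        -2 * (ξ ε * (Real.sin (φ ε))⁻¹ * (Real.cos (ψ ε) - Real.cos (φ ε)))) atTop
        (𝓝 (-2 * (0 * 1⁻¹ * (0 - 0)) -
        -2 * (ξ ε * (Real.sin (φ ε))⁻¹ * (Real.cos (ψ ε) - Real.cos (φ ε))))) := by
      have s1 : Tendsto (fun R => Real.sin (φ R)) atTop (𝓝 1) := by
        have := (Real.continuous_sin.tendsto (Real.pi / 2)).comp h.lim
        rwa [Real.sin_pi_div_two] at this
      have s2 : Tendsto (fun R => Real.cos (ψ R)) atTop (𝓝 0) := by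
        have := (Real.continuous_cos.tendsto (Real.pi / 2)).comp hlim
        rwa [Real.cos_pi_div_two] at this
      exact ((((h.tendsto_xi hb).mul (s1.inv₀ one_ne_zero)).mul
        (s2.sub h.tendsto_cos)).const_mul (-2)).sub_const _
    have := le_of_tendsto_of_tendsto t2 t1 (by
      filter_upwards [eventually_ge_atTop ε] with R hR
      refine h.calibration_Icc hb (hAE ε R hε.le hR) hε hR ?_
      rw [intervalIntegrable_iff_integrableOn_Ioc_of_le hR]
      exact hid.mono_set (Ioc_subset_Ioi_self.trans (Ioi_subset_Ioi hε.le)))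
    linarith
  have hstep2 : ∀ ε, 0 < ε → -(Real.pi * A₀ / 2) * (∫ x in (0 : ℝ)..ε, p x ^ 2) ≤
      (∫ x in Ioi 0, d x) - ∫ x in (0 : ℝ)..ε, d x := by
    intro ε hε
    rw [← integral_Ioi_eq_sub hid hε.le]
    refine le_trans ?_ (hstep1 ε hε)
    have hξ := h.xi_pos hb hε.le
    have hs := h.sin_pos hb hε
    set w := ξ ε * (Real.sin (φ ε))⁻¹ with hw
    have hw0 : 0 < w := by positivity
    -- Jordan's inequality `sin φ ≥ 2 φ / π` is combined with `φ(ε) ≥ ε ξ(ε) / A₀`.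
    have hwle : w * ε ≤ Real.pi * A₀ / 2 := by
      have e1 := Real.mul_le_sin (h.phi_nonneg ε hε.le) (h.phi_le ε hε.le)
      have e2 := h.le_phi_sub hb le_rfl hε.le
      rw [h.phi_zero, sub_zero, sub_zero] at e2
      have e3 : 2 / Real.pi * (ξ ε / A₀ * ε) ≤ Real.sin (φ ε) :=
        (mul_le_mul_of_nonneg_left e2 (by positivity)).trans e1
      rw [hw, ← div_eq_mul_inv, div_mul_eq_mul_div, div_le_iff₀ hs]
      have e4 : Real.pi * A₀ / 2 * (2 / Real.pi * (ξ ε / A₀ * ε)) = ξ ε * ε := by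
        have := Real.pi_pos.ne'
        field_simp
      rw [← e4]
      exact mul_le_mul_of_nonneg_left e3 (by positivity)
    have hψ2 : ψ ε ^ 2 ≤ ε * ∫ x in (0 : ℝ)..ε, p x ^ 2 := by
      rw [hψ ε hε.le]
      refine sq_integral_le hε (intervalIntegrable_of_locallyIntegrable hp 0 ε) ?_
      rw [intervalIntegrable_iff_integrableOn_Ioc_of_le hε.le]
      exact hp2.mono_set Ioc_subset_Ioi_self
    have hI0 : 0 ≤ ∫ x in (0 : ℝ)..ε, p x ^ 2 :=
      intervalIntegral.integral_nonneg hε.le fun x _ => sq_nonneg _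
    have hcos := Real.one_sub_sq_div_two_le_cos (x := ψ ε)
    have hcos' := Real.cos_le_one (φ ε)
    have e5 : w * ψ ε ^ 2 ≤ Real.pi * A₀ / 2 * ∫ x in (0 : ℝ)..ε, p x ^ 2 := by
      calc w * ψ ε ^ 2 ≤ w * (ε * ∫ x in (0 : ℝ)..ε, p x ^ 2) :=
            mul_le_mul_of_nonneg_left hψ2 hw0.le
        _ = (w * ε) * ∫ x in (0 : ℝ)..ε, p x ^ 2 := by ring
        _ ≤ _ := mul_le_mul_of_nonneg_right hwle hI0
    -- Here `cos ψ ≥ 1 - ψ² / 2` and `cos φ ≤ 1`; only a lower bound on the boundary term is needed.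
    have e6 : w * (-(ψ ε ^ 2 / 2)) ≤ w * (Real.cos (ψ ε) - Real.cos (φ ε)) :=
      mul_le_mul_of_nonneg_left (by linarith) hw0.le
    linarith
  have t1 := (tendsto_integral_zero_right hp2).const_mul (-(Real.pi * A₀ / 2))
  have t2 := (tendsto_integral_zero_right hid).const_sub (∫ x in Ioi 0, d x)
  have := le_of_tendsto_of_tendsto t1 t2 (by
    filter_upwards [self_mem_nhdsWithin] with ε hε using hstep2 ε hε)
  simpa using this

/-- Equality of cosines forces equality with the wall. -/
lemma eq_of_cos_eq (hb : IsCoeff b a₀ A₀) (h : HalfLineWall b φ ξ) {ψ : ℝ → ℝ}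
    (hψ : Continuous ψ) (hlim : Tendsto ψ atTop (𝓝 (Real.pi / 2)))
    (hcos : ∀ x, 0 < x → Real.cos (ψ x) = Real.cos (φ x)) {x : ℝ} (hx : 0 < x) : ψ x = φ x := by
  -- On the open half-line `cos φ` lies strictly between `0` and `1`, so `ψ` can never cross `0` or
  -- `π/2`.
  have hne : ∀ y, 0 < y → ψ y ≠ 0 ∧ ψ y ≠ Real.pi / 2 := by
    intro y hy
    have h1 := h.cos_pos hb hy.le
    have h2 := h.sin_pos hb hy
    rw [← hcos y hy] at h1
    constructor
    · intro h0
      have : Real.cos (φ y) = 1 := by rw [← hcos y hy, h0, Real.cos_zero]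
      nlinarith [Real.sin_sq_add_cos_sq (φ y)]
    · intro h0
      rw [h0, Real.cos_pi_div_two] at h1
      exact lt_irrefl _ h1
  have hpi := Real.pi_pos
  obtain ⟨y, hy0, hy1, hy2⟩ : ∃ y, x < y ∧ 0 < ψ y ∧ ψ y < Real.pi := by
    have := hlim.eventually (Ioo_mem_nhds (show 0 < Real.pi / 2 by linarith)
      (show Real.pi / 2 < Real.pi by linarith))
    obtain ⟨y, hy, hy'⟩ := (this.and (eventually_gt_atTop x)).exists
    exact ⟨y, hy', hy.1, hy.2⟩
  have hyc : ψ y < Real.pi / 2 := by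
    by_contra hcon
    push Not at hcon
    have h1 := h.cos_pos hb (hx.trans hy0).le
    rw [← hcos y (hx.trans hy0)] at h1
    exact absurd (Real.cos_nonpos_of_pi_div_two_le_of_le hcon (by linarith)) (not_le.2 h1)
  -- Far out, at `y`, the value of `ψ` is in `(0, π/2)`; connectedness keeps `ψ x` in the same
  -- interval, where the cosine is injective.
  have hpc : IsPreconnected (ψ '' Icc x y) := isPreconnected_Icc.image ψ hψ.continuousOn
  have hoc := hpc.ordConnected
  have hxm : ψ x ∈ ψ '' Icc x y := mem_image_of_mem _ ⟨le_rfl, hy0.le⟩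
  have hym : ψ y ∈ ψ '' Icc x y := mem_image_of_mem _ ⟨hy0.le, le_rfl⟩
  have hψx0 : 0 < ψ x := by
    by_contra hcon
    obtain ⟨z, hz, hz0⟩ := hoc.out hxm hym ⟨not_lt.1 hcon, hy1.le⟩
    exact (hne z (hx.trans_le hz.1)).1 hz0
  have hψx1 : ψ x < Real.pi / 2 := by
    by_contra hcon
    obtain ⟨z, hz, hz0⟩ := hoc.out hym hxm ⟨hyc.le, not_lt.1 hcon⟩
    exact (hne z (hx.trans_le hz.1)).2 hz0
  exact Real.injOn_cos ⟨hψx0.le, by linarith⟩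
    ⟨h.phi_nonneg x hx.le, by linarith [h.phi_le x hx.le]⟩ (hcos x hx)

end HalfLineWall

end Pendulum

/-! ### Picard iteration in an exponentially weighted space -/

namespace Pendulum

open BoundedContinuousFunction in
/-- The flux recovered from its exponentially weighted version. -/
noncomputable def unweight (L : ℝ) (v : ℝ →ᵇ ℝ) (x : ℝ) : ℝ := Real.exp (L * |x|) * v x

/-- The angle with flux `unweight L v`. -/
noncomputable def angleOf (b : ℝ → ℝ) (L : ℝ) (v : BoundedContinuousFunction ℝ ℝ) (x : ℝ) : ℝ :=
  ∫ t in (0 : ℝ)..x, unweight L v t / b t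

lemma continuous_unweight (L : ℝ) (v : BoundedContinuousFunction ℝ ℝ) :
    Continuous (unweight L v) := by
  have := v.continuous
  unfold unweight
  fun_prop

/-- In the weight `exp (L t)` each integration gains a factor `1 / L`. The Picard map integrates
twice, whence the `L ^ 2` in its Lipschitz constant. -/
lemma abs_integral_le_exp {f : ℝ → ℝ} {C L x : ℝ} (hC : 0 ≤ C) (hL : 0 < L) (hx : 0 ≤ x)
    (hf : ∀ t ∈ Ioc 0 x, |f t| ≤ C * Real.exp (L * t)) :
    |∫ t in (0 : ℝ)..x, f t| ≤ C / L * Real.exp (L * x) := by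
  have h1 : ∫ t in (0 : ℝ)..x, C * Real.exp (L * t) = C / L * (Real.exp (L * x) - 1) := by
    rw [intervalIntegral.integral_const_mul, intervalIntegral.integral_comp_mul_left _ hL.ne']
    simp
    field_simp
  have h2 := intervalIntegral.norm_integral_le_of_norm_le (μ := volume) hx (f := f)
    (g := fun t => C * Real.exp (L * t)) (Eventually.of_forall hf)
    (Continuous.intervalIntegrable (by fun_prop) _ _)
  rw [h1] at h2
  have h3 : 0 ≤ C / L := by positivity
  rw [← Real.norm_eq_abs]
  linarith

lemma abs_sin_mul_cos_sub_le (x y : ℝ) :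
    |Real.sin x * Real.cos x - Real.sin y * Real.cos y| ≤ |x - y| := by
  have h1 : Real.sin x * Real.cos x - Real.sin y * Real.cos y =
      Real.sin (x - y) * Real.cos (x + y) := by
    rw [Real.sin_sub, Real.cos_add]
    linear_combination (-(Real.sin x * Real.cos x)) * Real.sin_sq_add_cos_sq y +
      Real.sin y * Real.cos y * Real.sin_sq_add_cos_sq x
  rw [h1, abs_mul]
  calc |Real.sin (x - y)| * |Real.cos (x + y)| ≤ |x - y| * 1 :=
        mul_le_mul Real.abs_sin_le_abs (Real.abs_cos_le_one _) (abs_nonneg _) (abs_nonneg _)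
    _ = |x - y| := mul_one _

section FixedPoint

variable {b : ℝ → ℝ} {a₀ A₀ L : ℝ}

lemma continuous_angleOf (hb : IsCoeff b a₀ A₀) (L : ℝ) (v : BoundedContinuousFunction ℝ ℝ) :
    Continuous (angleOf b L v) :=
  intervalIntegral.continuous_primitive (fun u w => intervalIntegrable_of_locallyIntegrable
    (hb.locallyIntegrable_div (continuous_unweight L v).locallyIntegrable) u w) 0

lemma locallyIntegrable_force (hb : IsCoeff b a₀ A₀) {φ : ℝ → ℝ} (hφ : Continuous φ) :
    LocallyIntegrable (fun x => b x * Real.sin (φ x) * Real.cos (φ x)) volume := by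
  have := hb.locallyIntegrable_mul (f := fun x => Real.sin (φ x) * Real.cos (φ x))
    (Continuous.locallyIntegrable (by fun_prop))
  simpa only [← mul_assoc] using this

lemma abs_force_le (hb : IsCoeff b a₀ A₀) (x y : ℝ) :
    |b x * Real.sin y * Real.cos y| ≤ A₀ := by
  rw [abs_mul, abs_mul, abs_of_pos (hb.pos' x)]
  have h1 := mul_le_mul (hb.ub x) (Real.abs_sin_le_one y) (abs_nonneg _) hb.upper_pos.le
  have h2 := mul_le_mul h1 (Real.abs_cos_le_one y) (abs_nonneg _) (by linarith [hb.upper_pos])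
  linarith

/-- The flux obtained from initial value `s` and the angle of `v`. -/
noncomputable def fluxOf (b : ℝ → ℝ) (L s : ℝ) (v : BoundedContinuousFunction ℝ ℝ) (x : ℝ) : ℝ :=
  s - ∫ t in (0 : ℝ)..x, b t * Real.sin (angleOf b L v t) * Real.cos (angleOf b L v t)

lemma continuous_fluxOf (hb : IsCoeff b a₀ A₀) (L s : ℝ) (v : BoundedContinuousFunction ℝ ℝ) :
    Continuous (fluxOf b L s v) :=
  continuous_const.sub (intervalIntegral.continuous_primitive
    (fun u w => intervalIntegrable_of_locallyIntegrable
      (locallyIntegrable_force hb (continuous_angleOf hb L v)) u w) 0)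

lemma abs_fluxOf_le (hb : IsCoeff b a₀ A₀) (hL : 0 < L) (s : ℝ)
    (v : BoundedContinuousFunction ℝ ℝ) (x : ℝ) :
    |Real.exp (-(L * |x|)) * fluxOf b L s v (|x|)| ≤ |s| + A₀ / L := by
  have hA := hb.upper_pos
  have h1 : |fluxOf b L s v (|x|)| ≤ |s| + A₀ / L * Real.exp (L * |x|) := by
    refine (abs_sub _ _).trans (add_le_add le_rfl ?_)
    refine abs_integral_le_exp hA.le hL (abs_nonneg x) fun t ht => ?_
    refine (abs_force_le hb t _).trans ?_
    have : 1 ≤ Real.exp (L * t) := Real.one_le_exp (mul_nonneg hL.le ht.1.le)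
    nlinarith
  rw [abs_mul, abs_of_pos (Real.exp_pos _)]
  have h2 : Real.exp (-(L * |x|)) ≤ 1 := Real.exp_le_one_iff.2 (by
    have := mul_nonneg hL.le (abs_nonneg x); linarith)
  have h3 : Real.exp (-(L * |x|)) * Real.exp (L * |x|) = 1 := by
    rw [← Real.exp_add]; simp
  calc Real.exp (-(L * |x|)) * |fluxOf b L s v (|x|)|
      ≤ Real.exp (-(L * |x|)) * (|s| + A₀ / L * Real.exp (L * |x|)) :=
        mul_le_mul_of_nonneg_left h1 (Real.exp_pos _).le
    _ = Real.exp (-(L * |x|)) * |s| +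
        A₀ / L * (Real.exp (-(L * |x|)) * Real.exp (L * |x|)) := by ring
    _ ≤ 1 * |s| + A₀ / L * 1 := by
        rw [h3]
        exact add_le_add (mul_le_mul_of_nonneg_right h2 (abs_nonneg _)) le_rfl
    _ = _ := by ring

/-- The Picard map in the exponentially weighted space. -/
noncomputable def picardMap (hb : IsCoeff b a₀ A₀) (hL : 0 < L) (s : ℝ)
    (v : BoundedContinuousFunction ℝ ℝ) : BoundedContinuousFunction ℝ ℝ :=
  BoundedContinuousFunction.ofNormedAddCommGroup
    -- Only `x ≥ 0` matters; the even extension allows the iteration to run in bounded continuous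
    -- functions on all of `ℝ`.
    (fun x => Real.exp (-(L * |x|)) * fluxOf b L s v (|x|))
    ((by fun_prop : Continuous fun x : ℝ => Real.exp (-(L * |x|))).mul
      ((continuous_fluxOf hb L s v).comp continuous_abs))
    (|s| + A₀ / L) (fun x => abs_fluxOf_le hb hL s v x)

lemma picardMap_apply (hb : IsCoeff b a₀ A₀) (hL : 0 < L) (s : ℝ)
    (v : BoundedContinuousFunction ℝ ℝ) (x : ℝ) :
    picardMap hb hL s v x = Real.exp (-(L * |x|)) * fluxOf b L s v (|x|) := rfl

lemma abs_angleOf_sub_le (hb : IsCoeff b a₀ A₀) (hL : 0 < L)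
    (v w : BoundedContinuousFunction ℝ ℝ) {x : ℝ} (hx : 0 ≤ x) :
    |angleOf b L v x - angleOf b L w x| ≤ dist v w / a₀ / L * Real.exp (L * x) := by
  have ha := hb.pos
  have hi : ∀ v : BoundedContinuousFunction ℝ ℝ,
      IntervalIntegrable (fun t => unweight L v t / b t) volume 0 x := fun v =>
    intervalIntegrable_of_locallyIntegrable
      (hb.locallyIntegrable_div (continuous_unweight L v).locallyIntegrable) _ _
  unfold angleOf
  rw [← intervalIntegral.integral_sub (hi v) (hi w)]
  refine abs_integral_le_exp (by positivity) hL hx fun t ht => ?_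
  have h1 : unweight L v t / b t - unweight L w t / b t =
      Real.exp (L * t) * ((v t - w t) / b t) := by
    unfold unweight
    rw [abs_of_pos ht.1]; ring
  rw [h1, abs_mul, abs_of_pos (Real.exp_pos _), abs_div, abs_of_pos (hb.pos' t), mul_comm]
  refine mul_le_mul_of_nonneg_right ?_ (Real.exp_pos _).le
  refine div_le_div₀ dist_nonneg ?_ ha (hb.lb t)
  rw [← Real.dist_eq]
  exact BoundedContinuousFunction.dist_coe_le_dist t

lemma dist_picardMap_le (hb : IsCoeff b a₀ A₀) (hL : 0 < L) (s : ℝ)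
    (v w : BoundedContinuousFunction ℝ ℝ) :
    dist (picardMap hb hL s v) (picardMap hb hL s w) ≤ A₀ / (a₀ * L ^ 2) * dist v w := by
  have ha := hb.pos
  have hA := hb.upper_pos
  rw [BoundedContinuousFunction.dist_le (by positivity)]
  intro x
  have hi : ∀ v : BoundedContinuousFunction ℝ ℝ, IntervalIntegrable (fun t =>
      b t * Real.sin (angleOf b L v t) * Real.cos (angleOf b L v t)) volume 0 |x| := fun v =>
    intervalIntegrable_of_locallyIntegrable
      (locallyIntegrable_force hb (continuous_angleOf hb L v)) _ _
  rw [picardMap_apply, picardMap_apply, Real.dist_eq, ← mul_sub, abs_mul,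
    abs_of_pos (Real.exp_pos _)]
  have h1 : fluxOf b L s v (|x|) - fluxOf b L s w (|x|) = ∫ t in (0 : ℝ)..|x|,
      (b t * Real.sin (angleOf b L w t) * Real.cos (angleOf b L w t) -
        b t * Real.sin (angleOf b L v t) * Real.cos (angleOf b L v t)) := by
    rw [intervalIntegral.integral_sub (hi w) (hi v)]
    unfold fluxOf
    ring
  have h2 : |fluxOf b L s v (|x|) - fluxOf b L s w (|x|)| ≤
      A₀ * (dist v w / a₀ / L) / L * Real.exp (L * |x|) := by
    rw [h1]
    refine abs_integral_le_exp (by positivity) hL (abs_nonneg x) fun t ht => ?_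
    rw [mul_assoc, mul_assoc, ← mul_sub, abs_mul, abs_of_pos (hb.pos' t), mul_assoc A₀]
    refine mul_le_mul (hb.ub t) ?_ (abs_nonneg _) hA.le
    rw [abs_sub_comm]
    exact (abs_sin_mul_cos_sub_le _ _).trans (abs_angleOf_sub_le hb hL v w ht.1.le)
  have h3 : Real.exp (-(L * |x|)) * Real.exp (L * |x|) = 1 := by
    rw [← Real.exp_add]; simp
  calc Real.exp (-(L * |x|)) * |fluxOf b L s v (|x|) - fluxOf b L s w (|x|)|
      ≤ Real.exp (-(L * |x|)) * (A₀ * (dist v w / a₀ / L) / L * Real.exp (L * |x|)) :=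
        mul_le_mul_of_nonneg_left h2 (Real.exp_pos _).le
    _ = A₀ * (dist v w / a₀ / L) / L * (Real.exp (-(L * |x|)) * Real.exp (L * |x|)) := by ring
    _ = A₀ / (a₀ * L ^ 2) * dist v w := by rw [h3]; field_simp

lemma dist_picardMap_param_le (hb : IsCoeff b a₀ A₀) (hL : 0 < L) (s s' : ℝ)
    (v : BoundedContinuousFunction ℝ ℝ) :
    dist (picardMap hb hL s v) (picardMap hb hL s' v) ≤ |s - s'| := by
  rw [BoundedContinuousFunction.dist_le (abs_nonneg _)]
  intro x
  rw [picardMap_apply, picardMap_apply, Real.dist_eq, ← mul_sub, abs_mul,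
    abs_of_pos (Real.exp_pos _)]
  have h1 : fluxOf b L s v (|x|) - fluxOf b L s' v (|x|) = s - s' := by unfold fluxOf; ring
  have h2 : Real.exp (-(L * |x|)) ≤ 1 := Real.exp_le_one_iff.2 (by
    have := mul_nonneg hL.le (abs_nonneg x); linarith)
  rw [h1]
  exact mul_le_of_le_one_left (abs_nonneg _) h2

/-- The initial value problem on the half-line is solvable for every initial flux, and the solution
depends Lipschitz continuously on it, locally uniformly. -/
theorem exists_flow_family (hb : IsCoeff b a₀ A₀) :
    ∃ φ ξ : ℝ → ℝ → ℝ, (∀ s, HalfLineFlow b (φ s) (ξ s) ∧ ξ s 0 = s) ∧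
      ∀ X, ∃ C > 0, ∀ y ∈ Icc 0 X, ∀ s s',
        |ξ s y - ξ s' y| ≤ C * |s - s'| ∧ |φ s y - φ s' y| ≤ C * |s - s'| := by
  have ha := hb.pos
  have hA := hb.upper_pos
  have haA : a₀ ≤ A₀ := (hb.lb 0).trans (hb.ub 0)
  -- With this weight the Lipschitz constant `A₀ / (a₀ L²)` equals `a₀ / (4 A₀) ≤ 1/4`.
  set L : ℝ := 2 * A₀ / a₀ with hLd
  have hL : 0 < L := by positivity
  have hK : A₀ / (a₀ * L ^ 2) ≤ 1 / 2 := by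
    have : A₀ / (a₀ * L ^ 2) = a₀ / A₀ / 4 := by rw [hLd]; field_simp; norm_num
    rw [this]
    have := (div_le_one hA).2 haA
    linarith
  have hcontr : ∀ s, ContractingWith (1 / 2 : ℝ≥0) (picardMap hb hL s) := fun s => by
    refine ⟨by
      rw [← NNReal.coe_lt_coe]; norm_num, LipschitzWith.of_dist_le_mul fun v w => ?_⟩
    refine (dist_picardMap_le hb hL s v w).trans ?_
    have : ((1 / 2 : ℝ≥0) : ℝ) = 1 / 2 := by norm_num
    rw [this]
    exact mul_le_mul_of_nonneg_right hK dist_nonneg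
  let V : ℝ → BoundedContinuousFunction ℝ ℝ := fun s => (hcontr s).fixedPoint (picardMap hb hL s)
  have hV : ∀ s, picardMap hb hL s (V s) = V s := fun s => (hcontr s).fixedPoint_isFixedPt
  -- Changing `s` moves the Picard map by at most `|s - s'|`, and a contraction with constant `1/2`
  -- at most doubles this at its fixed point.
  have hdist : ∀ s s', dist (V s) (V s') ≤ 2 * |s - s'| := by
    intro s s'
    have := (hcontr s).dist_fixedPoint_fixedPoint_of_dist_le' (picardMap hb hL s') (hV s) (hV s')
      (fun v => dist_picardMap_param_le hb hL s s' v)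
    have e : |s - s'| / (1 - ((1 / 2 : ℝ≥0) : ℝ)) = 2 * |s - s'| := by
      have : ((1 / 2 : ℝ≥0) : ℝ) = 1 / 2 := by norm_num
      rw [this]; ring
    rwa [e] at this
  have hflux : ∀ s x, 0 ≤ x → unweight L (V s) x = fluxOf b L s (V s) x := by
    intro s x hx
    have h1 := congrArg (fun v : BoundedContinuousFunction ℝ ℝ => v x) (hV s)
    simp only [picardMap_apply] at h1
    unfold unweight
    rw [← h1, abs_of_nonneg hx, ← mul_assoc, ← Real.exp_add]
    simp
  refine ⟨fun s => angleOf b L (V s), fun s => unweight L (V s), fun s => ⟨⟨?_, ?_, ?_, ?_⟩, ?_⟩,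
    fun X => ?_⟩
  · exact continuous_angleOf hb L (V s)
  · exact continuous_unweight L (V s)
  · exact fun x _ => rfl
  · intro x hx
    simp only [hflux s x hx, hflux s 0 le_rfl]
    simp [fluxOf]
  · simp only [hflux s 0 le_rfl]
    simp [fluxOf]
  · refine ⟨(2 + 2 / a₀ / L) * Real.exp (L * X), by positivity, fun y hy s s' => ⟨?_, ?_⟩⟩
    · have he : Real.exp (L * y) ≤ Real.exp (L * X) :=
        Real.exp_le_exp.2 (mul_le_mul_of_nonneg_left hy.2 hL.le)
      have h1 : unweight L (V s) y - unweight L (V s') y =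
          Real.exp (L * y) * (V s y - V s' y) := by
        unfold unweight; rw [abs_of_nonneg hy.1]; ring
      rw [h1, abs_mul, abs_of_pos (Real.exp_pos _)]
      have h2 : |V s y - V s' y| ≤ 2 * |s - s'| := by
        rw [← Real.dist_eq]
        exact (BoundedContinuousFunction.dist_coe_le_dist y).trans (hdist s s')
      calc Real.exp (L * y) * |V s y - V s' y| ≤ Real.exp (L * X) * (2 * |s - s'|) :=
            mul_le_mul he h2 (abs_nonneg _) (Real.exp_pos _).le
        _ = 2 * (Real.exp (L * X) * |s - s'|) := by ring
        _ ≤ (2 + 2 / a₀ / L) * (Real.exp (L * X) * |s - s'|) :=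
            mul_le_mul_of_nonneg_right (le_add_of_nonneg_right (by positivity)) (by positivity)
        _ = _ := by ring
    · have he : Real.exp (L * y) ≤ Real.exp (L * X) :=
        Real.exp_le_exp.2 (mul_le_mul_of_nonneg_left hy.2 hL.le)
      refine (abs_angleOf_sub_le hb hL (V s) (V s') hy.1).trans ?_
      calc dist (V s) (V s') / a₀ / L * Real.exp (L * y)
          ≤ (2 * |s - s'|) / a₀ / L * Real.exp (L * X) := by
            have := hdist s s'
            gcongr
        _ = 2 / a₀ / L * (Real.exp (L * X) * |s - s'|) := by ring
        _ ≤ (2 + 2 / a₀ / L) * (Real.exp (L * X) * |s - s'|) :=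
            mul_le_mul_of_nonneg_right (le_add_of_nonneg_left (by positivity)) (by positivity)
        _ = _ := by ring

end FixedPoint

end Pendulum

/-! ### Shooting: existence of half-line walls -/

namespace Pendulum

/-- The angle exceeds `π / 2` while the flux is still positive. -/
def Overshoots (φ ξ : ℝ → ℝ) : Prop :=
  ∃ x, 0 ≤ x ∧ Real.pi / 2 < φ x ∧ ∀ y ∈ Icc 0 x, 0 < ξ y

/-- The flux becomes negative before the angle reaches `π / 2`. -/
def TurnsBack (φ ξ : ℝ → ℝ) : Prop :=
  ∃ x, 0 ≤ x ∧ ξ x < 0 ∧ ∀ y ∈ Icc 0 x, φ y < Real.pi / 2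

/-- Whichever witness comes first violates the condition that the other one imposes on all earlier
times. -/
lemma Overshoots.not_turnsBack {φ ξ : ℝ → ℝ} (h : Overshoots φ ξ) : ¬ TurnsBack φ ξ := by
  rintro ⟨y, hy0, hy, hyφ⟩
  obtain ⟨x, hx0, hx, hxξ⟩ := h
  rcases le_total x y with hle | hle
  · exact lt_asymm hx (hyφ x ⟨hx0, hle⟩)
  · exact lt_asymm hy (hxξ y ⟨hy0, hle⟩)

lemma exists_pos_lower_bound {f : ℝ → ℝ} (hf : Continuous f) {x : ℝ} (hx : 0 ≤ x)
    (hpos : ∀ y ∈ Icc 0 x, 0 < f y) : ∃ m > 0, ∀ y ∈ Icc 0 x, m ≤ f y := by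
  obtain ⟨z, hz, hmin⟩ := isCompact_Icc.exists_isMinOn (nonempty_Icc.2 hx) hf.continuousOn
  exact ⟨f z, hpos z hz, fun y hy => hmin hy⟩

section Shooting

variable {b : ℝ → ℝ} {a₀ A₀ : ℝ} {φ ξ : ℝ → ℝ → ℝ}

lemma eventually_abs_mul_lt {C : ℝ} (s : ℝ) {m : ℝ} (hm : 0 < m) :
    ∀ᶠ s' in 𝓝 s, C * |s' - s| < m := by
  have h : Tendsto (fun s' => C * |s' - s|) (𝓝 s) (𝓝 (C * |s - s|)) :=
    Continuous.tendsto (by fun_prop) s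
  rw [sub_self, abs_zero, mul_zero] at h
  exact h.eventually (gt_mem_nhds hm)

/-- Overshooting is an open condition on `s`: the strict inequalities hold with a margin on the
compact interval `[0, x]`, and the flow depends on `s` uniformly there. The same argument applies to
turning back. -/
lemma eventually_overshoots (hfl : ∀ s, HalfLineFlow b (φ s) (ξ s))
    (hdep : ∀ X, ∃ C > 0, ∀ y ∈ Icc 0 X, ∀ s s',
        |ξ s y - ξ s' y| ≤ C * |s - s'| ∧ |φ s y - φ s' y| ≤ C * |s - s'|) {s : ℝ}
    (hs : Overshoots (φ s) (ξ s)) : ∀ᶠ s' in 𝓝 s, Overshoots (φ s') (ξ s') := by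
  obtain ⟨x, hx0, hx, hxξ⟩ := hs
  obtain ⟨m, hm, hmle⟩ := exists_pos_lower_bound (hfl s).cont_xi hx0 hxξ
  obtain ⟨C, hC, hC'⟩ := hdep x
  filter_upwards [eventually_abs_mul_lt (C := C) s hm,
    eventually_abs_mul_lt (C := C) s (sub_pos.2 hx)] with s' h1 h2
  refine ⟨x, hx0, ?_, fun y hy => ?_⟩
  · have := (abs_le.1 (hC' x ⟨hx0, le_rfl⟩ s' s).2).1
    linarith
  · have := (abs_le.1 (hC' y hy s' s).1).1
    linarith [hmle y hy]

lemma eventually_turnsBack (hfl : ∀ s, HalfLineFlow b (φ s) (ξ s))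
    (hdep : ∀ X, ∃ C > 0, ∀ y ∈ Icc 0 X, ∀ s s',
        |ξ s y - ξ s' y| ≤ C * |s - s'| ∧ |φ s y - φ s' y| ≤ C * |s - s'|) {s : ℝ}
    (hs : TurnsBack (φ s) (ξ s)) : ∀ᶠ s' in 𝓝 s, TurnsBack (φ s') (ξ s') := by
  obtain ⟨x, hx0, hx, hxφ⟩ := hs
  obtain ⟨m, hm, hmle⟩ := exists_pos_lower_bound (f := fun y => Real.pi / 2 - φ s y)
    (continuous_const.sub (hfl s).cont_phi) hx0 (fun y hy => sub_pos.2 (hxφ y hy))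
  obtain ⟨C, hC, hC'⟩ := hdep x
  filter_upwards [eventually_abs_mul_lt (C := C) s hm,
    eventually_abs_mul_lt (C := C) s (neg_pos.2 hx)] with s' h1 h2
  refine ⟨x, hx0, ?_, fun y hy => ?_⟩
  · have := (abs_le.1 (hC' x ⟨hx0, le_rfl⟩ s' s).1).2
    linarith
  · have := (abs_le.1 (hC' y hy s' s).2).2
    linarith [hmle y hy]

end Shooting

namespace HalfLineFlow

variable {b φ ξ : ℝ → ℝ} {a₀ A₀ : ℝ}

/-- The force is at most `A₀`, so the flux stays above `2 A₀` on `[0, 1]`. The angle then has slope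
at least `2` and reaches `2 > π/2`. -/
lemma overshoots_of_large (hb : IsCoeff b a₀ A₀) (h : HalfLineFlow b φ ξ) (h0 : ξ 0 = 3 * A₀) :
    Overshoots φ ξ := by
  have hA := hb.upper_pos
  have hξ : ∀ y ∈ Icc (0 : ℝ) 1, 2 * A₀ ≤ ξ y := by
    intro y hy
    have := (h.hasAEDeriv_xi hb le_rfl hy.1).mul_le_sub hy.1 (c := -A₀)
      (Eventually.of_forall fun t _ => neg_le_neg ((abs_le.1 (abs_force_le hb t (φ t))).2))
    rw [h0] at this
    nlinarith [hy.2]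
  refine ⟨1, zero_le_one, ?_, fun y hy => by linarith [hξ y hy]⟩
  have := (h.hasAEDeriv_phi hb le_rfl zero_le_one).mul_le_sub zero_le_one (c := 2)
    (Eventually.of_forall fun t ht => by
      rw [le_div_iff₀ (hb.pos' t)]
      linarith [hξ t (Ioo_subset_Icc_self ht), hb.ub t])
  rw [h.phi_zero] at this
  linarith [Real.pi_lt_four]

lemma phi_monotone (hb : IsCoeff b a₀ A₀) (h : HalfLineFlow b φ ξ) {u v : ℝ} (hu : 0 ≤ u)
    (huv : u ≤ v) (hξ : ∀ t ∈ Ioo u v, 0 ≤ ξ t) : φ u ≤ φ v :=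
  (h.hasAEDeriv_phi hb hu huv).le_of_nonneg huv
    (Eventually.of_forall fun t ht => div_nonneg (hξ t ht) (hb.pos' t).le)

lemma phi_strictMono (hb : IsCoeff b a₀ A₀) (h : HalfLineFlow b φ ξ) {u v : ℝ} (hu : 0 ≤ u)
    (huv : u < v) (hξ : ∀ t ∈ Ioo u v, 0 < ξ t) : φ u < φ v :=
  (h.hasAEDeriv_phi hb hu huv.le).lt_of_pos huv fun t ht => div_pos (hξ t ht) (hb.pos' t)

/-- Up to a time `y` with `φ y = π/2` the quantity `ξ² - a₀² cos² φ` does not increase; its values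
`ξ(0)² - a₀²` at `0` and `ξ(y)²` at `y` give the bound. -/
lemma le_of_overshoots (hb : IsCoeff b a₀ A₀) (h : HalfLineFlow b φ ξ) (hs : Overshoots φ ξ) :
    a₀ ≤ ξ 0 := by
  obtain ⟨x, hx0, hx, hξ⟩ := hs
  obtain ⟨y, hy, hφy⟩ : ∃ y ∈ Icc 0 x, φ y = Real.pi / 2 :=
    intermediate_value_Icc hx0 h.cont_phi.continuousOn
      ⟨by rw [h.phi_zero]; positivity, hx.le⟩
  have h1 := (h.hasAEDeriv_sq_sub hb a₀ le_rfl hy.1).sub_le_mul hy.1 (C := 0)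
    (Eventually.of_forall fun t ht => by
      have ht' : t ∈ Icc 0 x := ⟨ht.1.le, ht.2.le.trans hy.2⟩
      have e0 : 0 ≤ φ t := by
        have := h.phi_monotone hb le_rfl ht.1.le fun z hz =>
          (hξ z ⟨hz.1.le, hz.2.le.trans ht'.2⟩).le
        rwa [h.phi_zero] at this
      have e1 : φ t ≤ Real.pi / 2 := by
        have := h.phi_monotone hb ht.1.le ht.2.le fun z hz =>
          (hξ z ⟨ht.1.le.trans hz.1.le, hz.2.le.trans hy.2⟩).le
        rwa [hφy] at this
      have hsin := Real.sin_nonneg_of_nonneg_of_le_pi e0 (by linarith [Real.pi_pos])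
      have hcos := Real.cos_nonneg_of_neg_pi_div_two_le_of_le (by linarith [Real.pi_pos]) e1
      have e2 : 0 ≤ 2 * ξ t * Real.sin (φ t) * Real.cos (φ t) / b t :=
        div_nonneg (mul_nonneg (mul_nonneg (mul_nonneg zero_le_two (hξ t ht').le) hsin) hcos)
          (hb.pos' t).le
      exact mul_nonpos_of_nonneg_of_nonpos e2 (by nlinarith [hb.lb t, hb.pos]))
  rw [hφy, h.phi_zero, Real.cos_pi_div_two, Real.cos_zero] at h1
  have h2 := hξ 0 ⟨le_rfl, hx0⟩
  exact abs_le_of_sq_le_sq' (by nlinarith [sq_nonneg (ξ y)]) h2.le |>.2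

/-- A trajectory that neither overshoots nor turns back stays in the admissible region. -/
lemma pos_and_lt (hb : IsCoeff b a₀ A₀) (h : HalfLineFlow b φ ξ) (h0 : 0 < ξ 0)
    (ho : ¬ Overshoots φ ξ) (ht : ¬ TurnsBack φ ξ) {x : ℝ} (hx : 0 ≤ x) :
    0 < ξ x ∧ φ x < Real.pi / 2 := by
  by_contra hcon
  have hpi := Real.pi_pos
  -- The argument looks at the first exit time `z` from the region `ξ > 0`, `φ < π/2`.
  set F : Set ℝ := Ici 0 ∩ ({y | ξ y ≤ 0} ∪ {y | Real.pi / 2 ≤ φ y}) with hF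
  have hFc : IsClosed F := isClosed_Ici.inter ((isClosed_le h.cont_xi continuous_const).union
    (isClosed_le continuous_const h.cont_phi))
  have hxF : x ∈ F := by
    refine ⟨hx, ?_⟩
    by_contra hn
    simp only [mem_union, mem_ofPred_eq, not_or, not_le] at hn
    exact hcon hn
  have hbdd : BddBelow F := ⟨0, fun y hy => hy.1⟩
  set z := sInf F with hz
  have hzF : z ∈ F := hFc.csInf_mem ⟨x, hxF⟩ hbdd
  have hz0 : 0 ≤ z := hzF.1
  have hbefore : ∀ y, 0 ≤ y → y < z → 0 < ξ y ∧ φ y < Real.pi / 2 := by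
    intro y hy hyz
    by_contra hn
    refine absurd (csInf_le hbdd (show y ∈ F from ⟨hy, ?_⟩)) (not_le.2 hyz)
    by_contra hn'
    simp only [mem_union, mem_ofPred_eq, not_or, not_le] at hn'
    exact hn hn'
  have hzpos : 0 < z := by
    refine lt_of_le_of_ne hz0 fun hz' => ?_
    rcases hzF.2 with h1 | h1
    · rw [← hz'] at h1; exact absurd h0 (not_lt.2 h1)
    · rw [← hz', mem_ofPred_eq, h.phi_zero] at h1; linarith
  have hnear : ∀ᶠ y in 𝓝[<] z, 0 ≤ y ∧ y < z := by
    filter_upwards [Ioo_mem_nhdsLT hzpos] with y hy using ⟨hy.1.le, hy.2⟩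
  have hξz : 0 ≤ ξ z := ge_of_tendsto (h.cont_xi.continuousWithinAt.tendsto (s := Iio z))
    (hnear.mono fun y hy => (hbefore y hy.1 hy.2).1.le)
  have hφz : φ z ≤ Real.pi / 2 :=
    le_of_tendsto (h.cont_phi.continuousWithinAt.tendsto (s := Iio z))
      (hnear.mono fun y hy => (hbefore y hy.1 hy.2).2.le)
  have hφ0 : ∀ y, 0 ≤ y → y ≤ z → 0 ≤ φ y := by
    intro y hy hyz
    have := h.phi_monotone hb le_rfl hy fun t ht =>
      (hbefore t ht.1.le (ht.2.trans_le hyz)).1.le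
    rwa [h.phi_zero] at this
  rcases hξz.eq_or_lt with hξ0 | hξpos
  · rcases hφz.eq_or_lt with hφe | hφlt
    -- Exit through the equilibrium corner `ξ = 0`, `φ = π/2`. There `ξ² - A₀² cos² φ` vanishes, so
    -- it was nonpositive before, and Grönwall's inequality forbids `cos φ z = 0`.
    · have hcosle : ∀ t ∈ Ioo 0 z, ξ t ≤ A₀ * Real.cos (φ t) := by
        intro t htz
        have h1 := (h.hasAEDeriv_sq_sub hb A₀ htz.1.le htz.2.le).le_of_nonneg htz.2.le
          (Eventually.of_forall fun y hy => by
            have hy0 : 0 ≤ y := htz.1.le.trans hy.1.le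
            obtain ⟨e1, e2⟩ := hbefore y hy0 hy.2
            have e0 := hφ0 y hy0 hy.2.le
            have hsin := Real.sin_nonneg_of_nonneg_of_le_pi e0 (by linarith)
            have hcos := Real.cos_nonneg_of_neg_pi_div_two_le_of_le (by linarith) e2.le
            have e3 : 0 ≤ 2 * ξ y * Real.sin (φ y) * Real.cos (φ y) / b y :=
              div_nonneg (mul_nonneg (mul_nonneg (mul_nonneg zero_le_two e1.le) hsin) hcos)
                (hb.pos' y).le
            exact mul_nonneg e3 (by nlinarith [hb.ub y, hb.pos' y]))
        rw [hφe, Real.cos_pi_div_two, ← hξ0] at h1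
        have hcos := Real.cos_nonneg_of_neg_pi_div_two_le_of_le
          (by linarith [hφ0 t htz.1.le htz.2.le]) (hbefore t htz.1.le htz.2).2.le
        exact abs_le_of_sq_le_sq' (by nlinarith) (mul_nonneg hb.upper_pos.le hcos) |>.2
      have := h.cos_pos_of_le hb hz0 (fun t htz => (hbefore t htz.1.le htz.2).1.le) hcosle
      rw [hφe, Real.cos_pi_div_two] at this
      exact lt_irrefl _ this
    -- Exit through `ξ = 0` with `0 < φ < π/2`: the force is strictly negative, so `ξ` becomes
    -- negative just after `z` and the trajectory turns back.
    · have hφpos : 0 < φ z := by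
        have := h.phi_strictMono hb le_rfl hzpos fun t htz => (hbefore t htz.1.le htz.2).1
        rwa [h.phi_zero] at this
      obtain ⟨δ, hδ, hball⟩ := Metric.eventually_nhds_iff.1
        (h.cont_phi.continuousAt.eventually (Ioo_mem_nhds hφpos hφlt))
      have hin : ∀ t, z ≤ t → t ≤ z + δ / 2 → φ t ∈ Ioo 0 (Real.pi / 2) := fun t h1 h2 =>
        hball (by rw [Real.dist_eq, abs_of_nonneg] <;> linarith)
      have hlt := (h.hasAEDeriv_xi hb hz0 (show z ≤ z + δ / 2 by linarith)).const_mul (-1)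
        |>.lt_of_pos (by linarith) fun t htz => by
          have e := hin t htz.1.le htz.2.le
          have := mul_pos (mul_pos (hb.pos' t) (Real.sin_pos_of_pos_of_lt_pi e.1
            (by linarith [e.2]))) (Real.cos_pos_of_mem_Ioo ⟨by linarith [e.1], e.2⟩)
          linarith
      refine ht ⟨z + δ / 2, by linarith, by linarith, fun y hy => ?_⟩
      rcases lt_or_ge y z with hyz | hyz
      · exact (hbefore y hy.1 hyz).2
      · exact (hin y hyz hy.2).2
  -- Exit through `φ = π/2` with positive flux: the angle keeps growing and overshoots.
  · have hφe : φ z = Real.pi / 2 := by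
      rcases hzF.2 with h1 | h1
      · exact absurd hξpos (not_lt.2 h1)
      · exact le_antisymm hφz h1
    obtain ⟨δ, hδ, hball⟩ := Metric.eventually_nhds_iff.1
      (h.cont_xi.continuousAt.eventually (lt_mem_nhds hξpos))
    have hin : ∀ t, z ≤ t → t ≤ z + δ / 2 → 0 < ξ t := fun t h1 h2 =>
      hball (by rw [Real.dist_eq, abs_of_nonneg] <;> linarith)
    have hlt := h.phi_strictMono hb hz0 (show z < z + δ / 2 by linarith)
      fun t htz => hin t htz.1.le htz.2.le
    refine ho ⟨z + δ / 2, by linarith, by linarith, fun y hy => ?_⟩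
    rcases lt_or_ge y z with hyz | hyz
    · exact (hbefore y hy.1 hyz).1
    · exact hin y hyz hy.2

/-- Only the limit requires an argument. The angle increases; if it stayed below some `l < π/2`, the
force would be bounded away from `0` after time `1`, and the flux would reach `0` in finite time. -/
lemma halfLineWall (hb : IsCoeff b a₀ A₀) (h : HalfLineFlow b φ ξ)
    (hpos : ∀ x, 0 ≤ x → 0 < ξ x ∧ φ x < Real.pi / 2) : HalfLineWall b φ ξ := by
  have hpi := Real.pi_pos
  have hmono : ∀ x y, 0 ≤ x → x ≤ y → φ x ≤ φ y := fun x y hx hxy =>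
    h.phi_monotone hb hx hxy fun t ht => (hpos t (hx.trans ht.1.le)).1.le
  have hnn : ∀ x, 0 ≤ x → 0 ≤ φ x := fun x hx => by
    have := hmono 0 x le_rfl hx
    rwa [h.phi_zero] at this
  refine ⟨h, hnn, fun x hx => (hpos x hx).2.le, ?_⟩
  have h1 : 0 < φ 1 := by
    have := h.phi_strictMono hb le_rfl zero_lt_one fun t ht => (hpos t ht.1.le).1
    rwa [h.phi_zero] at this
  refine tendsto_order.2 ⟨fun l hl => ?_, fun l hl => ?_⟩
  · obtain ⟨x, hx0, hx⟩ : ∃ x, 0 ≤ x ∧ l < φ x := by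
      by_contra hcon
      push Not at hcon
      set m := Real.sin (φ 1) * Real.cos l with hm
      have hl1 := hcon 1 zero_le_one
      have hs1 := Real.sin_pos_of_pos_of_lt_pi h1 (by linarith)
      have hcl := Real.cos_pos_of_mem_Ioo (x := l) ⟨by linarith, hl⟩
      have hm0 : 0 < m := mul_pos hs1 hcl
      have hle : ∀ x, 1 ≤ x → ξ x - ξ 1 ≤ -(a₀ * m) * (x - 1) := fun x hx =>
        (h.hasAEDeriv_xi hb zero_le_one hx).sub_le_mul hx (Eventually.of_forall fun t ht => by
          have ht0 : 0 ≤ t := zero_le_one.trans ht.1.le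
          have e1 : Real.sin (φ 1) ≤ Real.sin (φ t) :=
            Real.sin_le_sin_of_le_of_le_pi_div_two (by linarith) (hpos t ht0).2.le
              (hmono 1 t zero_le_one ht.1.le)
          have e2 : Real.cos l ≤ Real.cos (φ t) :=
            Real.cos_le_cos_of_nonneg_of_le_pi (hnn t ht0) (by linarith) (hcon t ht0)
          have e3 := mul_le_mul e1 e2 hcl.le (hs1.le.trans e1)
          have e4 := mul_le_mul (hb.lb t) e3 hm0.le (hb.pos' t).le
          linarith)
      have hξ1 := (hpos 1 zero_le_one).1
      have ha := hb.pos
      -- By this time a decay rate of at least `a₀ m` has consumed the whole flux `ξ 1`.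
      have h2 := hle (1 + ξ 1 / (a₀ * m)) (by
        have : 0 < ξ 1 / (a₀ * m) := by positivity
        linarith)
      have h3 : -(a₀ * m) * (1 + ξ 1 / (a₀ * m) - 1) = - ξ 1 := by
        field_simp; ring
      rw [h3] at h2
      have h4 := (hpos (1 + ξ 1 / (a₀ * m)) (by positivity)).1
      linarith
    filter_upwards [eventually_ge_atTop x] with y hy using hx.trans_le (hmono x y hx0 hy)
  · filter_upwards [eventually_ge_atTop 0] with y hy using (hpos y hy).2.trans hl

end HalfLineFlow

/-- The critical flux is the infimum of the overshooting ones. It does not overshoot, because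
overshooting is open and would persist just below it. It does not turn back, because that is also
open, and overshooting fluxes lie arbitrarily close. The lower bound `a₀` keeps it positive. -/
theorem exists_halfLineWall {b : ℝ → ℝ} {a₀ A₀ : ℝ} (hb : IsCoeff b a₀ A₀) :
    ∃ φ ξ : ℝ → ℝ, HalfLineWall b φ ξ := by
  obtain ⟨φ, ξ, hfl, hdep⟩ := exists_flow_family hb
  have hfl' := fun s => (hfl s).1
  set S : Set ℝ := {s | Overshoots (φ s) (ξ s)} with hS
  have hne : S.Nonempty := ⟨3 * A₀, (hfl' _).overshoots_of_large hb (hfl _).2⟩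
  have hlb : ∀ s ∈ S, a₀ ≤ s := fun s hs => by
    have := (hfl' s).le_of_overshoots hb hs
    rwa [(hfl s).2] at this
  have hbdd : BddBelow S := ⟨a₀, hlb⟩
  set s := sInf S with hs
  have hs0 : a₀ ≤ s := le_csInf hne hlb
  have ho : ¬ Overshoots (φ s) (ξ s) := by
    intro hcon
    have h1 := eventually_overshoots hfl' hdep hcon
    have h2 : ∀ᶠ s' in 𝓝[<] s, s' ∈ S ∧ s' < s :=
      (h1.filter_mono nhdsWithin_le_nhds).and self_mem_nhdsWithin
    obtain ⟨s', h3, h4⟩ := h2.exists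
    exact absurd (csInf_le hbdd h3) (not_le.2 h4)
  have ht : ¬ TurnsBack (φ s) (ξ s) := by
    intro hcon
    have h1 := eventually_turnsBack hfl' hdep hcon
    have h2 : s ∈ closure S := csInf_mem_closure hne hbdd
    obtain ⟨s', h3, h4⟩ := mem_closure_iff_nhds.1 h2 _ h1
    exact Overshoots.not_turnsBack h4 h3
  refine ⟨φ s, ξ s, (hfl' s).halfLineWall hb fun x hx => (hfl' s).pos_and_lt hb ?_ ho ht hx⟩
  rw [(hfl s).2]
  exact hb.pos.trans_le hs0

end Pendulum

/-! ### Gluing two half-line walls -/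

namespace Pendulum

lemma locallyIntegrableOn_comp_neg {Ω : Set ℝ} {f : ℝ → ℝ} (hf : LocallyIntegrableOn f Ω volume) :
    LocallyIntegrableOn (fun x => f (-x)) (Neg.neg ⁻¹' Ω) volume := by
  intro x hx
  obtain ⟨s, hs, hi⟩ := hf (-x) hx
  refine ⟨Neg.neg ⁻¹' s, ?_, ?_⟩
  · exact (continuous_neg.continuousWithinAt.tendsto_nhdsWithin (fun y hy => hy)) hs
  · exact ((Measure.measurePreserving_neg volume).integrableOn_comp_preimage
      (Homeomorph.neg ℝ).measurableEmbedding).2 hi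

lemma HasWeakDerivOn.comp_neg {Ω : Set ℝ} {f g : ℝ → ℝ} (h : HasWeakDerivOn Ω f g) :
    HasWeakDerivOn (Neg.neg ⁻¹' Ω) (fun x => f (-x)) (fun x => -g (-x)) := by
  refine ⟨locallyIntegrableOn_comp_neg h.1, (locallyIntegrableOn_comp_neg h.2.1).neg,
    fun ψ hψ hc hs => ?_⟩
  have hts : tsupport (fun x => ψ (-x)) ⊆ Ω := by
    have := tsupport_comp_subset_preimage ψ (continuous_neg (G := ℝ))
    intro x hx
    have := hs (this hx)
    simpa using this
  have e := h.2.2 (fun x => ψ (-x)) (hψ.comp contDiff_neg)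
    (hc.comp_homeomorph (Homeomorph.neg ℝ)) hts
  have e1 := integral_neg_eq_self (fun x => f x * deriv (fun x => ψ (-x)) x) volume
  have e2 := integral_neg_eq_self (fun x => g x * ψ (-x)) volume
  simp only [deriv_comp_neg, neg_neg, mul_neg, neg_mul, integral_neg] at e e1 e2 ⊢
  linarith

lemma HalfLineWall.congr {b φ ξ φ' : ℝ → ℝ} (h : HalfLineWall b φ ξ) (hc : Continuous φ')
    (he : ∀ x, 0 ≤ x → φ' x = φ x) : HalfLineWall b φ' ξ where
  cont_phi := hc
  cont_xi := h.cont_xi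
  phi_eq x hx := by rw [he x hx, h.phi_eq x hx]
  xi_eq x hx := by
    rw [h.xi_eq x hx]
    congr 1
    refine intervalIntegral.integral_congr fun t ht => ?_
    rw [uIcc_of_le hx] at ht
    simp only [he t ht.1]
  phi_nonneg x hx := by rw [he x hx]; exact h.phi_nonneg x hx
  phi_le x hx := by rw [he x hx]; exact h.phi_le x hx
  lim := h.lim.congr' (by
    filter_upwards [eventually_ge_atTop 0] with x hx using (he x hx).symm)

/-- `φ` is a wall profile on `ℝ`: its restriction to `[0, ∞)` is a half-line wall with flux `ξr`,
and its restriction to `(-∞, 0]` is one, after an odd reflection, with flux `ξl`. -/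
structure TwoSidedWall (b φ ξr ξl : ℝ → ℝ) : Prop where
  cont : Continuous φ
  right : HalfLineWall b φ ξr
  left : HalfLineWall (fun x => b (-x)) (fun x => -φ (-x)) ξl

/-- The flux on `ℝ` assembled from the fluxes of the two half-lines. -/
noncomputable def glue (ξr ξl : ℝ → ℝ) (x : ℝ) : ℝ := if 0 < x then ξr x else ξl (-x)

lemma glue_pos {ξr ξl : ℝ → ℝ} {x : ℝ} (hx : 0 < x) : glue ξr ξl x = ξr x := if_pos hx

lemma glue_nonpos {ξr ξl : ℝ → ℝ} {x : ℝ} (hx : x ≤ 0) : glue ξr ξl x = ξl (-x) :=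
  if_neg (not_lt.2 hx)

namespace TwoSidedWall

variable {b φ ξr ξl : ℝ → ℝ} {a₀ A₀ : ℝ}

lemma cont_left (h : TwoSidedWall b φ ξr ξl) : Continuous fun x => ξl (-x) :=
  h.left.cont_xi.comp continuous_neg

lemma measurable_glue (h : TwoSidedWall b φ ξr ξl) : Measurable (glue ξr ξl) :=
  Measurable.ite measurableSet_Ioi h.right.cont_xi.measurable h.cont_left.measurable

lemma glue_bound (hb : IsCoeff b a₀ A₀) (h : TwoSidedWall b φ ξr ξl) (x : ℝ) :
    0 < glue ξr ξl x ∧ glue ξr ξl x ≤ max (ξr 0) (ξl 0) := by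
  rcases lt_or_ge 0 x with hx | hx
  · rw [glue_pos hx]
    exact ⟨h.right.xi_pos hb hx.le, le_max_of_le_left
      (h.right.antitoneOn hb (mem_Ici.2 le_rfl) (mem_Ici.2 hx.le) hx.le)⟩
  · rw [glue_nonpos hx]
    have hx' : 0 ≤ -x := by linarith
    exact ⟨h.left.xi_pos hb.comp_neg hx', le_max_of_le_right
      (h.left.antitoneOn hb.comp_neg (mem_Ici.2 le_rfl) (mem_Ici.2 hx') hx')⟩

lemma continuousOn_glue (h : TwoSidedWall b φ ξr ξl) : ContinuousOn (glue ξr ξl) {0}ᶜ := by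
  intro x hx
  refine ContinuousAt.continuousWithinAt ?_
  rcases lt_or_gt_of_ne (show x ≠ 0 from hx) with hx | hx
  · refine h.cont_left.continuousAt.congr ?_
    filter_upwards [Iio_mem_nhds hx] with y hy using (glue_nonpos (le_of_lt hy)).symm
  · refine h.right.cont_xi.continuousAt.congr ?_
    filter_upwards [Ioi_mem_nhds hx] with y hy using (glue_pos hy).symm

lemma locallyIntegrable_glue_div (hb : IsCoeff b a₀ A₀) (h : TwoSidedWall b φ ξr ξl) :
    LocallyIntegrable (fun x => glue ξr ξl x / b x) volume := by
  refine hb.locallyIntegrable_div ?_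
  rw [locallyIntegrable_iff]
  intro k hk
  refine Measure.integrableOn_of_bounded (M := max (ξr 0) (ξl 0)) hk.measure_lt_top.ne
    h.measurable_glue.aestronglyMeasurable (Eventually.of_forall fun x => ?_)
  have := h.glue_bound hb x
  rw [Real.norm_of_nonneg this.1.le]
  exact this.2

lemma phi_eq_integral (h : TwoSidedWall b φ ξr ξl) (x : ℝ) :
    φ x = ∫ t in (0 : ℝ)..x, glue ξr ξl t / b t := by
  rcases le_total 0 x with hx | hx
  · rw [h.right.phi_eq x hx]
    refine intervalIntegral.integral_congr_ae (Eventually.of_forall fun t ht => ?_)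
    rw [uIoc_of_le hx] at ht
    simp only [glue_pos ht.1]
  · have h1 := h.left.phi_eq (-x) (by linarith)
    rw [neg_neg] at h1
    have h2 := intervalIntegral.integral_comp_neg (fun t => ξl (-t) / b t) (a := 0) (b := -x)
    simp only [neg_neg, neg_zero] at h2
    rw [h2, intervalIntegral.integral_symm, neg_inj] at h1
    rw [h1]
    refine intervalIntegral.integral_congr fun t ht => ?_
    rw [uIcc_of_ge hx] at ht
    simp only [glue_nonpos ht.2]

/-- The odd reflection preserves the force law, so the only possible defect of the equation at `0`
is the jump from `ξl 0` to `ξr 0`. -/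
lemma glue_eq_integral (h : TwoSidedWall b φ ξr ξl) (x : ℝ) :
    glue ξr ξl x = (if 0 < x then ξr 0 else ξl 0) +
      ∫ t in (0 : ℝ)..x, -(b t * Real.sin (φ t) * Real.cos (φ t)) := by
  rw [intervalIntegral.integral_neg]
  rcases lt_or_ge 0 x with hx | hx
  · rw [glue_pos hx, if_pos hx, h.right.xi_eq x hx.le]; ring
  · rw [glue_nonpos hx, if_neg (not_lt.2 hx), h.left.xi_eq (-x) (by linarith)]
    have h2 := intervalIntegral.integral_comp_neg
      (fun t => b t * Real.sin (φ t) * Real.cos (φ t)) (a := 0) (b := -x)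
    simp only [neg_neg, neg_zero] at h2
    simp only [Real.sin_neg, Real.cos_neg, mul_neg, neg_mul, intervalIntegral.integral_neg]
    rw [h2, intervalIntegral.integral_symm]
    ring

lemma hasWeakDerivOn (hb : IsCoeff b a₀ A₀) (h : TwoSidedWall b φ ξr ξl) :
    HasWeakDerivOn univ φ (fun x => glue ξr ξl x / b x) :=
  hasWeakDerivOn_of_integral (h.locallyIntegrable_glue_div hb) (c := 0)
    (fun x => by rw [zero_add]; exact h.phi_eq_integral x)

lemma phi_zero (h : TwoSidedWall b φ ξr ξl) : φ 0 = 0 := h.right.phi_zero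

lemma tendsto_atBot (h : TwoSidedWall b φ ξr ξl) : Tendsto φ atBot (𝓝 (-(Real.pi / 2))) := by
  have := (h.left.lim.comp tendsto_neg_atBot_atTop).neg
  simpa [Function.comp_def] using this

lemma wallConstraints (h : TwoSidedWall b φ ξr ξl) : WallConstraints φ :=
  ⟨h.phi_zero, h.right.lim, h.tendsto_atBot⟩

lemma strictMono (hb : IsCoeff b a₀ A₀) (h : TwoSidedWall b φ ξr ξl) : StrictMono φ := by
  refine StrictMonoOn.Iic_union_Ici (a := 0) (fun x hx y hy hxy => ?_) (h.right.strictMonoOn hb)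
  have := h.left.strictMonoOn hb.comp_neg (mem_Ici.2 (neg_nonneg.2 hy))
    (mem_Ici.2 (neg_nonneg.2 hx)) (neg_lt_neg hxy)
  simp only [neg_neg] at this
  linarith

lemma lipschitz (hb : IsCoeff b a₀ A₀) (h : TwoSidedWall b φ ξr ξl) :
    ∃ K : ℝ≥0, LipschitzWith K φ := by
  have ha := hb.pos
  have hM : 0 ≤ max (ξr 0) (ξl 0) / a₀ :=
    div_nonneg ((h.glue_bound hb 0).1.le.trans (h.glue_bound hb 0).2) ha.le
  refine ⟨⟨_, hM⟩, LipschitzWith.of_dist_le_mul fun x y => ?_⟩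
  have hi := fun u v => intervalIntegrable_of_locallyIntegrable
    (h.locallyIntegrable_glue_div hb) u v
  have e : φ x - φ y = ∫ t in y..x, glue ξr ξl t / b t := by
    rw [h.phi_eq_integral x, h.phi_eq_integral y,
      ← intervalIntegral.integral_add_adjacent_intervals (hi 0 y) (hi y x)]
    ring
  rw [Real.dist_eq, Real.dist_eq, e, ← Real.norm_eq_abs]
  refine intervalIntegral.norm_integral_le_of_norm_le_const fun t _ => ?_
  have := h.glue_bound hb t
  rw [Real.norm_of_nonneg (div_nonneg this.1.le (hb.pos' t).le)]
  exact div_le_div₀ (this.1.le.trans this.2) this.2 ha (hb.lb t)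

lemma mul_weakDeriv_ae_eq (hb : IsCoeff b a₀ A₀) (h : TwoSidedWall b φ ξr ξl) {a : ℝ → ℝ}
    (hab : a =ᵐ[volume] b) : (fun x => a x * weakDeriv φ x) =ᵐ[volume] glue ξr ξl := by
  filter_upwards [hab, (h.hasWeakDerivOn hb).weakDeriv_ae_eq] with x h1 h2
  rw [h1, h2, mul_div_cancel₀ _ (hb.pos' x).ne']

lemma integrable_energy (hb : IsCoeff b a₀ A₀) (h : TwoSidedWall b φ ξr ξl) :
    Integrable (fun x => b x * (glue ξr ξl x / b x) ^ 2 + b x * Real.cos (φ x) ^ 2) volume := by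
  rw [← integrableOn_univ, ← Iio_union_Ici (a := (0 : ℝ)), integrableOn_union,
    integrableOn_Ici_iff_integrableOn_Ioi]
  constructor
  · have := (h.left.integrableOn_energy hb.comp_neg)
    rw [← neg_zero] at this
    refine this.comp_neg_Iio.congr_fun (fun x hx => ?_) measurableSet_Iio
    simp only [neg_neg, Real.cos_neg, glue_nonpos (le_of_lt hx)]
  · exact (h.right.integrableOn_energy hb).congr_fun (fun x hx => by
      simp only [glue_pos hx]) measurableSet_Ioi

lemma memHomH1 (hb : IsCoeff b a₀ A₀) (h : TwoSidedWall b φ ξr ξl) : MemHomH1 φ := by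
  have hw := h.hasWeakDerivOn hb
  refine ⟨h.cont, ⟨_, hw⟩, ?_⟩
  have hm : Measurable (fun x => glue ξr ξl x / b x) := h.measurable_glue.div hb.meas
  refine (memLp_congr_ae hw.weakDeriv_ae_eq).2 ?_
  rw [memLp_two_iff_integrable_sq hm.aestronglyMeasurable]
  refine Integrable.mono' ((h.integrable_energy hb).const_mul a₀⁻¹)
    (hm.pow_const 2).aestronglyMeasurable (Eventually.of_forall fun x => ?_)
  have hB := hb.pos' x
  rw [Real.norm_of_nonneg (by positivity), inv_mul_eq_div, le_div_iff₀ hb.pos]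
  nlinarith [mul_nonneg (sub_nonneg.2 (hb.lb x)) (sq_nonneg (glue ξr ξl x / b x)),
    mul_nonneg hB.le (sq_nonneg (Real.cos (φ x)))]

end TwoSidedWall

/-- Test functions supported away from `0` do not see the jump; this accounts for the jump of the
glued flux. -/
lemma hasWeakDerivOn_step (c d : ℝ) :
    HasWeakDerivOn {0}ᶜ (fun x => if 0 < x then c else d) (fun _ => 0) := by
  have hl : LocallyIntegrable (fun x : ℝ => if 0 < x then c else d) volume := by
    rw [locallyIntegrable_iff]
    intro k hk
    refine Measure.integrableOn_of_bounded (M := max |c| |d|) hk.measure_lt_top.ne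
      (Measurable.ite measurableSet_Ioi measurable_const measurable_const).aestronglyMeasurable
      (Eventually.of_forall fun x => ?_)
    rw [Real.norm_eq_abs]
    split_ifs
    · exact le_max_left _ _
    · exact le_max_right _ _
  refine ⟨hl.locallyIntegrableOn _, (locallyIntegrable_const 0).locallyIntegrableOn _,
    fun ψ hψ hc hs => ?_⟩
  have h0 : ψ 0 = 0 := image_eq_zero_of_notMem_tsupport fun h => hs h rfl
  have hψ1 : ContDiff ℝ 1 ψ := hψ.of_le (by exact_mod_cast le_top)
  have hi := integrable_mul_of_tsupport_subset (hl.locallyIntegrableOn univ)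
    (contDiff_deriv_of_contDiff hψ).continuous hc.deriv (subset_univ _)
  rw [← intervalIntegral.integral_Iic_add_Ioi (b := 0) hi.integrableOn hi.integrableOn,
    setIntegral_congr_fun (g := fun x => d * deriv ψ x) measurableSet_Iic
      (fun x hx => by simp only [if_neg (not_lt.2 (mem_Iic.1 hx))]),
    setIntegral_congr_fun (g := fun x => c * deriv ψ x) measurableSet_Ioi
      (fun x hx => by simp only [if_pos (mem_Ioi.1 hx)]),
    integral_const_mul, integral_const_mul, hc.integral_Iic_deriv_eq hψ1,
    hc.integral_Ioi_deriv_eq hψ1, h0]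
  simp

namespace TwoSidedWall

variable {a b φ ξr ξl : ℝ → ℝ} {a₀ A₀ : ℝ}

lemma locallyIntegrable_neg_force (hb : IsCoeff b a₀ A₀) (hφ : Continuous φ) :
    LocallyIntegrable (fun x => -(b x * Real.sin (φ x) * Real.cos (φ x))) volume :=
  (locallyIntegrable_force hb hφ).neg

lemma solvesPendulumOn_compl (hb : IsCoeff b a₀ A₀) (h : TwoSidedWall b φ ξr ξl)
    (hab : a =ᵐ[volume] b) : SolvesPendulumOn a {0}ᶜ φ := by
  have h1 := (hasWeakDerivOn_of_integral (c := 0) (locallyIntegrable_neg_force hb h.cont)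
    (fun x => rfl)).mono (subset_univ {0}ᶜ)
  have h2 := (hasWeakDerivOn_step (ξr 0) (ξl 0)).add h1
  refine h2.congr (measurableSet_singleton 0).compl ?_ ?_
  · filter_upwards [h.mul_weakDeriv_ae_eq hb hab] with x hx _
    rw [hx, h.glue_eq_integral x]
    simp
  · filter_upwards [hab] with x hx _
    simp only [hx, zero_add]

lemma solvesPendulumOn_univ (hb : IsCoeff b a₀ A₀) (h : TwoSidedWall b φ ξr ξl)
    (hab : a =ᵐ[volume] b) (h0 : ξr 0 = ξl 0) : SolvesPendulumOn a univ φ := by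
  have h1 := hasWeakDerivOn_of_integral (c := ξl 0) (locallyIntegrable_neg_force hb h.cont)
    (fun x => rfl)
  refine h1.congr MeasurableSet.univ ?_ ?_
  · filter_upwards [h.mul_weakDeriv_ae_eq hb hab] with x hx _
    rw [hx, h.glue_eq_integral x, h0, ite_self]
  · filter_upwards [hab] with x hx _
    simp only [hx]

lemma isWallSolution (hb : IsCoeff b a₀ A₀) (h : TwoSidedWall b φ ξr ξl)
    (hab : a =ᵐ[volume] b) : IsWallSolution a φ :=
  ⟨h.memHomH1 hb, h.solvesPendulumOn_compl hb hab, h.wallConstraints, fun x hx =>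
    ⟨by linarith [h.left.phi_le x hx.le], by linarith [h.left.phi_nonneg x hx.le],
      h.right.phi_nonneg x hx.le, h.right.phi_le x hx.le⟩⟩

end TwoSidedWall

/-! ### Wall solutions are exactly two-sided walls -/

theorem exists_twoSidedWall {b : ℝ → ℝ} {a₀ A₀ : ℝ} (hb : IsCoeff b a₀ A₀) :
    ∃ φ ξr ξl, TwoSidedWall b φ ξr ξl := by
  obtain ⟨φr, ξr, hr⟩ := exists_halfLineWall hb
  obtain ⟨φl, ξl, hl⟩ := exists_halfLineWall hb.comp_neg
  set φ : ℝ → ℝ := fun x => if 0 ≤ x then φr x else -φl (-x) with hφ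
  have hc : Continuous φ := by
    refine Continuous.if_le hr.cont_phi (hl.cont_phi.comp continuous_neg).neg continuous_const
      continuous_id fun x hx => ?_
    rw [← hx]
    simp [hr.phi_zero, hl.phi_zero]
  refine ⟨φ, ξr, ξl, hc, hr.congr hc fun x hx => if_pos hx,
    hl.congr (hc.comp continuous_neg).neg fun x hx => ?_⟩
  rcases hx.eq_or_lt with hx | hx
  · rw [← hx]; simp [hφ, hr.phi_zero, hl.phi_zero]
  · have : ¬ 0 ≤ -x := by linarith
    simp [hφ, this]

lemma IsWallSolution.comp_neg {a φ : ℝ → ℝ} (h : IsWallSolution a φ) :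
    IsWallSolution (fun x => a (-x)) (fun x => -φ (-x)) := by
  obtain ⟨⟨hc, hw, hm⟩, hs, ⟨h0, htop, hbot⟩, hr⟩ := h
  have hw' : HasWeakDerivOn univ (fun x => -φ (-x)) (fun x => weakDeriv φ (-x)) := by
    simpa using (hw.hasWeakDerivOn.comp_neg).const_mul (-1)
  have hae := hw'.weakDeriv_ae_eq
  refine ⟨⟨(hc.comp continuous_neg).neg, ⟨_, hw'⟩, (memLp_congr_ae hae).2 ?_⟩, ?_, ?_, ?_⟩
  · exact hm.comp_measurePreserving (Measure.measurePreserving_neg volume)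
  · have h1 := HasWeakDerivOn.comp_neg hs
    have hset : (Neg.neg ⁻¹' ({0}ᶜ : Set ℝ)) = {0}ᶜ := by ext x; simp
    rw [hset] at h1
    refine h1.congr (measurableSet_singleton 0).compl ?_ ?_
    · filter_upwards [hae] with x hx _
      rw [hx]
    · refine Eventually.of_forall fun x _ => ?_
      simp
  · refine ⟨by simp [h0], ?_, ?_⟩
    · simpa [Function.comp_def] using (hbot.comp tendsto_neg_atTop_atBot).neg
    · simpa [Function.comp_def] using (htop.comp tendsto_neg_atBot_atTop).neg
  · intro x hx
    obtain ⟨h1, h2, h3, h4⟩ := hr x hx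
    simp only [neg_neg]
    exact ⟨by linarith, by linarith, by linarith, by linarith⟩

/-- The equation on `(0, ∞)` identifies `a ∂ₓφ` almost everywhere with a primitive of the force.
This primitive is continuous up to `0` and serves as the flux. -/
lemma IsWallSolution.exists_halfLineWall {a b φ : ℝ → ℝ} {a₀ A₀ : ℝ} (hb : IsCoeff b a₀ A₀)
    (hab : a =ᵐ[volume] b) (h : IsWallSolution a φ) : ∃ ξ, HalfLineWall b φ ξ := by
  obtain ⟨⟨hc, hw, hm⟩, hs, ⟨h0, htop, hbot⟩, hr⟩ := h
  have hl := TwoSidedWall.locallyIntegrable_neg_force hb hc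
  have hs' : HasWeakDerivOn (Ioi 0) (fun x => a x * weakDeriv φ x)
      (fun x => -(b x * Real.sin (φ x) * Real.cos (φ x))) := by
    refine HasWeakDerivOn.congr measurableSet_Ioi (HasWeakDerivOn.mono hs ?_)
      (Eventually.of_forall fun x _ => rfl) ?_
    · intro x hx
      exact ne_of_gt hx
    · filter_upwards [hab] with x hx _
      simp only [hx]
  obtain ⟨c, hcx⟩ := hs'.exists_ae_eq_integral isOpen_Ioi ordConnected_Ioi hl
  set ξ : ℝ → ℝ := fun x => c + ∫ t in (0 : ℝ)..x, -(b t * Real.sin (φ t) * Real.cos (φ t))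
    with hξ
  refine ⟨ξ, ⟨hc, ?_, fun x hx => ?_, fun x hx => ?_⟩, fun x hx => ?_, fun x hx => ?_, htop⟩
  · exact continuous_const.add (intervalIntegral.continuous_primitive
      (fun u v => intervalIntegrable_of_locallyIntegrable hl u v) 0)
  · rw [hw.eq_integral hc x, h0, zero_add]
    refine intervalIntegral.integral_congr_ae ?_
    filter_upwards [hcx, hab] with t ht1 ht2 htI
    rw [uIoc_of_le hx] at htI
    have e := ht1 htI.1
    rw [ht2] at e
    rw [eq_div_iff (hb.pos' t).ne', mul_comm]
    exact e
  · simp [hξ, intervalIntegral.integral_neg, sub_eq_add_neg]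
  · rcases hx.eq_or_lt with hx | hx
    · rw [← hx, h0]
    · exact (hr x hx).2.2.1
  · rcases hx.eq_or_lt with hx | hx
    · rw [← hx, h0]; positivity
    · exact (hr x hx).2.2.2

lemma IsWallSolution.exists_twoSidedWall {a b φ : ℝ → ℝ} {a₀ A₀ : ℝ} (hb : IsCoeff b a₀ A₀)
    (hab : a =ᵐ[volume] b) (h : IsWallSolution a φ) : ∃ ξr ξl, TwoSidedWall b φ ξr ξl := by
  obtain ⟨ξr, hr⟩ := h.exists_halfLineWall hb hab
  have hab' : (fun x => a (-x)) =ᵐ[volume] fun x => b (-x) :=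
    (Measure.measurePreserving_neg volume).quasiMeasurePreserving.ae_eq_comp hab
  obtain ⟨ξl, hl⟩ := h.comp_neg.exists_halfLineWall hb.comp_neg hab'
  exact ⟨ξr, ξl, hr.cont_phi, hr, hl⟩

end Pendulum

/-! ### Energy and unique minimality -/

namespace Pendulum

/-- The energy density with coefficient `b` of a function `ψ` with derivative `p`. -/
noncomputable def energyDensity (b ψ p : ℝ → ℝ) (x : ℝ) : ℝ :=
  b x * p x ^ 2 + b x * Real.cos (ψ x) ^ 2

section Energy

variable {a b ψ p : ℝ → ℝ} {a₀ A₀ : ℝ}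

lemma energyDensity_nonneg (hb : IsCoeff b a₀ A₀) (x : ℝ) : 0 ≤ energyDensity b ψ p x := by
  have := hb.pos' x
  unfold energyDensity
  positivity

lemma energy_eq_lintegral (hab : a =ᵐ[volume] b) (h : HasWeakDerivOn univ ψ p) :
    energy a ψ = ∫⁻ x, ENNReal.ofReal (energyDensity b ψ p x) := by
  rw [energy, if_pos ⟨p, h⟩]
  refine lintegral_congr_ae ?_
  filter_upwards [hab, h.weakDeriv_ae_eq] with x h1 h2
  rw [h1, h2, energyDensity]

lemma HasWeakDerivOn.aestronglyMeasurable (h : HasWeakDerivOn univ ψ p) :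
    AEStronglyMeasurable p volume :=
  (locallyIntegrableOn_univ.1 h.2.1).aestronglyMeasurable

lemma HasWeakDerivOn.aestronglyMeasurable' (h : HasWeakDerivOn univ ψ p) :
    AEStronglyMeasurable ψ volume :=
  (locallyIntegrableOn_univ.1 h.1).aestronglyMeasurable

lemma aestronglyMeasurable_energyDensity (hb : IsCoeff b a₀ A₀)
    (hp : AEStronglyMeasurable p volume) (hψ : AEStronglyMeasurable ψ volume) :
    AEStronglyMeasurable (energyDensity b ψ p) volume := by
  have hbm := hb.meas.aestronglyMeasurable (μ := volume)
  exact (hbm.mul (hp.pow 2)).add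
    (hbm.mul ((Real.continuous_cos.comp_aestronglyMeasurable hψ).pow 2))

lemma energy_eq_ofReal (hb : IsCoeff b a₀ A₀) (hab : a =ᵐ[volume] b)
    (h : HasWeakDerivOn univ ψ p) (hi : Integrable (energyDensity b ψ p) volume) :
    energy a ψ = ENNReal.ofReal (∫ x, energyDensity b ψ p x) := by
  rw [energy_eq_lintegral hab h, ofReal_integral_eq_lintegral_ofReal hi
    (Eventually.of_forall fun x => energyDensity_nonneg hb x)]

lemma integrable_of_energy_ne_top (hb : IsCoeff b a₀ A₀) (hab : a =ᵐ[volume] b)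
    (h : HasWeakDerivOn univ ψ p) (he : energy a ψ ≠ ⊤) :
    Integrable (energyDensity b ψ p) volume := by
  rw [energy_eq_lintegral hab h] at he
  exact (lintegral_ofReal_ne_top_iff_integrable
    (aestronglyMeasurable_energyDensity hb h.aestronglyMeasurable h.aestronglyMeasurable')
    (Eventually.of_forall fun x => energyDensity_nonneg hb x)).1 he

end Energy

lemma integral_eq_add_comp_neg {f : ℝ → ℝ} (hf : Integrable f volume) :
    ∫ x, f x = (∫ x in Ioi 0, f x) + ∫ x in Ioi 0, f (-x) := by
  have := integral_comp_neg_Ioi 0 f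
  rw [neg_zero] at this
  rw [this, ← intervalIntegral.integral_Iic_add_Ioi (b := 0) hf.integrableOn hf.integrableOn,
    add_comm]

namespace HalfLineWall

variable {b φ ξ : ℝ → ℝ} {a₀ A₀ : ℝ}

/-- In case of equality the calibration defect `∫ b (cos ψ - cos φ)²` vanishes, so the continuous
functions `cos ψ` and `cos φ` agree on the open half-line. -/
lemma energy_le (hb : IsCoeff b a₀ A₀) (h : HalfLineWall b φ ξ) {ψ p : ℝ → ℝ}
    (hp : LocallyIntegrable p volume) (hψ : ∀ x, 0 ≤ x → ψ x = ∫ t in (0 : ℝ)..x, p t)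
    (hψc : Continuous ψ) (hlim : Tendsto ψ atTop (𝓝 (Real.pi / 2)))
    (hi : IntegrableOn (energyDensity b ψ p) (Ioi 0) volume) :
    (∫ x in Ioi 0, energyDensity b φ (fun x => ξ x / b x) x) ≤
        ∫ x in Ioi 0, energyDensity b ψ p x ∧
      ((∫ x in Ioi 0, energyDensity b ψ p x) ≤
        ∫ x in Ioi 0, energyDensity b φ (fun x => ξ x / b x) x → ∀ x, 0 < x → ψ x = φ x) := by
  obtain ⟨hiD, hle⟩ := h.calibration_Ioi hb hp hψ hψc hlim hi
  have hnn : ∀ x, 0 ≤ b x * (Real.cos (ψ x) - Real.cos (φ x)) ^ 2 := fun x =>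
    mul_nonneg (hb.pos' x).le (sq_nonneg _)
  have hD0 : 0 ≤ ∫ x in Ioi 0, b x * (Real.cos (ψ x) - Real.cos (φ x)) ^ 2 :=
    integral_nonneg hnn
  unfold energyDensity
  refine ⟨by linarith, fun hge => ?_⟩
  have hz : ∫ x in Ioi 0, b x * (Real.cos (ψ x) - Real.cos (φ x)) ^ 2 = 0 := by linarith
  have hae := (setIntegral_eq_zero_iff_of_nonneg_ae (Eventually.of_forall hnn) hiD).1 hz
  have hEq : EqOn (fun x => Real.cos (ψ x)) (fun x => Real.cos (φ x)) (Ioi 0) := by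
    refine Measure.eqOn_open_of_ae_eq (μ := volume) ?_ isOpen_Ioi
      (Real.continuous_cos.comp hψc).continuousOn
      (Real.continuous_cos.comp h.cont_phi).continuousOn
    filter_upwards [hae] with x hx
    have := (mul_eq_zero.1 hx).resolve_left (hb.pos' x).ne'
    exact sub_eq_zero.1 (pow_eq_zero_iff two_ne_zero |>.1 this)
  exact fun x hx => h.eq_of_cos_eq hb hψc hlim (fun y hy => hEq hy) hx

end HalfLineWall

namespace TwoSidedWall

variable {a b φ ξr ξl : ℝ → ℝ} {a₀ A₀ : ℝ}

lemma energy_ne_top (hb : IsCoeff b a₀ A₀) (h : TwoSidedWall b φ ξr ξl) (hab : a =ᵐ[volume] b) :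
    energy a φ ≠ ⊤ := by
  rw [energy_eq_ofReal hb hab (h.hasWeakDerivOn hb) (h.integrable_energy hb)]
  exact ENNReal.ofReal_ne_top

/-- The constraint `ψ 0 = 0` decouples the two half-lines, and the left one is reduced to the right
one by odd reflection. -/
theorem energy_le (hb : IsCoeff b a₀ A₀) (h : TwoSidedWall b φ ξr ξl) (hab : a =ᵐ[volume] b)
    {ψ : ℝ → ℝ} (hψc : Continuous ψ) (hψ : WallConstraints ψ) :
    energy a φ ≤ energy a ψ ∧ (energy a ψ ≤ energy a φ → ψ = φ) := by
  by_cases htop : energy a ψ = ⊤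
  · refine ⟨htop ▸ le_top, fun hle => ?_⟩
    rw [htop, top_le_iff] at hle
    exact absurd hle (h.energy_ne_top hb hab)
  have hw : WeaklyDifferentiable ψ := by
    by_contra hcon
    exact htop (by rw [energy, if_neg hcon])
  obtain ⟨hψ0, hψtop, hψbot⟩ := hψ
  set p := weakDeriv ψ with hp
  have hpl : LocallyIntegrable p volume := hw.locallyIntegrable
  have hiψ := integrable_of_energy_ne_top hb hab hw.hasWeakDerivOn htop
  have hiφ := h.integrable_energy hb
  rw [energy_eq_ofReal hb hab (h.hasWeakDerivOn hb) hiφ,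
    energy_eq_ofReal hb hab hw.hasWeakDerivOn hiψ]
  have hψi : ∀ x, ψ x = ∫ t in (0 : ℝ)..x, p t := fun x => by
    rw [hw.eq_integral hψc x, hψ0, zero_add]
  obtain ⟨r1, r2⟩ := h.right.energy_le hb hpl (fun x _ => hψi x) hψc hψtop hiψ.integrableOn
  have hpl' : LocallyIntegrable (fun x => p (-x)) volume := by
    rw [← locallyIntegrableOn_univ] at hpl ⊢
    exact locallyIntegrableOn_comp_neg hpl
  obtain ⟨l1, l2⟩ := h.left.energy_le hb.comp_neg hpl' (ψ := fun x => -ψ (-x)) (fun x _ => by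
      rw [hψi (-x), intervalIntegral.integral_comp_neg, neg_zero, intervalIntegral.integral_symm,
        neg_neg]) (hψc.comp continuous_neg).neg
    (by simpa [Function.comp_def] using (hψbot.comp tendsto_neg_atTop_atBot).neg)
    (by
      have := hiψ.comp_neg.integrableOn (s := Ioi 0)
      exact this.congr_fun (fun x _ => by simp [energyDensity, hp]) measurableSet_Ioi)
  have eψ := integral_eq_add_comp_neg hiψ
  have eφ := integral_eq_add_comp_neg hiφ
  have el : ∫ x in Ioi 0, energyDensity (fun x => b (-x)) (fun x => -ψ (-x)) (fun x => p (-x)) x =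
      ∫ x in Ioi 0, energyDensity b ψ p (-x) := by
    simp only [energyDensity, Real.cos_neg]
  have el' : ∫ x in Ioi 0, energyDensity (fun x => b (-x)) (fun x => -φ (-x))
      (fun x => ξl x / b (-x)) x = ∫ x in Ioi 0, (b (-x) * (glue ξr ξl (-x) / b (-x)) ^ 2 +
        b (-x) * Real.cos (φ (-x)) ^ 2) := by
    refine setIntegral_congr_fun measurableSet_Ioi fun x hx => ?_
    have : -x ≤ 0 := neg_nonpos.2 (le_of_lt hx)
    simp only [energyDensity, Real.cos_neg, glue_nonpos this, neg_neg]
  have er' : ∫ x in Ioi 0, energyDensity b φ (fun x => ξr x / b x) x =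
      ∫ x in Ioi 0, (b x * (glue ξr ξl x / b x) ^ 2 + b x * Real.cos (φ x) ^ 2) := by
    refine setIntegral_congr_fun measurableSet_Ioi fun x hx => ?_
    simp only [energyDensity, glue_pos (mem_Ioi.1 hx)]
  have eφ' : ∫ x, energyDensity b φ (fun x => glue ξr ξl x / b x) x =
      ∫ x, (b x * (glue ξr ξl x / b x) ^ 2 + b x * Real.cos (φ x) ^ 2) := rfl
  rw [el, el'] at l1 l2
  rw [er'] at r1 r2
  rw [eψ, eφ', eφ]
  refine ⟨ENNReal.ofReal_le_ofReal (by linarith), fun hle => ?_⟩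
  -- The wall energy has to be nonnegative for `ENNReal.ofReal` to be undone. Each half of the
  -- competitor's energy is at least that of the wall, so a total that is no larger forces equality
  -- on both halves.
  have hnn : 0 ≤ ∫ x in Ioi 0, (b x * (glue ξr ξl x / b x) ^ 2 + b x * Real.cos (φ x) ^ 2) :=
    integral_nonneg fun x => energyDensity_nonneg (ψ := φ) (p := fun x => glue ξr ξl x / b x) hb x
  have hnn' : 0 ≤ ∫ x in Ioi 0, (b (-x) * (glue ξr ξl (-x) / b (-x)) ^ 2 +
      b (-x) * Real.cos (φ (-x)) ^ 2) :=
    integral_nonneg fun x =>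
      energyDensity_nonneg (ψ := φ) (p := fun x => glue ξr ξl x / b x) hb (-x)
  have hle' := (ENNReal.ofReal_le_ofReal_iff (by linarith)).1 hle
  have e1 := r2 (by linarith)
  have e2 := l2 (by linarith)
  ext x
  rcases lt_trichotomy x 0 with hx | hx | hx
  · have := e2 (-x) (by linarith)
    simpa using this
  · rw [hx, hψ0, h.phi_zero]
  · exact e1 x hx

lemma isConstrainedMinimizer_iff (hb : IsCoeff b a₀ A₀) (h : TwoSidedWall b φ ξr ξl)
    (hab : a =ᵐ[volume] b) (ψ : ℝ → ℝ) : IsConstrainedMinimizer a ψ ↔ ψ = φ := by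
  constructor
  · rintro ⟨h1, h2, h3⟩
    exact (h.energy_le hb hab h1 h2).2 (h3 φ h.cont h.wallConstraints)
  · rintro rfl
    exact ⟨h.cont, h.wallConstraints, fun χ h1 h2 => (h.energy_le hb hab h1 h2).1⟩

end TwoSidedWall

end Pendulum

/-! ### Differentiating the energy along a line -/

namespace Pendulum

section Calculus

variable {b φ f η p : ℝ → ℝ} {a₀ A₀ : ℝ}

/-- The `t`-derivative of the energy density along `φ + t η`. -/
noncomputable def energyDensityDeriv (b φ f η p : ℝ → ℝ) (t x : ℝ) : ℝ :=
  2 * (b x * (f x + t * p x) * p x) - b x * Real.sin (2 * (φ x + t * η x)) * η x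

/-- The angle `φ` is not in `L²`, but `cos φ` and `η` are; this transfers square integrability to
`cos (φ + t η)`. -/
lemma abs_cos_add_le (x y : ℝ) : |Real.cos (x + y)| ≤ |Real.cos x| + |y| := by
  rw [Real.cos_add]
  refine (abs_sub _ _).trans (add_le_add ?_ ?_)
  · rw [abs_mul]
    exact mul_le_of_le_one_right (abs_nonneg _) (Real.abs_cos_le_one y)
  · rw [abs_mul]
    exact (mul_le_of_le_one_left (abs_nonneg _) (Real.abs_sin_le_one x)).trans Real.abs_sin_le_abs

lemma sq_add_le (x y : ℝ) : (x + y) ^ 2 ≤ 2 * (x ^ 2 + y ^ 2) := by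
  nlinarith [sq_nonneg (x - y)]

lemma integrable_energyDensity_add (hb : IsCoeff b a₀ A₀) (hφ : AEStronglyMeasurable φ volume)
    (hf : MemLp f 2 volume) (hc : MemLp (fun x => Real.cos (φ x)) 2 volume)
    (hp : MemLp p 2 volume) (hη : MemLp η 2 volume) (t : ℝ) :
    Integrable (energyDensity b (fun x => φ x + t * η x) (fun x => f x + t * p x)) volume := by
  have hA := hb.upper_pos
  refine Integrable.mono' ((((hf.integrable_sq.add (hp.integrable_sq.const_mul (t ^ 2))).add
    hc.integrable_sq).add (hη.integrable_sq.const_mul (t ^ 2))).const_mul (2 * A₀))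
    (aestronglyMeasurable_energyDensity hb (hf.1.add (hp.1.const_mul t))
      (hφ.add (hη.1.const_mul t))) (Eventually.of_forall fun x => ?_)
  have hB := hb.pos' x
  have hB' := hb.ub x
  rw [Real.norm_of_nonneg (energyDensity_nonneg hb x)]
  simp only [energyDensity, Pi.add_apply]
  have h1 := sq_add_le (f x) (t * p x)
  have h2 : Real.cos (φ x + t * η x) ^ 2 ≤ 2 * (Real.cos (φ x) ^ 2 + (t * η x) ^ 2) := by
    have e1 := abs_cos_add_le (φ x) (t * η x)
    have e2 : |Real.cos (φ x + t * η x)| ^ 2 ≤ (|Real.cos (φ x)| + |t * η x|) ^ 2 :=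
      pow_le_pow_left₀ (abs_nonneg _) e1 2
    have e3 := sq_add_le |Real.cos (φ x)| |t * η x|
    rw [sq_abs] at e2
    rw [sq_abs, sq_abs] at e3
    linarith
  have h3 := mul_le_mul hB' h1 (sq_nonneg _) hA.le
  have h4 := mul_le_mul hB' h2 (sq_nonneg _) hA.le
  nlinarith

lemma aestronglyMeasurable_energyDensityDeriv (hb : IsCoeff b a₀ A₀)
    (hφ : AEStronglyMeasurable φ volume) (hf : AEStronglyMeasurable f volume)
    (hp : AEStronglyMeasurable p volume) (hη : AEStronglyMeasurable η volume) (t : ℝ) :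
    AEStronglyMeasurable (energyDensityDeriv b φ f η p t) volume := by
  have hbm := hb.meas.aestronglyMeasurable (μ := volume)
  exact (((hbm.mul (hf.add (hp.const_mul t))).mul hp).const_mul 2).sub
    ((hbm.mul (Real.continuous_sin.comp_aestronglyMeasurable
      ((hφ.add (hη.const_mul t)).const_mul 2))).mul hη)

/-- A bound uniform in `|t| ≤ T` for differentiation under the integral. Writing the sine of the
double angle as a product exposes the factor `cos (φ + t η)`, which makes the bound integrable. -/
lemma abs_energyDensityDeriv_le (hb : IsCoeff b a₀ A₀) {t T : ℝ} (ht : |t| ≤ T) (x : ℝ) :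
    |energyDensityDeriv b φ f η p t x| ≤ A₀ * (f x ^ 2 + (1 + 2 * T) * p x ^ 2 +
      Real.cos (φ x) ^ 2 + (1 + 2 * T) * η x ^ 2) := by
  have hA := hb.upper_pos
  have hB := hb.pos' x
  have hB' := hb.ub x
  have h1 : |(f x + t * p x) * p x| ≤ (f x ^ 2 + p x ^ 2) / 2 + T * p x ^ 2 := by
    rw [add_mul]
    refine (abs_add_le _ _).trans (add_le_add ?_ ?_)
    · rw [abs_le]
      constructor <;> nlinarith [sq_nonneg (f x - p x), sq_nonneg (f x + p x)]
    · rw [mul_assoc, abs_mul, ← sq, abs_of_nonneg (sq_nonneg (p x))]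
      exact mul_le_mul_of_nonneg_right ht (sq_nonneg _)
  have h2 : |Real.sin (2 * (φ x + t * η x)) * η x| ≤
      2 * ((Real.cos (φ x) ^ 2 + η x ^ 2) / 2 + T * η x ^ 2) := by
    rw [Real.sin_two_mul, abs_mul, abs_mul, abs_mul, abs_two]
    have e1 := abs_cos_add_le (φ x) (t * η x)
    have e2 := Real.abs_sin_le_one (φ x + t * η x)
    have e3 : |Real.sin (φ x + t * η x)| * |Real.cos (φ x + t * η x)| ≤
        1 * (|Real.cos (φ x)| + T * |η x|) := by
      refine mul_le_mul e2 (e1.trans (add_le_add le_rfl ?_)) (abs_nonneg _) zero_le_one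
      rw [abs_mul]
      exact mul_le_mul_of_nonneg_right ht (abs_nonneg _)
    have e4 := mul_le_mul_of_nonneg_right e3 (abs_nonneg (η x))
    have e5 : |Real.cos (φ x)| * |η x| ≤ (Real.cos (φ x) ^ 2 + η x ^ 2) / 2 := by
      nlinarith [sq_nonneg (|Real.cos (φ x)| - |η x|), sq_abs (Real.cos (φ x)), sq_abs (η x)]
    have e6 : |η x| * |η x| = η x ^ 2 := by rw [← sq, sq_abs]
    have e7 : T * |η x| * |η x| = T * η x ^ 2 := by rw [mul_assoc, e6]
    calc 2 * |Real.sin (φ x + t * η x)| * |Real.cos (φ x + t * η x)| * |η x|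
        = 2 * (|Real.sin (φ x + t * η x)| * |Real.cos (φ x + t * η x)| * |η x|) := by ring
      _ ≤ 2 * (1 * (|Real.cos (φ x)| + T * |η x|) * |η x|) := by linarith
      _ = 2 * (|Real.cos (φ x)| * |η x| + T * |η x| * |η x|) := by ring
      _ ≤ _ := by rw [e7]; linarith
  have e : energyDensityDeriv b φ f η p t x =
      b x * (2 * ((f x + t * p x) * p x) - Real.sin (2 * (φ x + t * η x)) * η x) := by
    unfold energyDensityDeriv; ring
  rw [e, abs_mul, abs_of_pos hB]
  have h3 : |2 * ((f x + t * p x) * p x) - Real.sin (2 * (φ x + t * η x)) * η x| ≤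
      f x ^ 2 + (1 + 2 * T) * p x ^ 2 + Real.cos (φ x) ^ 2 + (1 + 2 * T) * η x ^ 2 := by
    refine (abs_sub _ _).trans ?_
    rw [abs_mul, abs_two]
    linarith
  exact mul_le_mul hB' h3 (abs_nonneg _) hA.le

lemma hasDerivAt_energyDensity (t x : ℝ) :
    HasDerivAt (fun t => energyDensity b (fun x => φ x + t * η x) (fun x => f x + t * p x) x)
      (energyDensityDeriv b φ f η p t x) t := by
  unfold energyDensity energyDensityDeriv
  have h1 : HasDerivAt (fun t : ℝ => f x + t * p x) (p x) t := by
    simpa using ((hasDerivAt_id t).mul_const (p x)).const_add (f x)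
  have h2 : HasDerivAt (fun t : ℝ => φ x + t * η x) (η x) t := by
    simpa using ((hasDerivAt_id t).mul_const (η x)).const_add (φ x)
  have h3 := ((h1.pow 2).const_mul (b x)).add ((h2.cos.pow 2).const_mul (b x))
  refine h3.congr_deriv ?_
  rw [Real.sin_two_mul]
  ring

lemma hasDerivAt_energyDensityDeriv (t x : ℝ) :
    HasDerivAt (fun t => energyDensityDeriv b φ f η p t x)
      (2 * (b x * p x ^ 2 - b x * Real.cos (2 * (φ x + t * η x)) * η x ^ 2)) t := by
  unfold energyDensityDeriv
  have h1 : HasDerivAt (fun t : ℝ => f x + t * p x) (p x) t := by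
    simpa using ((hasDerivAt_id t).mul_const (p x)).const_add (f x)
  have h2 : HasDerivAt (fun t : ℝ => φ x + t * η x) (η x) t := by
    simpa using ((hasDerivAt_id t).mul_const (η x)).const_add (φ x)
  have h3 := (((h1.const_mul (b x)).mul_const (p x)).const_mul 2).sub
    ((((h2.const_mul 2).sin).const_mul (b x)).mul_const (η x))
  refine h3.congr_deriv ?_
  ring

lemma abs_secondDensity_le (hb : IsCoeff b a₀ A₀) (t x : ℝ) :
    |2 * (b x * p x ^ 2 - b x * Real.cos (2 * (φ x + t * η x)) * η x ^ 2)| ≤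
      2 * A₀ * (p x ^ 2 + η x ^ 2) := by
  have hA := hb.upper_pos
  have hB := hb.pos' x
  have h1 : |p x ^ 2 - Real.cos (2 * (φ x + t * η x)) * η x ^ 2| ≤ p x ^ 2 + η x ^ 2 := by
    refine (abs_sub _ _).trans (add_le_add (abs_of_nonneg (sq_nonneg _)).le ?_)
    rw [abs_mul, abs_of_nonneg (sq_nonneg (η x))]
    exact mul_le_of_le_one_left (sq_nonneg _) (Real.abs_cos_le_one _)
  have e : 2 * (b x * p x ^ 2 - b x * Real.cos (2 * (φ x + t * η x)) * η x ^ 2) =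
      2 * b x * (p x ^ 2 - Real.cos (2 * (φ x + t * η x)) * η x ^ 2) := by ring
  rw [e, abs_mul, abs_of_pos (by positivity)]
  exact mul_le_mul (mul_le_mul_of_nonneg_left (hb.ub x) zero_le_two) h1 (abs_nonneg _)
    (by positivity)

lemma aestronglyMeasurable_secondDensity (hb : IsCoeff b a₀ A₀)
    (hφ : AEStronglyMeasurable φ volume) (hp : AEStronglyMeasurable p volume)
    (hη : AEStronglyMeasurable η volume) (t : ℝ) : AEStronglyMeasurable
      (fun x => 2 * (b x * p x ^ 2 - b x * Real.cos (2 * (φ x + t * η x)) * η x ^ 2)) volume := by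
  have hbm := hb.meas.aestronglyMeasurable (μ := volume)
  exact ((hbm.mul (hp.pow 2)).sub ((hbm.mul (Real.continuous_cos.comp_aestronglyMeasurable
      ((hφ.add (hη.const_mul t)).const_mul 2))).mul (hη.pow 2))).const_mul 2

lemma hasDerivAt_integral_energyDensity (hb : IsCoeff b a₀ A₀)
    (hφ : AEStronglyMeasurable φ volume)
    (hf : MemLp f 2 volume) (hc : MemLp (fun x => Real.cos (φ x)) 2 volume)
    (hp : MemLp p 2 volume) (hη : MemLp η 2 volume) (t : ℝ) :
    Integrable (energyDensityDeriv b φ f η p t) volume ∧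
    HasDerivAt (fun t => ∫ x, energyDensity b (fun x => φ x + t * η x) (fun x => f x + t * p x) x)
      (∫ x, energyDensityDeriv b φ f η p t x) t := by
  refine hasDerivAt_integral_of_dominated_loc_of_deriv_le (Metric.ball_mem_nhds t one_pos)
    -- On the unit ball around `t` the parameter is bounded by `T = |t| + 1`.
    (bound := fun x => A₀ * (f x ^ 2 + (1 + 2 * (|t| + 1)) * p x ^ 2 +
      Real.cos (φ x) ^ 2 + (1 + 2 * (|t| + 1)) * η x ^ 2))
    (Eventually.of_forall fun s => (integrable_energyDensity_add hb hφ hf hc hp hη s).1)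
    (integrable_energyDensity_add hb hφ hf hc hp hη t)
    (aestronglyMeasurable_energyDensityDeriv hb hφ hf.1 hp.1 hη.1 t)
    (Eventually.of_forall fun x s hs => ?_) ?_
    (Eventually.of_forall fun x s _ => hasDerivAt_energyDensity s x)
  · refine abs_energyDensityDeriv_le hb ?_ x
    have h1 : |s - t| < 1 := by simpa [Real.dist_eq] using hs
    have h2 := abs_add_le (s - t) t
    rw [sub_add_cancel] at h2
    linarith
  · exact (((hf.integrable_sq.add (hp.integrable_sq.const_mul _)).add hc.integrable_sq).add
      (hη.integrable_sq.const_mul _)).const_mul A₀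

lemma hasDerivAt_integral_energyDensityDeriv (hb : IsCoeff b a₀ A₀)
    (hφ : AEStronglyMeasurable φ volume)
    (hf : MemLp f 2 volume) (hc : MemLp (fun x => Real.cos (φ x)) 2 volume)
    (hp : MemLp p 2 volume) (hη : MemLp η 2 volume) (t : ℝ) :
    Integrable (fun x => 2 * (b x * p x ^ 2 - b x * Real.cos (2 * (φ x + t * η x)) * η x ^ 2))
      volume ∧
    HasDerivAt (fun t => ∫ x, energyDensityDeriv b φ f η p t x)
      (∫ x, 2 * (b x * p x ^ 2 - b x * Real.cos (2 * (φ x + t * η x)) * η x ^ 2)) t :=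
  hasDerivAt_integral_of_dominated_loc_of_deriv_le (Metric.ball_mem_nhds t one_pos)
    (bound := fun x => 2 * A₀ * (p x ^ 2 + η x ^ 2))
    (Eventually.of_forall fun s =>
      aestronglyMeasurable_energyDensityDeriv hb hφ hf.1 hp.1 hη.1 s)
    (hasDerivAt_integral_energyDensity hb hφ hf hc hp hη t).1
    (aestronglyMeasurable_secondDensity hb hφ hp.1 hη.1 t)
    (Eventually.of_forall fun x s _ => abs_secondDensity_le hb s x)
    ((hp.integrable_sq.add hη.integrable_sq).const_mul (2 * A₀))
    (Eventually.of_forall fun x s _ => hasDerivAt_energyDensityDeriv s x)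

end Calculus

namespace TwoSidedWall

variable {a b φ ξr ξl : ℝ → ℝ} {a₀ A₀ : ℝ}

lemma memLp_deriv (hb : IsCoeff b a₀ A₀) (h : TwoSidedWall b φ ξr ξl) :
    MemLp (fun x => glue ξr ξl x / b x) 2 volume :=
  (memLp_congr_ae (h.hasWeakDerivOn hb).weakDeriv_ae_eq).1 (h.memHomH1 hb).2.2

lemma memLp_cos (hb : IsCoeff b a₀ A₀) (h : TwoSidedWall b φ ξr ξl) :
    MemLp (fun x => Real.cos (φ x)) 2 volume := by
  have hm : Continuous (fun x => Real.cos (φ x)) := Real.continuous_cos.comp h.cont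
  rw [memLp_two_iff_integrable_sq hm.aestronglyMeasurable]
  refine Integrable.mono' ((h.integrable_energy hb).const_mul a₀⁻¹)
    (hm.pow 2).aestronglyMeasurable (Eventually.of_forall fun x => ?_)
  have hB := hb.pos' x
  rw [Real.norm_of_nonneg (by positivity), inv_mul_eq_div, le_div_iff₀ hb.pos]
  nlinarith [mul_nonneg (sub_nonneg.2 (hb.lb x)) (sq_nonneg (Real.cos (φ x))),
    mul_nonneg hB.le (sq_nonneg (glue ξr ξl x / b x))]

lemma secondVariationDensity_ae_eq (hab : a =ᵐ[volume] b) {η : ℝ → ℝ} :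
    secondVariationDensity a φ η =ᵐ[volume]
      fun x => b x * weakDeriv η x ^ 2 - b x * Real.cos (2 * φ x) * η x ^ 2 := by
  filter_upwards [hab] with x hx
  rw [secondVariationDensity, hx]

lemma integrable_secondVariationDensity (hb : IsCoeff b a₀ A₀) (h : TwoSidedWall b φ ξr ξl)
    (hab : a =ᵐ[volume] b) {η : ℝ → ℝ} (hη : MemH1 η) :
    Integrable (secondVariationDensity a φ η) volume := by
  have := (hasDerivAt_integral_energyDensityDeriv hb h.cont.aestronglyMeasurable
    (h.memLp_deriv hb) (h.memLp_cos hb) hη.2.2 hη.1 0).1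
  refine Integrable.congr (this.const_mul (1 / 2)) ?_
  filter_upwards [secondVariationDensity_ae_eq (φ := φ) (η := η) hab] with x hx
  rw [hx]
  simp

theorem isHalfSecondDerivOfEnergy (hb : IsCoeff b a₀ A₀) (h : TwoSidedWall b φ ξr ξl)
    (hab : a =ᵐ[volume] b) {η : ℝ → ℝ} (hη : MemH1 η) : IsHalfSecondDerivOfEnergy a φ η := by
  have hφm := h.cont.aestronglyMeasurable (μ := volume)
  have hf := h.memLp_deriv hb
  have hc := h.memLp_cos hb
  obtain ⟨hη2, hηw, hηp⟩ := hη
  have hw : ∀ t : ℝ, HasWeakDerivOn univ (fun x => φ x + t * η x)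
      (fun x => glue ξr ξl x / b x + t * weakDeriv η x) := fun t =>
    (h.hasWeakDerivOn hb).add (hηw.hasWeakDerivOn.const_mul t)
  have hen : ∀ t : ℝ, energy a (fun x => φ x + t * η x) =
      ENNReal.ofReal (∫ x, energyDensity b (fun x => φ x + t * η x)
        (fun x => glue ξr ξl x / b x + t * weakDeriv η x) x) := fun t =>
    energy_eq_ofReal hb hab (hw t) (integrable_energyDensity_add hb hφm hf hc hηp hη2 t)
  have hreal : (fun t : ℝ => (energy a (fun x => φ x + t * η x)).toReal) = fun t =>
      ∫ x, energyDensity b (fun x => φ x + t * η x)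
        (fun x => glue ξr ξl x / b x + t * weakDeriv η x) x := by
    ext t
    rw [hen t, ENNReal.toReal_ofReal (integral_nonneg fun x => energyDensity_nonneg hb x)]
  have hd1 := fun t => (hasDerivAt_integral_energyDensity hb hφm hf hc hηp hη2 t).2
  refine ⟨fun t => by rw [hen t]; exact ENNReal.ofReal_ne_top,
    h.integrable_secondVariationDensity hb hab ⟨hη2, hηw, hηp⟩, ?_, ?_⟩
  · rw [hreal]
    exact fun t => (hd1 t).differentiableAt
  · rw [hreal, funext fun t => (hd1 t).deriv]
    refine (hasDerivAt_integral_energyDensityDeriv hb hφm hf hc hηp hη2 0).2.congr_deriv ?_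
    rw [integral_const_mul, secondVariation,
      integral_congr_ae (secondVariationDensity_ae_eq (φ := φ) (η := η) hab)]
    simp

end TwoSidedWall

end Pendulum

/-! ### Stability for even, monotone coefficients -/

namespace Pendulum

/-- For almost every `x`, monotonicity of `a` gives `b x ≤ b t` for almost all `t > x`, so the
comparison constant may be taken to be `b x` itself. -/
lemma HalfLineWall.ae_cos_le {a b φ ξ : ℝ → ℝ} {a₀ A₀ : ℝ} (hb : IsCoeff b a₀ A₀)
    (h : HalfLineWall b φ ξ) (hab : a =ᵐ[volume] b) (ha : MonotoneOn a (Ioi 0)) :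
    ∀ᵐ x, 0 < x → b x * Real.cos (φ x) ≤ ξ x := by
  filter_upwards [hab] with x hx hx0
  refine h.mul_cos_le_xi hb hx0.le (hb.pos' x).le ?_
  filter_upwards [hab] with t ht htx
  rw [← hx, ← ht]
  exact ha hx0 (mem_Ioi.2 (hx0.trans htx)) htx.le

/-- Applied to `η(R)² + η(-R)²`, this supplies large radii with negligible boundary terms, without
any pointwise decay of `η`. -/
lemma frequently_lt_of_integrable {f : ℝ → ℝ} (hf : Integrable f volume) {ε : ℝ} (hε : 0 < ε) :
    ∃ᶠ x in atTop, f x < ε := by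
  intro hcon
  obtain ⟨N, hN⟩ := eventually_atTop.1 hcon
  have h1 : IntegrableOn (fun _ : ℝ => ε) (Ioi N) volume := by
    refine Integrable.mono' hf.norm.integrableOn aestronglyMeasurable_const
      ((ae_restrict_iff' measurableSet_Ioi).2 (Eventually.of_forall fun x hx => ?_))
    rw [Real.norm_of_nonneg hε.le]
    exact (not_lt.1 (hN x (le_of_lt hx))).trans (Real.le_norm_self _)
  rw [integrableOn_const_iff] at h1
  simp [hε.ne'] at h1

namespace TwoSidedWall

variable {a b φ ξr ξl : ℝ → ℝ} {a₀ A₀ : ℝ}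

lemma cos_pos (hb : IsCoeff b a₀ A₀) (h : TwoSidedWall b φ ξr ξl) (x : ℝ) :
    0 < Real.cos (φ x) := by
  rcases le_total 0 x with hx | hx
  · exact h.right.cos_pos hb hx
  · simpa using h.left.cos_pos hb.comp_neg (neg_nonneg.2 hx)

lemma glue_le_mul_cos (hb : IsCoeff b a₀ A₀) (h : TwoSidedWall b φ ξr ξl) (x : ℝ) :
    glue ξr ξl x ≤ A₀ * Real.cos (φ x) := by
  rcases lt_or_ge 0 x with hx | hx
  · rw [glue_pos hx]
    exact h.right.xi_le_mul_cos hb hx.le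
  · rw [glue_nonpos hx]
    simpa using h.left.xi_le_mul_cos hb.comp_neg (neg_nonneg.2 hx)

lemma ae_mul_cos_le_glue (hb : IsCoeff b a₀ A₀) (h : TwoSidedWall b φ ξr ξl)
    (hab : a =ᵐ[volume] b) (he : Function.Even a) (ha : MonotoneOn a (Ioi 0)) :
    ∀ᵐ x, b x * Real.cos (φ x) ≤ glue ξr ξl x := by
  have hab' : a =ᵐ[volume] fun x => b (-x) := by
    have := (Measure.measurePreserving_neg volume).quasiMeasurePreserving.ae_eq_comp hab
    filter_upwards [this] with x hx
    simpa [he x] using hx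
  have h2 := (Measure.measurePreserving_neg volume).quasiMeasurePreserving.ae
    (h.left.ae_cos_le hb.comp_neg hab' ha)
  have h0 : ∀ᵐ x : ℝ, x ≠ 0 := compl_mem_ae_iff.2 (measure_singleton 0)
  filter_upwards [h.right.ae_cos_le hb hab ha, h2, h0] with x h1 h2 h0
  rcases lt_or_gt_of_ne h0 with hx | hx
  · rw [glue_nonpos hx.le]
    simpa using h2 (neg_pos.2 hx)
  · rw [glue_pos hx]
    exact h1 hx

/-- By symmetry both half-lines carry the same force, so `ξr - ξl` is constant; it vanishes because
both fluxes tend to `0`. -/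
lemma flux_eq_of_odd (hb : IsCoeff b a₀ A₀) (h : TwoSidedWall b φ ξr ξl)
    (he : (fun x => b (-x)) =ᵐ[volume] b) (ho : Function.Odd φ) : ξr 0 = ξl 0 := by
  have key : ∀ R, 0 ≤ R → ξr R - ξl R = ξr 0 - ξl 0 := by
    intro R hR
    rw [h.right.xi_eq R hR, h.left.xi_eq R hR]
    have : ∫ t in (0 : ℝ)..R, b (-t) * Real.sin (-φ (-t)) * Real.cos (-φ (-t)) =
        ∫ t in (0 : ℝ)..R, b t * Real.sin (φ t) * Real.cos (φ t) := by
      refine intervalIntegral.integral_congr_ae ?_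
      filter_upwards [he] with t ht _
      rw [ht, ho t, neg_neg]
    rw [this]
    ring
  have h1 := (h.right.tendsto_xi hb).sub (h.left.tendsto_xi hb.comp_neg)
  have h2 : Tendsto (fun R => ξr R - ξl R) atTop (𝓝 (ξr 0 - ξl 0)) :=
    tendsto_const_nhds.congr' (by
      filter_upwards [eventually_ge_atTop 0] with R hR using (key R hR).symm)
  have := tendsto_nhds_unique h1 h2
  linarith

/-- The square completion `b η'² - b cos (2φ) η² + (b φ' tan φ η²)' ≥ 0` integrated over
`[-R, R]`. -/
lemma neg_boundary_le_integral (hb : IsCoeff b a₀ A₀) (h : TwoSidedWall b φ ξr ξl)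
    (h0 : ξr 0 = ξl 0) (hcos : ∀ᵐ x, b x * Real.cos (φ x) ≤ glue ξr ξl x)
    {η p : ℝ → ℝ} {R : ℝ} (hR : 0 ≤ R) (hη : HasAEDeriv η p (-R) R)
    (hi : IntervalIntegrable (fun x => b x * p x ^ 2 - b x * Real.cos (2 * φ x) * η x ^ 2)
      volume (-R) R) :
    -(A₀ * (η R ^ 2 + η (-R) ^ 2)) ≤
      ∫ x in -R..R, (b x * p x ^ 2 - b x * Real.cos (2 * φ x) * η x ^ 2) := by
  have hR' : -R ≤ R := by linarith
  have hfi := fun u v => intervalIntegrable_of_locallyIntegrable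
    (h.locallyIntegrable_glue_div hb) u v
  have hgi := fun u v => intervalIntegrable_of_locallyIntegrable
    (locallyIntegrable_neg_force hb h.cont) u v
  have hφ : HasAEDeriv φ (fun x => glue ξr ξl x / b x) (-R) R :=
    HasAEDeriv.of_integral hR' (hfi _ _) (c := φ (-R)) fun x _ => by
      rw [h.phi_eq_integral x, h.phi_eq_integral (-R),
        ← intervalIntegral.integral_add_adjacent_intervals (hfi 0 (-R)) (hfi (-R) x)]
  -- Equality of the one-sided fluxes makes the glued flux absolutely continuous across `0`.
  have hξ : HasAEDeriv (glue ξr ξl) (fun x => -(b x * Real.sin (φ x) * Real.cos (φ x))) (-R) R :=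
    HasAEDeriv.of_integral hR' (hgi _ _) (c := glue ξr ξl (-R)) fun x _ => by
      rw [h.glue_eq_integral x, h.glue_eq_integral (-R), h0, ite_self, ite_self,
        ← intervalIntegral.integral_add_adjacent_intervals (hgi 0 (-R)) (hgi (-R) x)]
      ring
  have hc : ∀ x, Real.cos (φ x) ≠ 0 := fun x => (h.cos_pos hb x).ne'
  have hT := ((hξ.mul (hφ.sin hR')).mul ((hφ.cos hR').inv hR' fun x _ => hc x)).mul (hη.mul hη)
  have hq := (intervalIntegral.integral_add hi (hT.intervalIntegrable hR')).symm
  rw [hT.integral_eq hR'] at hq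
  have hnn : 0 ≤ ∫ x in -R..R, ((b x * p x ^ 2 - b x * Real.cos (2 * φ x) * η x ^ 2) +
      (((-(b x * Real.sin (φ x) * Real.cos (φ x)) * Real.sin (φ x) +
        glue ξr ξl x * (Real.cos (φ x) * (glue ξr ξl x / b x))) * (Real.cos (φ x))⁻¹ +
        glue ξr ξl x * Real.sin (φ x) *
          (-(Real.cos (φ x) ^ 2)⁻¹ * (-Real.sin (φ x) * (glue ξr ξl x / b x)))) *
        (η x * η x) +
      glue ξr ξl x * Real.sin (φ x) * (Real.cos (φ x))⁻¹ * (p x * η x + η x * p x))) := by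
    refine intervalIntegral.integral_nonneg_of_ae hR' ?_
    filter_upwards [hcos] with x hx
    have hB := hb.pos' x
    have hcx := h.cos_pos hb x
    -- Completing the square leaves `η² (ξ² - b² cos² φ) / b`, which is nonnegative by `b cos φ ≤
    -- ξ`.
    have e : (b x * p x ^ 2 - b x * Real.cos (2 * φ x) * η x ^ 2) +
      (((-(b x * Real.sin (φ x) * Real.cos (φ x)) * Real.sin (φ x) +
        glue ξr ξl x * (Real.cos (φ x) * (glue ξr ξl x / b x))) * (Real.cos (φ x))⁻¹ +
        glue ξr ξl x * Real.sin (φ x) *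
          (-(Real.cos (φ x) ^ 2)⁻¹ * (-Real.sin (φ x) * (glue ξr ξl x / b x)))) *
        (η x * η x) +
      glue ξr ξl x * Real.sin (φ x) * (Real.cos (φ x))⁻¹ * (p x * η x + η x * p x)) =
      b x * (p x + glue ξr ξl x * Real.sin (φ x) / (Real.cos (φ x) * b x) * η x) ^ 2 +
        η x ^ 2 * ((glue ξr ξl x ^ 2 - (b x * Real.cos (φ x)) ^ 2) / b x) := by
      rw [Real.cos_two_mul']
      field_simp
      ring
    have e2 : (b x * Real.cos (φ x)) ^ 2 ≤ glue ξr ξl x ^ 2 :=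
      pow_le_pow_left₀ (by positivity) hx 2
    have e3 : 0 ≤ (glue ξr ξl x ^ 2 - (b x * Real.cos (φ x)) ^ 2) / b x :=
      div_nonneg (sub_nonneg.2 e2) hB.le
    simp only [Pi.zero_apply]
    rw [e]
    positivity
  rw [← hq] at hnn
  -- The bound `ξ ≤ A₀ cos φ` absorbs the singular factor `1 / cos φ` of the tangent.
  have hbd : ∀ x, |glue ξr ξl x * Real.sin (φ x) * (Real.cos (φ x))⁻¹ * (η x * η x)| ≤
      A₀ * η x ^ 2 := by
    intro x
    have hcx := h.cos_pos hb x
    have hg := (h.glue_bound hb x).1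
    rw [abs_mul, abs_mul, abs_mul, abs_of_pos hg, abs_of_pos (inv_pos.2 hcx), abs_mul_self, ← sq]
    refine mul_le_mul_of_nonneg_right ?_ (sq_nonneg _)
    rw [← div_eq_mul_inv, div_le_iff₀ hcx]
    exact (mul_le_of_le_one_right hg.le (Real.abs_sin_le_one _)).trans (h.glue_le_mul_cos hb x)
  have b1 := (abs_le.1 (hbd R)).2
  have b2 := (abs_le.1 (hbd (-R))).1
  linarith

theorem secondVariation_nonneg (hb : IsCoeff b a₀ A₀) (h : TwoSidedWall b φ ξr ξl)
    (hab : a =ᵐ[volume] b) (h0 : ξr 0 = ξl 0)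
    (hcos : ∀ᵐ x, b x * Real.cos (φ x) ≤ glue ξr ξl x) {η : ℝ → ℝ} (hη : MemH1 η) :
    0 ≤ secondVariation a φ η := by
  have hA := hb.upper_pos
  obtain ⟨c, hc⟩ := hη.2.1.exists_ae_eq_integral
  set p := weakDeriv η with hp
  -- Boundary values of `η` make sense only for its absolutely continuous representative `e`.
  set e : ℝ → ℝ := fun x => c + ∫ t in (0 : ℝ)..x, p t with he
  have hpl : LocallyIntegrable p volume := hη.2.1.locallyIntegrable
  have hpi := fun u v => intervalIntegrable_of_locallyIntegrable hpl u v
  have hQ : secondVariationDensity a φ η =ᵐ[volume]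
      fun x => b x * p x ^ 2 - b x * Real.cos (2 * φ x) * e x ^ 2 := by
    filter_upwards [secondVariationDensity_ae_eq (φ := φ) (η := η) hab, hc] with x h1 h2
    rw [h1, h2]
  have hQi := (h.integrable_secondVariationDensity hb hab hη).congr hQ
  rw [secondVariation, integral_congr_ae hQ]
  have he2 : Integrable (fun x => e x ^ 2) volume := by
    refine hη.1.integrable_sq.congr ?_
    filter_upwards [hc] with x hx
    rw [hx]
  have hsum : Integrable (fun x => e x ^ 2 + e (-x) ^ 2) volume := he2.add he2.comp_neg
  have hlim := intervalIntegral_tendsto_integral hQi tendsto_neg_atTop_atBot tendsto_id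
  by_contra hneg
  push Not at hneg
  set I := ∫ x, (b x * p x ^ 2 - b x * Real.cos (2 * φ x) * e x ^ 2) with hI
  -- If the integral `I` were negative, some `R` would have truncated integral below `I / 2` and
  -- boundary terms, weighted by `A₀`, below `-I / 2`, contradicting the boundary estimate.
  have hev := hlim.eventually (gt_mem_nhds (show I < I / 2 by linarith))
  have hfr := frequently_lt_of_integrable hsum (show 0 < -I / 2 / A₀ by
    apply div_pos <;> linarith)
  obtain ⟨R, hR1, hR2, hR3⟩ := (hfr.and_eventually (hev.and (eventually_ge_atTop 0))).exists
  have hAE : HasAEDeriv e p (-R) R :=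
    HasAEDeriv.of_integral (by linarith) (hpi _ _) (c := e (-R)) fun x _ => by
      simp only [he]
      rw [← intervalIntegral.integral_add_adjacent_intervals (hpi 0 (-R)) (hpi (-R) x)]
      ring
  have hfin := h.neg_boundary_le_integral hb h0 hcos hR3 hAE hQi.intervalIntegrable
  rw [lt_div_iff₀ hA] at hR1
  simp only [id] at hR2
  linarith

end TwoSidedWall

/-! ### Reduction to pointwise bounds, uniqueness and conclusion -/

/-- A measurable version of `a` is truncated to `[a₀, A₀]`. Evenness and monotonicity need not
survive pointwise, so they are used through `a` and almost everywhere. -/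
lemma exists_isCoeff {a : ℝ → ℝ} {a₀ A₀ : ℝ} (ha_meas : AEMeasurable a volume) (ha₀ : 0 < a₀)
    (ha : ∀ᵐ x ∂(volume : Measure ℝ), a₀ ≤ a x ∧ a x ≤ A₀) :
    ∃ b, IsCoeff b a₀ A₀ ∧ a =ᵐ[volume] b := by
  obtain ⟨x, hx⟩ := ha.exists
  have hle : a₀ ≤ A₀ := hx.1.trans hx.2
  refine ⟨fun x => max a₀ (min (ha_meas.mk a x) A₀), ⟨?_, ha₀, fun x => le_max_left _ _,
    fun x => max_le hle (min_le_right _ _)⟩, ?_⟩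
  · exact measurable_const.max (ha_meas.measurable_mk.min measurable_const)
  · filter_upwards [ha, ha_meas.ae_eq_mk] with x h1 h2
    rw [← h2, min_eq_left h1.2, max_eq_right h1.1]

/-- Any two solutions are two-sided walls, so each of them is the unique constrained minimizer. -/
theorem existsUnique_isWallSolution {a b : ℝ → ℝ} {a₀ A₀ : ℝ} (hb : IsCoeff b a₀ A₀)
    (hab : a =ᵐ[volume] b) : ∃! φ, IsWallSolution a φ := by
  obtain ⟨φ, ξr, ξl, h⟩ := exists_twoSidedWall hb
  refine ⟨φ, h.isWallSolution hb hab, fun ψ hψ => ?_⟩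
  obtain ⟨ζr, ζl, hψ'⟩ := hψ.exists_twoSidedWall hb hab
  exact (h.isConstrainedMinimizer_iff hb hab ψ).1 ((hψ'.isConstrainedMinimizer_iff hb hab ψ).2 rfl)

/-- The odd reflection of a solution solves the problem with the reflected coefficient, which is the
same one. -/
lemma IsWallSolution.odd {a b φ : ℝ → ℝ} {a₀ A₀ : ℝ} (hb : IsCoeff b a₀ A₀)
    (hab : a =ᵐ[volume] b) (he : Function.Even a) (h : IsWallSolution a φ) : Function.Odd φ := by
  have h1 := h.comp_neg
  have h2 : (fun x => a (-x)) = a := funext he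
  rw [h2] at h1
  have h3 := congrFun ((existsUnique_isWallSolution hb hab).unique h h1)
  intro x
  rw [h3 (-x), neg_neg]

lemma TwoSidedWall.memW1Infty {a b φ ξr ξl : ℝ → ℝ} {a₀ A₀ : ℝ} (hb : IsCoeff b a₀ A₀)
    (h : TwoSidedWall b φ ξr ξl) (hab : a =ᵐ[volume] b) :
    MemW1Infty {0}ᶜ (fun x => a x * weakDeriv φ x) := by
  have hflux := h.mul_weakDeriv_ae_eq hb hab
  refine ⟨?_, _, h.solvesPendulumOn_compl hb hab, ?_⟩
  · refine MemLp.restrict _ ((memLp_congr_ae hflux).2 ?_)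
    refine memLp_top_of_bound h.measurable_glue.aestronglyMeasurable (max (ξr 0) (ξl 0))
      (Eventually.of_forall fun x => ?_)
    rw [Real.norm_of_nonneg (h.glue_bound hb x).1.le]
    exact (h.glue_bound hb x).2
  · have hforce : (fun x => -(a x * Real.sin (φ x) * Real.cos (φ x))) =ᵐ[volume]
        fun x => -(b x * Real.sin (φ x) * Real.cos (φ x)) := by
      filter_upwards [hab] with x hx
      rw [hx]
    refine MemLp.restrict _ ((memLp_congr_ae hforce).2 ?_)
    refine memLp_top_of_bound (locallyIntegrable_neg_force hb h.cont).aestronglyMeasurable A₀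
      (Eventually.of_forall fun x => ?_)
    rw [norm_neg]
    exact abs_force_le hb x (φ x)

end Pendulum

theorem theorem2 (a : ℝ → ℝ) (a₀ A₀ : ℝ) (ha_meas : AEMeasurable a volume) (ha₀ : 0 < a₀)
    (ha : ∀ᵐ x ∂(volume : Measure ℝ), a₀ ≤ a x ∧ a x ≤ A₀) :
    (∃! φ : ℝ → ℝ, Pendulum.IsWallSolution a φ) ∧
    ∀ φ : ℝ → ℝ, Pendulum.IsWallSolution a φ →
      (∃ K : ℝ≥0, LipschitzWith K φ) ∧
      StrictMono φ ∧
      Pendulum.MemW1Infty {0}ᶜ (fun x => a x * Pendulum.weakDeriv φ x) ∧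
      (∃ ξ : ℝ → ℝ, ξ =ᵐ[volume] (fun x => a x * Pendulum.weakDeriv φ x) ∧
        ContinuousOn ξ {0}ᶜ ∧ ∀ x : ℝ, x ≠ 0 → 0 < ξ x) ∧
      Pendulum.energy a φ ≠ ⊤ ∧
      (∀ ψ : ℝ → ℝ, Pendulum.IsConstrainedMinimizer a ψ ↔ ψ = φ) ∧
      (Function.Even a → MonotoneOn a (Ioi 0) →
        Function.Odd φ ∧
        Pendulum.SolvesPendulumOn a univ φ ∧
        ∀ η : ℝ → ℝ, Pendulum.MemH1 η →
          Pendulum.IsHalfSecondDerivOfEnergy a φ η ∧ 0 ≤ Pendulum.secondVariation a φ η) := by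
  obtain ⟨b, hb, hab⟩ := Pendulum.exists_isCoeff ha_meas ha₀ ha
  refine ⟨Pendulum.existsUnique_isWallSolution hb hab, fun φ hφ => ?_⟩
  obtain ⟨ξr, ξl, h⟩ := hφ.exists_twoSidedWall hb hab
  refine ⟨h.lipschitz hb, h.strictMono hb, h.memW1Infty hb hab,
    ⟨Pendulum.glue ξr ξl, (h.mul_weakDeriv_ae_eq hb hab).symm, h.continuousOn_glue,
      fun x _ => (h.glue_bound hb x).1⟩, h.energy_ne_top hb hab,
    h.isConstrainedMinimizer_iff hb hab, fun heven hmono => ?_⟩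
  have hodd := hφ.odd hb hab heven
  have hbeven : (fun x => b (-x)) =ᵐ[volume] b := by
    have := (Measure.measurePreserving_neg volume).quasiMeasurePreserving.ae_eq_comp hab
    filter_upwards [this, hab] with x h1 h2
    rw [← h2, ← heven x]
    exact h1.symm
  have h0 := h.flux_eq_of_odd hb hbeven hodd
  exact ⟨hodd, h.solvesPendulumOn_univ hb hab h0, fun η hη =>
    ⟨h.isHalfSecondDerivOfEnergy hb hab hη, h.secondVariation_nonneg hb hab h0
      (h.ae_mul_cos_le_glue hb hab heven hmono) hη⟩⟩
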